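/- Let $p\ge 1$, let $0<\theta_1<\dots<\theta_p$ and $\gamma_1,\dots,\gamma_p$ be real numbers and let $n_1,\dots,n_p\ge 1$ be integers. Let $X=\sum_{i=1}^p \frac{1}{2\theta_i}\chi^2_{n_i}\!\big(\frac{\gamma_i^2}{2\theta_i}\big)$ be a linear combination of independent (noncentral) chi-square variables, where $\chi^2_k(\delta)$ has $k$ degrees of freedom and noncentrality $\delta$. Put $$g(t)=\frac{\exp\big(\sum_{i}\frac{\gamma_i^2}{4(\theta_i+t)}\big)}{\prod_{i}(\theta_i+t)^{n_i/2}},\qquad \kappa=\prod_{i}\theta_i^{n_i/2}\,\exp\Big(-\sum_{i}\frac{\gamma_i^2}{4\theta_i}\Big)$$ (principal branches of the powers), and let, for $s>0$, $$f_{\theta,\gamma^2,n}(s)=\frac{\kappa}{2\pi i}\lim_{R\to\infty}\int_{t_0-iR}^{t_0+iR}g(t)e^{st}\,dt,\qquad t_0>-\theta_1 ,$$ and $f_{\theta,\gamma^2,n}(s)=0$ for $s\le 0$. Branch cuts and type 1 poles: list the $\theta_i$ with odd $n_i$ in increasing order and pair the first with the second, the third with the fourth, and so on. A pair $\theta_i<\theta_j$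 gives the branch cut $[-\theta_j,-\theta_i]$; if the number of odd $n_i$ is odd, the last such $\theta_i$ gives the unbounded cut $(-\infty,-\theta_i]$. Let $C_1,\dots,C_r$ be these cuts. An index $j$ with $n_j$ even is of type 1 if the number of $i<j$ with $n_i$ odd is even (equivalently, $-\theta_j$ lies on no cut); let $-\theta_{j_1},\dots,-\theta_{j_l}$ be the corresponding points. **Density.** The limit exists for all $s>0$ and $t_0>-\theta_1$ and does not depend on $t_0$, the function $f_{\theta,\gamma^2,n}$ is a probability density function of $X$, and for all $s>0$ $$f_{\theta,\gamma^2,n}(s)=\frac{f_{s\theta,s\gamma^2,n}(1)}{s}=\kappa\Big(\frac{1}{2\pi i}\sum_{k=1}^{r}\int_{\Gamma^k}g(t)e^{st}\,dt+\frac{1}{2\pi i}\sum_{m=1}^{l}\int_{\Gamma^m_\varepsilon}g(t)e^{st}\,dt\Big)$$ for every choice of piecewise $C^1$ contours, avoiding all cuts and type 1 poles, of the following kind (and such contours exist). If $C_k$ is bounded, $\Gamma^k$ is a closed contour that runs once anticlockwise around $C_k$ (winding number $1$) and does not run around the other cuts and the type 1 poles (winding number $0$). If $C_k$ is unbounded,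 $\Gamma^k$ is a keyhole contour that comes from $\operatorname{Re}t=-\infty$ in the lower half-plane, passes around the end of $C_k$, returns to $\operatorname{Re}t=-\infty$ in the upper half-plane, and does not run around the other cuts and the type 1 poles; the integral along it is the convergent improper integral. Finally, $\Gamma^m_\varepsilon$ is a closed contour (for example a small circle) that runs once anticlockwise around $-\theta_{j_m}$ and not around the cuts and the other type 1 poles. **Distribution function.** For every $\theta_0>0$ let $\tilde X=\frac{1}{2\theta_0}\chi^2_2(0)+\sum_{i=1}^p\frac{1}{2(\theta_i+\theta_0)}\chi^2_{n_i}\!\big(\frac{\gamma_i^2}{2(\theta_i+\theta_0)}\big)$ (independent summands), and put $\tilde\theta=(\theta_0,\theta_1+\theta_0,\dots,\theta_p+\theta_0)$, $\tilde\gamma^2=(0,\gamma_1^2,\dots,\gamma_p^2)$, $\tilde n=(2,n_1,\dots,n_p)$. Then $f_{\tilde\theta,\tilde\gamma^2,\tilde n}$ is a probability density function of $\tilde X$, and for all $x>0$ $$P(X\le x)=\frac{e^{x\theta_0}}{\theta_0}f_{\tilde\theta,\tilde\gamma^2,\tilde n}(x)\prod_{i=1}^p\Big(\frac{\theta_i}{\theta_i+\theta_0}\Big)^{n_i/2}\exp\Big(-\sum_{i=1}^p\frac{\gamma_i^2\theta_0}{4\theta_i(\theta_i+\theta_0)}\Big)$$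 $$\phantom{P(X\le x)}=\frac{e^{x\theta_0}}{x\theta_0}f_{x\tilde\theta,x\tilde\gamma^2,\tilde n}(1)\prod_{i=1}^p\Big(\frac{\theta_i}{\theta_i+\theta_0}\Big)^{n_i/2}\exp\Big(-\sum_{i=1}^p\frac{\gamma_i^2\theta_0}{4\theta_i(\theta_i+\theta_0)}\Big).$$ -/

import Mathlib

open MeasureTheory ProbabilityTheory Set Filter Topology

noncomputable section

/-- The noncentral chi-square law `χ²_k(δ)` on `ℝ`: the law of `Y₁² + ⋯ + Y_k²`, where the `Y_j` are
independent `N(√(δ/k), 1)`, so that the squared means add up to `δ`. -/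
def noncentralChiSq (k : ℕ) (δ : ℝ) : Measure ℝ :=
  (Measure.pi (fun _ : Fin k => gaussianReal (Real.sqrt (δ / k)) 1)).map (fun y => ∑ j, y j ^ 2)

/-- `X = ∑ i, (1 / (2 θ i)) χ²_{n i} (g i / (2 θ i))` with independent summands
(`g i` is the squared parameter `γ i ^ 2`). -/
def IsChiSqCombination {Ω : Type*} [MeasurableSpace Ω] (P : Measure Ω) {m : ℕ}
    (θ g : Fin m → ℝ) (n : Fin m → ℕ) (X : Ω → ℝ) : Prop :=
  ∃ Z : Fin m → Ω → ℝ,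
    (∀ i, HasLaw (Z i) (noncentralChiSq (n i) (g i / (2 * θ i))) P) ∧
    iIndepFun Z P ∧
    ∀ ω, X ω = ∑ i, 1 / (2 * θ i) * Z i ω

/-- `f` is a probability density function of the random variable `X`. -/
def IsDensityOf {Ω : Type*} [MeasurableSpace Ω] (P : Measure Ω) (X : Ω → ℝ) (f : ℝ → ℝ) : Prop :=
  Measurable f ∧ (∀ s, 0 ≤ f s) ∧ P.map X = volume.withDensity (fun s => ENNReal.ofReal (f s))

/-- `κ = ∏ θ_i ^ (n_i / 2) * exp (- ∑ g_i / (4 θ_i))`, where `g_i = γ_i ^ 2`. -/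
def kappa {m : ℕ} (θ g : Fin m → ℝ) (n : Fin m → ℕ) : ℝ :=
  (∏ i, θ i ^ ((n i : ℝ) / 2)) * Real.exp (-∑ i, g i / (4 * θ i))

/-- `g(t) = exp (∑ g_i / (4 (θ_i + t))) / ∏ (θ_i + t) ^ (n_i / 2)`, where `g_i = γ_i ^ 2`;
the powers are taken with the principal branch of the argument. -/
def gFun {m : ℕ} (θ g : Fin m → ℝ) (n : Fin m → ℕ) (t : ℂ) : ℂ :=
  Complex.exp (∑ i, (g i : ℂ) / (4 * ((θ i : ℂ) + t))) /
    ∏ i, ((θ i : ℂ) + t) ^ ((n i : ℂ) / 2)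

/-- The integrand `g(t) e^{st}`. -/
def integrand {m : ℕ} (θ g : Fin m → ℝ) (n : Fin m → ℕ) (s : ℝ) (t : ℂ) : ℂ :=
  gFun θ g n t * Complex.exp ((s : ℂ) * t)

/-- The integral of `F(t) dt` along the part `c|[a, b]` of a curve `c`. -/
def contourIntegral (F : ℂ → ℂ) (c : ℝ → ℂ) (a b : ℝ) : ℂ :=
  ∫ u in a..b, F (c u) * deriv c u

/-- The vertical line through the real number `t₀`, directed upwards. -/
def verticalLine (t₀ : ℝ) (y : ℝ) : ℂ := (t₀ : ℂ) + (y : ℂ) * Complex.I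

/-- The inversion integral along the vertical line through `t₀`, truncated at height `R`:
`κ / (2πi) * ∫_{t₀ - iR}^{t₀ + iR} g(t) e^{st} dt`. -/
def truncatedInversion {m : ℕ} (θ g : Fin m → ℝ) (n : Fin m → ℕ) (t₀ s R : ℝ) : ℂ :=
  (kappa θ g n : ℂ) *
    (1 / (2 * (Real.pi : ℂ) * Complex.I) *
      contourIntegral (integrand θ g n s) (verticalLine t₀) (-R) R)

/-- The function `f_{θ, γ², n}`: the inversion integral (a limit, since it need not converge
absolutely) along the vertical line through `0` for `s > 0`, and `0` for `s ≤ 0`. -/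
def chiSqDensity {m : ℕ} (θ g : Fin m → ℝ) (n : Fin m → ℕ) (s : ℝ) : ℝ :=
  if 0 < s then limUnder atTop (fun R : ℝ => (truncatedInversion θ g n 0 s R).re) else 0

/-- The number of odd multiplicities strictly before the index `i`. -/
def oddBelow {p : ℕ} (n : Fin p → ℕ) (i : Fin p) : ℕ :=
  (Finset.univ.filter (fun j : Fin p => j < i ∧ Odd (n j))).card

/-- The indices of odd multiplicity in 1st, 3rd, 5th, … position among those of odd multiplicity.
There is one branch cut for each of them. -/
def cutStarts {p : ℕ} (n : Fin p → ℕ) : Finset (Fin p) :=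
  Finset.univ.filter (fun i => Odd (n i) ∧ Even (oddBelow n i))

/-- The even multiplicities of type 1: the number of preceding odd multiplicities is even. -/
def typeOne {p : ℕ} (n : Fin p → ℕ) : Finset (Fin p) :=
  Finset.univ.filter (fun i => Even (n i) ∧ Even (oddBelow n i))

/-- `j` is the next index of odd multiplicity after the index `i` of odd multiplicity. -/
def IsPartner {p : ℕ} (n : Fin p → ℕ) (i j : Fin p) : Prop :=
  i < j ∧ Odd (n j) ∧ oddBelow n j = oddBelow n i + 1

/-- The branch cut that starts at `-θ i`: the segment `[-θ j, -θ i]` if `j` is the partner of `i`,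
and the half-line `(-∞, -θ i]` if `i` has no partner. -/
def branchCut {p : ℕ} (θ : Fin p → ℝ) (n : Fin p → ℕ) (i : Fin p) : Set ℂ :=
  {z | z.im = 0 ∧ z.re ≤ -θ i ∧ ∀ j, IsPartner n i j → -θ j ≤ z.re}

open scoped Classical in
/-- The part of the singular set attached to `i`: a branch cut for `i ∈ cutStarts n`, the point
`-θ i` for `i ∈ typeOne n`. -/
def singularPart {p : ℕ} (θ : Fin p → ℝ) (n : Fin p → ℕ) (i : Fin p) : Set ℂ :=
  if Odd (n i) then branchCut θ n i else {-(θ i : ℂ)}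

/-- `c` is piecewise continuously differentiable on `[a, b]`. -/
def PiecewiseC1 (c : ℝ → ℂ) (a b : ℝ) : Prop :=
  ContinuousOn c (Icc a b) ∧
    ∃ S : Finset ℝ, ∀ u v, a ≤ u → u < v → v ≤ b → (∀ x ∈ Ioo u v, x ∉ S) →
      ContDiffOn ℝ 1 c (Icc u v)

/-- The winding number around `w` of the closed curve that runs through `c|[a, b]` and then
back from `c b` to `c a` on a straight line (which is constant if `c a = c b`). -/
def windingNumber (c : ℝ → ℂ) (a b : ℝ) (w : ℂ) : ℂ :=
  1 / (2 * (Real.pi : ℂ) * Complex.I) *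
    ((∫ u in a..b, deriv c u / (c u - w)) +
      ∫ v in (0 : ℝ)..1, (c a - c b) / (c b + (v : ℂ) * (c a - c b) - w))

/-- `c : [0, 1] → ℂ` is a closed contour that runs once anticlockwise around the singular part
attached to `i`, and around none of the other cuts and type 1 poles. -/
structure IsClosedContour {p : ℕ} (θ : Fin p → ℝ) (n : Fin p → ℕ) (i : Fin p) (c : ℝ → ℂ) :
    Prop where
  piecewise : PiecewiseC1 c 0 1
  closed : c 0 = c 1
  avoids : ∀ u ∈ Icc (0 : ℝ) 1, ∀ j ∈ cutStarts n ∪ typeOne n, c u ∉ singularPart θ n j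
  encloses : ∀ w ∈ singularPart θ n i, windingNumber c 0 1 w = 1
  excludes : ∀ j ∈ cutStarts n ∪ typeOne n, j ≠ i → ∀ w ∈ singularPart θ n j,
    windingNumber c 0 1 w = 0

/-- `c : ℝ → ℂ` is a keyhole contour around the unbounded cut that starts at `-θ i`: it comes from
`-∞` below the cut, returns to `-∞` above it, and runs around none of the other cuts and type 1
poles. -/
structure IsKeyholeContour {p : ℕ} (θ : Fin p → ℝ) (n : Fin p → ℕ) (i : Fin p) (c : ℝ → ℂ) :
    Prop where
  piecewise : ∀ R : ℝ, PiecewiseC1 c (-R) R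
  re_start : Tendsto (fun u => (c u).re) atBot atBot
  re_end : Tendsto (fun u => (c u).re) atTop atBot
  im_start : ∀ᶠ u in atBot, (c u).im < 0
  im_end : ∀ᶠ u in atTop, 0 < (c u).im
  avoids : ∀ u, ∀ j ∈ cutStarts n ∪ typeOne n, c u ∉ singularPart θ n j
  encloses : ∀ w ∈ singularPart θ n i, ∀ᶠ R : ℝ in atTop, windingNumber c (-R) R w = 1
  excludes : ∀ j ∈ cutStarts n ∪ typeOne n, j ≠ i → ∀ w ∈ singularPart θ n j,
    ∀ᶠ R : ℝ in atTop, windingNumber c (-R) R w = 0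

/-- The cut that starts at `-θ i` is unbounded (this occurs for at most one `i`, namely the last
index of odd multiplicity if the number of these is odd). -/
def IsUnboundedCut {p : ℕ} (n : Fin p → ℕ) (i : Fin p) : Prop :=
  i ∈ cutStarts n ∧ ∀ j, ¬ IsPartner n i j

/-- A choice of one contour for each branch cut and each type 1 pole. -/
def IsContourSystem {p : ℕ} (θ : Fin p → ℝ) (n : Fin p → ℕ) (Γ : Fin p → ℝ → ℂ) : Prop :=
  ∀ i ∈ cutStarts n ∪ typeOne n,
    (IsUnboundedCut n i → IsKeyholeContour θ n i (Γ i)) ∧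
    (¬ IsUnboundedCut n i → IsClosedContour θ n i (Γ i))

/-- `J` is the integral of `F` along the contour `c` attached to `i`: over `[0, 1]` for a closed
contour, and an improper integral over `ℝ` for a keyhole contour. -/
def HasIntegralAlong {p : ℕ} (n : Fin p → ℕ) (i : Fin p) (F : ℂ → ℂ) (c : ℝ → ℂ) (J : ℂ) : Prop :=
  (IsUnboundedCut n i → Tendsto (fun R : ℝ => contourIntegral F c (-R) R) atTop (𝓝 J)) ∧
  (¬ IsUnboundedCut n i → contourIntegral F c 0 1 = J)

/-- The parameters of `X̃`: `θ₀, θ_1 + θ₀, …, θ_p + θ₀`. -/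
def tildeTheta {p : ℕ} (θ₀ : ℝ) (θ : Fin p → ℝ) : Fin (p + 1) → ℝ :=
  Fin.cons θ₀ (fun i => θ i + θ₀)

/-- The squared parameters of `X̃`: `0, γ_1 ^ 2, …, γ_p ^ 2`. -/
def tildeG {p : ℕ} (g : Fin p → ℝ) : Fin (p + 1) → ℝ := Fin.cons 0 g

/-- The multiplicities of `X̃`: `2, n_1, …, n_p`. -/
def tildeN {p : ℕ} (n : Fin p → ℕ) : Fin (p + 1) → ℕ := Fin.cons 2 n

end

/-! ### Piecewise continuously differentiable curves -/

/-! For `s > 0` the factor `e^{st}` decays as `Re t → -∞`, so the integrand `g(t) e^{st}` has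
primitives `Φ` and `Ψ` on the upper and the lower half-plane that vanish in that direction. The
contour part of the theorem is read off from the jump `Φ - Ψ` on the real axis. Across a real point
with evenly many odd `n i` to its right, the phases of the principal powers above and below agree,
so `g` is holomorphic there (`differentiableAt_gFun_of_gap`). Hence `Φ` and `Ψ` extend to the real
points off the cuts and type 1 poles, and the jump is constant on each gap between neighbouring
points `-θ i` that lies on no cut.

A truncated vertical integral equals `Φ` at the top minus `Ψ` at the bottom minus the jump on the
rightmost gap. The end values are at most `gBound g n R * e^{s t₀} / s`, which tends to `0`. So the
limit exists, is independent of the line and is approached at an explicit rate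
(`norm_truncatedInversion_sub_le`), without absolute convergence.

For the contours, simple poles `a j / (t + θ j)` are subtracted whose logarithms reproduce the
changes of the jump; the rest has a single-valued primitive off the singular set
(`exists_global_primitive`). Contour integrals then depend only on winding numbers and, for a
keyhole, on the behaviour at its ends. Without an unbounded cut the sum telescopes to the rightmost
jump up to sign, because the leftmost jump is zero (`jump_eq_zero`); with one, the ends of the
keyhole supply the missing term. Circles and a parabola serve as contours.

On the probabilistic side `X` has Laplace transform `κ g(t)`, so its distribution function has `κ
g(t) / t`, which is `O(|t|^{-3/2})` on vertical lines. Fourier inversion therefore recovers the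
distribution function. Differentiating its truncated inversion integral in `s` gives the truncated
integral for `f`, and the explicit rate is locally uniform in `s`; so `f` is the derivative of the
distribution function on `(0, ∞)`. Finally, the extra exponential summand turns `g(t)` into `g(θ₀ +
t) / (θ₀ + t)`: inverting this along the line through `0` is inverting the distribution function
along the line through `θ₀`, up to `e^{sθ₀}` and constants. -/

theorem PiecewiseC1.induction {c : ℝ → ℂ} {P : ℝ → ℝ → Prop} (refl : ∀ a, P a a)
    (smooth : ∀ a b, a < b → ContDiffOn ℝ 1 c (Icc a b) → P a b)
    (trans : ∀ a m b, a < m → m < b → P a m → P m b → P a b)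
    {a b : ℝ} (hab : a ≤ b) (h : PiecewiseC1 c a b) : P a b := by
  classical
  obtain ⟨-, S, hS⟩ := h
  -- Induction on the number of break points inside `(u, v)`: splitting at one of them lowers the
  -- number on both sides.
  suffices H : ∀ N : ℕ, ∀ u v, a ≤ u → u ≤ v → v ≤ b →
      (S.filter (fun x => x ∈ Ioo u v)).card ≤ N → P u v from
    H _ a b le_rfl hab le_rfl le_rfl
  intro N
  induction N with
  | zero =>
    intro u v hu huv hv hN
    rcases huv.eq_or_lt with rfl | huv
    · exact refl _
    · refine smooth u v huv (hS u v hu huv hv fun x hx hxS => ?_)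
      have := Finset.card_eq_zero.1 (Nat.le_zero.1 hN)
      exact Finset.notMem_empty x (this ▸ Finset.mem_filter.2 ⟨hxS, hx⟩)
  | succ N ih =>
    intro u v hu huv hv hN
    by_cases hne : ∃ x ∈ S, x ∈ Ioo u v
    · obtain ⟨m, hmS, hm⟩ := hne
      have key : ∀ u' v', u ≤ u' → v' ≤ v → m ∉ Ioo u' v' →
          (S.filter (fun x => x ∈ Ioo u' v')).card ≤ N := by
        intro u' v' hu' hv' hm'
        refine Nat.le_of_lt_succ (lt_of_lt_of_le (Finset.card_lt_card ?_) hN)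
        rw [Finset.ssubset_iff_of_subset]
        · exact ⟨m, Finset.mem_filter.2 ⟨hmS, hm⟩, fun h => hm' (Finset.mem_filter.1 h).2⟩
        · intro x hx
          rw [Finset.mem_filter] at hx ⊢
          exact ⟨hx.1, hu'.trans_lt hx.2.1, hx.2.2.trans_le hv'⟩
      exact trans u m v hm.1 hm.2
        (ih u m hu hm.1.le (hm.2.le.trans hv) (key _ _ le_rfl hm.2.le fun h => lt_irrefl _ h.2))
        (ih m v (hu.trans hm.1.le) hm.2.le hv (key _ _ hm.1.le le_rfl fun h => lt_irrefl _ h.1))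
    · rcases huv.eq_or_lt with rfl | huv
      · exact refl _
      · exact smooth u v huv (hS u v hu huv hv fun x hx hxS => hne ⟨x, hxS, hx⟩)

theorem hasDerivAt_of_contDiffOn_Icc {c : ℝ → ℂ} {a b x : ℝ} (h : ContDiffOn ℝ 1 c (Icc a b))
    (hx : x ∈ Ioo a b) : HasDerivAt c (deriv c x) x :=
  (((h.differentiableOn one_ne_zero) x (Ioo_subset_Icc_self hx)).differentiableAt
    (Icc_mem_nhds hx.1 hx.2)).hasDerivAt

/-- At the end points `deriv c` may be a default value, as `c` can have a corner there. The
one-sided `derivWithin` is continuous on the closed interval and agrees with `deriv c` inside it. -/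
theorem intervalIntegrable_mul_deriv_of_contDiffOn {c : ℝ → ℂ} {a b : ℝ} (hab : a < b)
    (h : ContDiffOn ℝ 1 c (Icc a b)) {φ : ℝ → ℂ} (hφ : ContinuousOn φ (Icc a b)) :
    IntervalIntegrable (fun u => φ u * deriv c u) volume a b := by
  have hd : ContinuousOn (derivWithin c (Icc a b)) (Icc a b) :=
    h.continuousOn_derivWithin (uniqueDiffOn_Icc hab) le_rfl
  have hi : IntervalIntegrable (fun u => φ u * derivWithin c (Icc a b) u) volume a b :=
    ContinuousOn.intervalIntegrable (by rw [uIcc_of_le hab.le]; exact hφ.mul hd)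
  rw [intervalIntegrable_iff_integrableOn_Ioo_of_le hab.le] at hi ⊢
  refine hi.congr_fun (fun x hx => ?_) measurableSet_Ioo
  simp only
  rw [derivWithin_of_mem_nhds (Icc_mem_nhds hx.1 hx.2)]

theorem PiecewiseC1.intervalIntegrable {c : ℝ → ℂ} {a b : ℝ} (hab : a ≤ b)
    (h : PiecewiseC1 c a b) {f : ℂ → ℂ} {U : Set ℂ} (hf : ContinuousOn f U)
    (hU : ∀ u ∈ Icc a b, c u ∈ U) :
    IntervalIntegrable (fun u => f (c u) * deriv c u) volume a b := by
  revert hU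
  refine PiecewiseC1.induction (P := fun a b => (∀ u ∈ Icc a b, c u ∈ U) →
    IntervalIntegrable (fun u => f (c u) * deriv c u) volume a b) ?_ ?_ ?_ hab h
  · intro a _; simp
  · intro a b hab hc hU
    exact intervalIntegrable_mul_deriv_of_contDiffOn hab hc (hf.comp hc.continuousOn hU)
  · intro a m b h1 h2 ih1 ih2 hU
    exact (ih1 fun u hu => hU u ⟨hu.1, hu.2.trans h2.le⟩).trans
      (ih2 fun u hu => hU u ⟨h1.le.trans hu.1, hu.2⟩)

theorem PiecewiseC1.contourIntegral_eq_sub {c : ℝ → ℂ} {a b : ℝ} (hab : a ≤ b)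
    (h : PiecewiseC1 c a b) {f G : ℂ → ℂ} {U : Set ℂ} (hf : ContinuousOn f U)
    (hG : ∀ z ∈ U, HasDerivAt G (f z) z) (hU : ∀ u ∈ Icc a b, c u ∈ U) :
    contourIntegral f c a b = G (c b) - G (c a) := by
  -- Adding integrals over adjacent intervals needs integrability, so both claims go through the
  -- induction together.
  suffices H : IntervalIntegrable (fun u => f (c u) * deriv c u) volume a b ∧
      contourIntegral f c a b = G (c b) - G (c a) from H.2
  revert hU
  refine PiecewiseC1.induction (P := fun a b => (∀ u ∈ Icc a b, c u ∈ U) →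
    IntervalIntegrable (fun u => f (c u) * deriv c u) volume a b ∧
      contourIntegral f c a b = G (c b) - G (c a)) ?_ ?_ ?_ hab h
  · intro a _; simp [contourIntegral]
  · intro a b hab hc hU
    have hi := intervalIntegrable_mul_deriv_of_contDiffOn hab hc (hf.comp hc.continuousOn hU)
    refine ⟨hi, ?_⟩
    refine intervalIntegral.integral_eq_sub_of_hasDerivAt_of_le (f := fun u => G (c u)) hab.le
      ?_ (fun x hx => ?_) hi
    · exact ContinuousOn.comp (fun z hz => (hG z hz).continuousAt.continuousWithinAt)
        hc.continuousOn hU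
    · have := HasDerivAt.scomp x (hG _ (hU x (Ioo_subset_Icc_self hx)))
        (hasDerivAt_of_contDiffOn_Icc hc hx)
      rw [mul_comm]
      exact this
  · intro a m b h1 h2 ih1 ih2 hU
    obtain ⟨i1, e1⟩ := ih1 fun u hu => hU u ⟨hu.1, hu.2.trans h2.le⟩
    obtain ⟨i2, e2⟩ := ih2 fun u hu => hU u ⟨h1.le.trans hu.1, hu.2⟩
    refine ⟨i1.trans i2, ?_⟩
    unfold contourIntegral at e1 e2 ⊢
    rw [← intervalIntegral.integral_add_adjacent_intervals i1 i2, e1, e2]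
    ring

theorem ContDiff.piecewiseC1 {c : ℝ → ℂ} (h : ContDiff ℝ 1 c) (a b : ℝ) : PiecewiseC1 c a b :=
  ⟨h.continuous.continuousOn, ∅, fun _ _ _ _ _ _ => h.contDiffOn⟩

theorem contDiff_segment (a b : ℂ) : ContDiff ℝ 1 (fun v : ℝ => a + (v : ℂ) * (b - a)) :=
  contDiff_const.add ((Complex.ofRealCLM.contDiff).mul contDiff_const)

/-- The integral along a segment in a set on which the integrand has a primitive. -/
theorem integral_segment_eq_sub {f G : ℂ → ℂ} {U : Set ℂ} (hf : ContinuousOn f U)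
    (hG : ∀ z ∈ U, HasDerivAt G (f z) z) {a b : ℂ} (hU : ∀ v ∈ Icc (0 : ℝ) 1, a + (v : ℂ) * (b - a) ∈ U) :
    ∫ v in (0 : ℝ)..1, f (a + (v : ℂ) * (b - a)) * (b - a) = G b - G a := by
  have h := ((contDiff_segment a b).piecewiseC1 0 1).contourIntegral_eq_sub zero_le_one hf hG hU
  have hd : ∀ v : ℝ, deriv (fun v : ℝ => a + (v : ℂ) * (b - a)) v = b - a := by
    intro v
    have : HasDerivAt (fun v : ℝ => a + (v : ℂ) * (b - a)) (1 * (b - a)) v :=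
      ((Complex.ofRealCLM.hasDerivAt (x := v)).mul_const (b - a)).const_add a
    simpa using this.deriv
  simpa [contourIntegral, hd] using h

/-! ### Gluing primitives on the two half-planes -/

/-- At a real point the derivatives within the two closed half-planes combine to a full derivative,
since these half-planes cover the plane. The gluing constant `D` must be the same at all real points
of `U`. -/
theorem exists_primitive_of_halfPlanes {f Φ Ψ : ℂ → ℂ} {U : Set ℂ} (hU : IsOpen U) (D : ℂ)
    (hΦ : ∀ z ∈ U, 0 ≤ z.im → HasDerivWithinAt Φ (f z) {z | 0 ≤ z.im} z)
    (hΨ : ∀ z ∈ U, z.im ≤ 0 → HasDerivWithinAt Ψ (f z) {z | z.im ≤ 0} z)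
    (hD : ∀ z ∈ U, z.im = 0 → Φ z = Ψ z + D) :
    ∃ G : ℂ → ℂ, (∀ z ∈ U, HasDerivAt G (f z) z) ∧ (∀ z, 0 ≤ z.im → G z = Φ z) ∧
      ∀ z, z.im < 0 → G z = Ψ z + D := by
  classical
  refine ⟨fun z => if 0 ≤ z.im then Φ z else Ψ z + D, ?_, fun z hz => if_pos hz,
    fun z hz => if_neg (not_le.2 hz)⟩
  set G : ℂ → ℂ := fun z => if 0 ≤ z.im then Φ z else Ψ z + D
  have h1 : ∀ z, 0 ≤ z.im → G z = Φ z := fun z hz => if_pos hz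
  have h2 : ∀ z ∈ U, z.im ≤ 0 → G z = Ψ z + D := by
    intro z hz hz'
    rcases hz'.eq_or_lt with h | h
    · rw [h1 z h.ge, hD z hz h]
    · exact if_neg (not_le.2 h)
  intro z hz
  have hup : 0 ≤ z.im → HasDerivWithinAt G (f z) {z | 0 ≤ z.im} z := fun h =>
    (hΦ z hz h).congr (fun w hw => h1 w hw) (h1 z h)
  have hlo : z.im ≤ 0 → HasDerivWithinAt G (f z) {z | z.im ≤ 0} z := fun h =>
    ((hΨ z hz h).add_const D).congr_of_eventuallyEq
      (by filter_upwards [self_mem_nhdsWithin, mem_nhdsWithin_of_mem_nhds (hU.mem_nhds hz)]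
            with w hw hw'
          exact h2 w hw' hw)
      (h2 z hz h)
  rcases lt_trichotomy z.im 0 with h | h | h
  · refine (hlo h.le).hasDerivAt (mem_of_superset
      ((isOpen_lt Complex.continuous_im continuous_const).mem_nhds h) fun w (hw : w.im < 0) => hw.le)
  · have := (hup h.ge).union (hlo h.le)
    rw [show ({z : ℂ | 0 ≤ z.im} ∪ {z | z.im ≤ 0}) = univ by
      ext w; simpa using le_total 0 w.im] at this
    exact this.hasDerivAt univ_mem
  · refine (hup h.le).hasDerivAt (mem_of_superset
      ((isOpen_lt continuous_const Complex.continuous_im).mem_nhds h) fun w (hw : 0 < w.im) => hw.le)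

/-! ### Primitives on a half-plane that vanish at infinity -/

theorem convex_halfPlane (σ η : ℝ) : Convex ℝ {z : ℂ | η ≤ σ * z.im} := by
  have : {z : ℂ | η ≤ σ * z.im} = (σ • Complex.imLm : ℂ →ₗ[ℝ] ℝ) ⁻¹' Ici η := by ext; simp
  rw [this]
  exact (convex_Ici η).linear_preimage _

theorem convex_openHalfPlane (σ η : ℝ) : Convex ℝ {z : ℂ | η < σ * z.im} := by
  have : {z : ℂ | η < σ * z.im} = (σ • Complex.imLm : ℂ →ₗ[ℝ] ℝ) ⁻¹' Ioi η := by ext; simp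
  rw [this]
  exact (convex_Ioi η).linear_preimage _

theorem convex_re_le (M : ℝ) : Convex ℝ {z : ℂ | z.re ≤ M} := by
  have : {z : ℂ | z.re ≤ M} = Complex.reLm ⁻¹' Iic M := by ext; simp
  rw [this]
  exact (convex_Iic M).linear_preimage _

theorem isOpen_halfPlane (σ η : ℝ) : IsOpen {z : ℂ | η < σ * z.im} :=
  isOpen_lt continuous_const (continuous_const.mul Complex.continuous_im)

/-- The variation of a primitive along a horizontal ray on which the function decays
exponentially. -/
theorem norm_primitive_sub_le {F Φ : ℂ → ℂ} {s : ℝ} (hs : 0 < s) {z : ℂ} {b : ℝ}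
    (hΦ : ∀ x : ℝ, x ≤ 0 → HasDerivAt Φ (F (z + x)) (z + x))
    (hb : ∀ x : ℝ, x ≤ 0 → ‖F (z + x)‖ ≤ b * Real.exp (s * (z.re + x))) {A : ℝ} (hA : 0 ≤ A) :
    ‖Φ z - Φ (z - A)‖ ≤ b * Real.exp (s * z.re) / s := by
  have hb0 : 0 ≤ b := by
    have := (norm_nonneg _).trans (hb 0 le_rfl)
    exact nonneg_of_mul_nonneg_left this (Real.exp_pos _)
  have hd : ∀ x : ℝ, x ≤ 0 → HasDerivAt (fun x : ℝ => Φ (z + x)) (F (z + x)) x := by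
    intro x hx
    have h1 : HasDerivAt (fun x : ℝ => z + (x : ℂ)) 1 x :=
      (Complex.ofRealCLM.hasDerivAt (x := x)).const_add z
    have := HasDerivAt.scomp x (hΦ x hx) h1
    rw [one_smul] at this
    exact this
  -- The comparison function is the primitive of the bound that vanishes at `-A`; dropping its
  -- negative term makes the estimate independent of `A`.
  have hB : ∀ x : ℝ, HasDerivAt
      (fun x : ℝ => b / s * (Real.exp (s * (z.re + x)) - Real.exp (s * (z.re - A))))
      (b * Real.exp (s * (z.re + x))) x := by
    intro x
    have h1 : HasDerivAt (fun x : ℝ => s * (z.re + x)) (s * 1) x :=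
      ((hasDerivAt_id x).const_add z.re).const_mul s
    have := ((h1.exp).sub_const (Real.exp (s * (z.re - A)))).const_mul (b / s)
    refine this.congr_deriv ?_
    field_simp
  have key := image_norm_le_of_norm_deriv_right_le_deriv_boundary (a := -A) (b := 0)
    (f := fun x : ℝ => Φ (z + x) - Φ (z - A)) (f' := fun x : ℝ => F (z + x))
    (B := fun x : ℝ => b / s * (Real.exp (s * (z.re + x)) - Real.exp (s * (z.re - A))))
    (B' := fun x : ℝ => b * Real.exp (s * (z.re + x)))
    (fun x hx => ((hd x hx.2).continuousAt.sub continuousAt_const).continuousWithinAt)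
    (fun x hx => ((hd x hx.2.le).sub_const _).hasDerivWithinAt)
    (by simp [sub_eq_add_neg]) hB (fun x hx => hb x hx.2.le)
    (show (0 : ℝ) ∈ Icc (-A) 0 from ⟨by linarith, le_rfl⟩)
  simp only [Complex.ofReal_zero, add_zero] at key
  refine key.trans ?_
  rw [div_mul_eq_mul_div]
  gcongr
  have := Real.exp_pos (s * (z.re - A))
  linarith

/-- Any primitive has a limit along a leftward horizontal ray, because its increments are dominated
by a decaying exponential. The limit is the same for all rays, and subtracting it normalises the
primitive. -/
theorem exists_halfPlane_primitive {F : ℂ → ℂ} {s σ : ℝ} (hs : 0 < s) (hσ : σ ≠ 0)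
    (hF : DifferentiableOn ℂ F {z | 0 < σ * z.im})
    (hb : ∀ η : ℝ, 0 < η → ∃ b, ∀ w : ℂ, η ≤ σ * w.im → ‖F w‖ ≤ b * Real.exp (s * w.re)) :
    ∃ Φ : ℂ → ℂ, (∀ z : ℂ, 0 < σ * z.im → HasDerivAt Φ (F z) z) ∧
      ∀ z : ℂ, 0 < σ * z.im → ∀ b : ℝ,
        (∀ x : ℝ, x ≤ 0 → ‖F (z + x)‖ ≤ b * Real.exp (s * (z.re + x))) →
        ‖Φ z‖ ≤ b * Real.exp (s * z.re) / s := by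
  obtain ⟨Φ, hΦ⟩ := (convex_openHalfPlane σ 0).exists_forall_hasDerivWithinAt hF
  replace hΦ : ∀ z : ℂ, 0 < σ * z.im → HasDerivAt Φ (F z) z := fun z hz =>
    (hΦ z hz).hasDerivAt ((isOpen_halfPlane σ 0).mem_nhds hz)
  have step : ∀ z : ℂ, 0 < σ * z.im → ∀ b : ℝ,
      (∀ x : ℝ, x ≤ 0 → ‖F (z + x)‖ ≤ b * Real.exp (s * (z.re + x))) → ∀ A : ℝ, 0 ≤ A →
      ‖Φ z - Φ (z - A)‖ ≤ b * Real.exp (s * z.re) / s := fun z hz b hb A hA =>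
    norm_primitive_sub_le hs (fun x _ => hΦ _ (by simpa using hz)) hb hA
  have hexp : ∀ c : ℝ, Tendsto (fun n : ℕ => Real.exp (s * (c - n))) atTop (𝓝 0) := by
    intro c
    refine Real.tendsto_exp_atBot.comp (Tendsto.const_mul_atBot hs ?_)
    exact tendsto_atBot_add_const_left _ c (tendsto_neg_atTop_atBot.comp tendsto_natCast_atTop_atTop)
  set z₀ : ℂ := (1 / σ : ℝ) * Complex.I
  have hz₀ : σ * z₀.im = 1 := by simp [z₀, hσ]
  obtain ⟨ℓ, hℓ⟩ : ∃ ℓ, Tendsto (fun n : ℕ => Φ (z₀ - n)) atTop (𝓝 ℓ) := by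
    obtain ⟨b, hb⟩ := hb 1 one_pos
    have hb0 : 0 ≤ b := nonneg_of_mul_nonneg_left
      ((norm_nonneg _).trans (hb z₀ hz₀.ge)) (Real.exp_pos _)
    refine cauchySeq_tendsto_of_complete (cauchySeq_of_le_tendsto_0'
      (fun n : ℕ => b * Real.exp (s * (z₀.re - n)) / s) ?_ ?_)
    · intro n m hnm
      rw [dist_eq_norm]
      have := step (z₀ - n) (by simp [hz₀]) b (fun x _ => by
        have := hb (z₀ - n + x) (by simp [hz₀])
        simpa using this) ((m : ℝ) - n) (by simpa using hnm)
      simpa using this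
    · simpa using ((hexp z₀.re).const_mul b).div_const s
  have hlim : ∀ z : ℂ, 0 < σ * z.im → Tendsto (fun n : ℕ => Φ (z - n)) atTop (𝓝 ℓ) := by
    intro z hz
    -- The segment from `z₀ - n` to `z - n` lies in a convex region at height at least `η` and with
    -- real part at most `M - n`, where `F` is `O(e^{-sn})`.
    set η := min 1 (σ * z.im)
    set M := max z₀.re z.re
    obtain ⟨b, hb⟩ := hb η (lt_min one_pos hz)
    have hdiff : Tendsto (fun n : ℕ => Φ (z - n) - Φ (z₀ - n)) atTop (𝓝 0) := by
      refine squeeze_zero_norm (a := fun n : ℕ => b * Real.exp (s * (M - n)) * ‖z - z₀‖) ?_ ?_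
      · intro n
        have hc := (convex_halfPlane σ η).inter (convex_re_le (M - n))
        have := hc.norm_image_sub_le_of_norm_hasDerivWithin_le (f := Φ) (f' := F)
          (C := b * Real.exp (s * (M - n))) (x := z₀ - n) (y := z - n)
          (fun w hw => (hΦ w ((lt_min one_pos hz).trans_le hw.1)).hasDerivWithinAt)
          (fun w hw => by
            refine (hb w hw.1).trans ?_
            have hb0 : 0 ≤ b := nonneg_of_mul_nonneg_left
              ((norm_nonneg _).trans (hb w hw.1)) (Real.exp_pos _)
            have := hw.2
            simp only [mem_ofPred_eq] at this
            gcongr)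
          ⟨by simp [hz₀, η], by simp [M]⟩ ⟨by simp [η], by simp [M]⟩
        simpa using this
      · simpa using ((hexp M).const_mul b).mul_const ‖z - z₀‖
    simpa using hdiff.add hℓ
  refine ⟨fun z => Φ z - ℓ, fun z hz => (hΦ z hz).sub_const ℓ, fun z hz b hb => ?_⟩
  refine le_of_tendsto ((tendsto_const_nhds.sub (hlim z hz)).norm) (Eventually.of_forall fun n => ?_)
  simpa using step z hz b hb n n.cast_nonneg

/-- A primitive on a half-plane extends to the boundary points near which the function is
holomorphic. -/
theorem exists_primitive_extension {F Φ : ℂ → ℂ} {σ : ℝ} (hσ : σ ≠ 0)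
    (hΦ : ∀ z : ℂ, 0 < σ * z.im → HasDerivAt Φ (F z) z) :
    ∃ Ψ : ℂ → ℂ, (∀ z : ℂ, 0 < σ * z.im → Ψ z = Φ z) ∧
      ∀ z : ℂ, 0 ≤ σ * z.im → (∃ r > 0, DifferentiableOn ℂ F (Metric.ball z r)) →
        HasDerivWithinAt Ψ (F z) {z | 0 ≤ σ * z.im} z := by
  classical
  set H : Set ℂ := {z | 0 < σ * z.im}
  -- The boundary value is the limit of `Φ` from inside. Near a point where `F` is holomorphic, `Φ`
  -- differs from a primitive `Q` on a disc by a constant on the half-disc, so the limit exists and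
  -- equals `Q + c`.
  refine ⟨fun z => if z ∈ H then Φ z else limUnder (𝓝[H] z) Φ, fun z hz => if_pos hz, ?_⟩
  set Ψ : ℂ → ℂ := fun z => if z ∈ H then Φ z else limUnder (𝓝[H] z) Φ
  have hΨ : ∀ z ∈ H, Ψ z = Φ z := fun z hz => if_pos hz
  rintro z hz ⟨r, hr, hFr⟩
  obtain ⟨Q, hQ⟩ := hFr.isExactOn_ball
  have hclos : ∀ w : ℂ, 0 ≤ σ * w.im → (𝓝[H] w).NeBot := by
    intro w hw
    rw [← mem_closure_iff_nhdsWithin_neBot, Metric.mem_closure_iff]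
    intro ε hε
    -- This is a shift by `ε / 2` in the imaginary direction given by the sign of `σ`.
    refine ⟨w + ((ε / 2 / σ * |σ| : ℝ) : ℂ) * Complex.I, ?_, ?_⟩
    · simp only [H, mem_ofPred_eq, Complex.add_im, Complex.mul_im, Complex.ofReal_re,
        Complex.I_im, Complex.ofReal_im, Complex.I_re, mul_one, mul_zero, add_zero]
      have : σ * (ε / 2 / σ * |σ|) = ε / 2 * |σ| := by field_simp
      rw [mul_add, this]
      have := abs_pos.2 hσ
      positivity
    · rw [dist_eq_norm]
      simp only [sub_add_cancel_left, norm_neg, norm_mul, Complex.norm_real, Complex.norm_I,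
        mul_one, Real.norm_eq_abs, abs_div, abs_abs]
      rw [abs_of_pos hε, div_mul_cancel₀ _ (abs_pos.2 hσ).ne']
      simp; linarith
  obtain ⟨c, hc⟩ : ∃ c, ∀ w ∈ Metric.ball z r ∩ H, Φ w - Q w = c := by
    have hcv : Convex ℝ (Metric.ball z r ∩ H) := (convex_ball z r).inter (convex_openHalfPlane σ 0)
    obtain ⟨w₀, hw₀⟩ : (Metric.ball z r ∩ H).Nonempty := by
      have := hclos z hz
      have h1 : Metric.ball z r ∩ H ∈ 𝓝[H] z :=
        inter_mem (mem_nhdsWithin_of_mem_nhds (Metric.ball_mem_nhds z hr)) self_mem_nhdsWithin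
      exact Filter.nonempty_of_mem h1
    refine ⟨Φ w₀ - Q w₀, fun w hw => ?_⟩
    have := hcv.norm_image_sub_le_of_norm_hasDerivWithin_le (f := fun w => Φ w - Q w)
      (f' := fun _ => 0) (C := 0) (x := w₀) (y := w)
      (fun u hu => by
        have := ((hΦ u hu.2).sub (hQ u hu.1)).hasDerivWithinAt (s := Metric.ball z r ∩ H)
        rw [sub_self] at this
        exact this)
      (fun u hu => by simp) hw₀ hw
    rw [zero_mul, norm_le_zero_iff, sub_eq_zero] at this
    exact this
  have hc' : ∀ w ∈ Metric.ball z r, 0 ≤ σ * w.im → Ψ w = Q w + c := by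
    intro w hw hw'
    by_cases hwH : w ∈ H
    · rw [hΨ w hwH, ← hc w ⟨hw, hwH⟩]; ring
    · have : Ψ w = limUnder (𝓝[H] w) Φ := if_neg hwH
      rw [this]
      have := hclos w hw'
      refine Tendsto.limUnder_eq ?_
      have hQw : Tendsto (fun u => Q u + c) (𝓝[H] w) (𝓝 (Q w + c)) :=
        ((hQ w hw).continuousAt.add continuousAt_const).mono_left nhdsWithin_le_nhds
      refine hQw.congr' ?_
      filter_upwards [self_mem_nhdsWithin,
        mem_nhdsWithin_of_mem_nhds (Metric.isOpen_ball.mem_nhds hw)] with u hu hu'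
      rw [← hc u ⟨hu', hu⟩]; ring
  refine ((hQ z (Metric.mem_ball_self hr)).add_const c).hasDerivWithinAt.congr_of_eventuallyEq ?_
    (hc' z (Metric.mem_ball_self hr) hz)
  filter_upwards [self_mem_nhdsWithin, mem_nhdsWithin_of_mem_nhds (Metric.ball_mem_nhds z hr)]
    with w hw hw'
  exact hc' w hw' hw

/-! ### Combinatorics of the cuts -/

section Cuts

variable {p : ℕ}

/-- The number of odd multiplicities among the first `k`. -/
noncomputable def oddCount (n : Fin p → ℕ) (k : ℕ) : ℕ :=
  (Finset.univ.filter (fun j : Fin p => (j : ℕ) < k ∧ Odd (n j))).card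

theorem oddBelow_eq_oddCount (n : Fin p → ℕ) (i : Fin p) : oddBelow n i = oddCount n i := rfl

theorem oddCount_mono (n : Fin p → ℕ) : Monotone (oddCount n) := fun _ _ hkl =>
  Finset.card_le_card fun j hj => by
    simp only [Finset.mem_filter, Finset.mem_univ, true_and] at hj ⊢
    exact ⟨hj.1.trans_le hkl, hj.2⟩

theorem oddCount_succ_of_odd {n : Fin p → ℕ} {j : Fin p} (hj : Odd (n j)) :
    oddCount n (j + 1) = oddCount n j + 1 := by
  classical
  unfold oddCount
  rw [← Finset.card_insert_of_notMem (a := j) (by simp)]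
  congr 1
  ext i
  simp only [Finset.mem_filter, Finset.mem_univ, true_and, Finset.mem_insert]
  constructor
  · rintro ⟨h1, h2⟩
    rcases eq_or_ne i j with h | h
    · exact Or.inl h
    · exact Or.inr ⟨lt_of_le_of_ne (Nat.le_of_lt_succ h1) fun h' => h (Fin.ext h'), h2⟩
  · rintro (rfl | ⟨h1, h2⟩)
    · exact ⟨Nat.lt_succ_self _, hj⟩
    · exact ⟨h1.trans (Nat.lt_succ_self _), h2⟩

/-- `oddCount` grows only at odd multiplicities, and there by one; so it passes from `m` to `m + 1`
at an index of odd multiplicity. -/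
theorem exists_odd_index {n : Fin p → ℕ} {k m : ℕ} (h : m < oddCount n k) :
    ∃ j : Fin p, (j : ℕ) < k ∧ Odd (n j) ∧ oddCount n j = m := by
  induction k with
  | zero => simp [oddCount] at h
  | succ k ih =>
    by_cases hk : m < oddCount n k
    · obtain ⟨j, h1, h2⟩ := ih hk
      exact ⟨j, h1.trans (Nat.lt_succ_self _), h2⟩
    · by_cases hodd : ∃ j : Fin p, (j : ℕ) = k ∧ Odd (n j)
      · obtain ⟨j, rfl, hj⟩ := hodd
        rw [oddCount_succ_of_odd hj] at h
        exact ⟨j, Nat.lt_succ_self _, hj, by omega⟩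
      · refine absurd (h.trans_le (Finset.card_le_card fun j hj => ?_)) hk
        simp only [Finset.mem_filter, Finset.mem_univ, true_and] at hj ⊢
        exact ⟨lt_of_le_of_ne (Nat.le_of_lt_succ hj.1) fun h' => hodd ⟨j, h', hj.2⟩, hj.2⟩

theorem mem_cutStarts {n : Fin p → ℕ} {i : Fin p} :
    i ∈ cutStarts n ↔ Odd (n i) ∧ Even (oddCount n i) := by
  rw [cutStarts, Finset.mem_filter, oddBelow_eq_oddCount]
  simp only [Finset.mem_univ, true_and]

theorem mem_typeOne {n : Fin p → ℕ} {i : Fin p} :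
    i ∈ typeOne n ↔ Even (n i) ∧ Even (oddCount n i) := by
  rw [typeOne, Finset.mem_filter, oddBelow_eq_oddCount]
  simp only [Finset.mem_univ, true_and]

theorem mem_cutStarts_union_typeOne {n : Fin p → ℕ} {i : Fin p} :
    i ∈ cutStarts n ∪ typeOne n ↔ Even (oddCount n i) := by
  rw [Finset.mem_union, mem_cutStarts, mem_typeOne]
  rcases Nat.even_or_odd (n i) with h | h
  · simp [h]
  · simp [h]

theorem isPartner_iff {n : Fin p → ℕ} {i j : Fin p} :
    IsPartner n i j ↔ i < j ∧ Odd (n j) ∧ oddCount n j = oddCount n i + 1 := Iff.rfl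

theorem disjoint_cutStarts_typeOne (n : Fin p → ℕ) : Disjoint (cutStarts n) (typeOne n) := by
  rw [Finset.disjoint_left]
  intro i hi hi'
  exact Nat.not_even_iff_odd.2 (mem_cutStarts.1 hi).1 (mem_typeOne.1 hi').1

theorem singularPart_of_mem_cutStarts (θ : Fin p → ℝ) {n : Fin p → ℕ} {i : Fin p}
    (hi : i ∈ cutStarts n) : singularPart θ n i = branchCut θ n i := by
  simp [singularPart, (mem_cutStarts.1 hi).1]

theorem singularPart_of_mem_typeOne (θ : Fin p → ℝ) {n : Fin p → ℕ} {i : Fin p}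
    (hi : i ∈ typeOne n) : singularPart θ n i = {-(θ i : ℂ)} := by
  simp [singularPart, (mem_typeOne.1 hi).1]

/-- The union of the branch cuts and the type 1 poles. -/
def singularSet (θ : Fin p → ℝ) (n : Fin p → ℕ) : Set ℂ :=
  ⋃ i ∈ cutStarts n ∪ typeOne n, singularPart θ n i

theorem mem_singularSet {θ : Fin p → ℝ} {n : Fin p → ℕ} {z : ℂ} :
    z ∈ singularSet θ n ↔ ∃ i ∈ cutStarts n ∪ typeOne n, z ∈ singularPart θ n i := by
  simp [singularSet]

theorem isClosed_branchCut (θ : Fin p → ℝ) (n : Fin p → ℕ) (i : Fin p) :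
    IsClosed (branchCut θ n i) := by
  have : branchCut θ n i = {z | z.im = 0} ∩ ({z | z.re ≤ -θ i} ∩
      ⋂ j, ⋂ _ : IsPartner n i j, {z | -θ j ≤ z.re}) := by
    ext z; simp [branchCut]
  rw [this]
  refine (isClosed_eq Complex.continuous_im continuous_const).inter
    ((isClosed_le Complex.continuous_re continuous_const).inter ?_)
  exact isClosed_iInter fun j => isClosed_iInter fun _ =>
    isClosed_le continuous_const Complex.continuous_re

theorem isClosed_singularSet (θ : Fin p → ℝ) (n : Fin p → ℕ) : IsClosed (singularSet θ n) := by
  refine (Finset.finite_toSet (cutStarts n ∪ typeOne n)).isClosed_biUnion fun i _ => ?_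
  unfold singularPart
  split_ifs
  · exact isClosed_branchCut θ n i
  · exact isClosed_singleton

theorem singularPart_im {θ : Fin p → ℝ} {n : Fin p → ℕ} {i : Fin p} {z : ℂ}
    (hz : z ∈ singularPart θ n i) : z.im = 0 := by
  unfold singularPart at hz
  split_ifs at hz
  · exact hz.1
  · rw [mem_singleton_iff] at hz; simp [hz]

theorem singularPart_re_le {θ : Fin p → ℝ} {n : Fin p → ℕ} {i : Fin p} {z : ℂ}
    (hz : z ∈ singularPart θ n i) : z.re ≤ -θ i := by
  unfold singularPart at hz
  split_ifs at hz
  · exact hz.2.1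
  · rw [mem_singleton_iff] at hz; simp [hz]

theorem neg_mem_singularPart_self {θ : Fin p → ℝ} (hθ : StrictMono θ) (n : Fin p → ℕ)
    (i : Fin p) : -(θ i : ℂ) ∈ singularPart θ n i := by
  unfold singularPart
  split_ifs
  · refine ⟨by simp, by simp, fun j hj => ?_⟩
    simpa using (hθ hj.1).le
  · exact mem_singleton _

/-- Every singularity lies on a cut or is a type 1 pole. -/
theorem exists_neg_mem_singularPart {θ : Fin p → ℝ} (hθ : StrictMono θ) (n : Fin p → ℕ)
    (j : Fin p) : ∃ i ∈ cutStarts n ∪ typeOne n, -(θ j : ℂ) ∈ singularPart θ n i := by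
  rcases Nat.even_or_odd (oddCount n j) with h | h
  · exact ⟨j, mem_cutStarts_union_typeOne.2 h, neg_mem_singularPart_self hθ n j⟩
  · obtain ⟨m, hm⟩ := h
    -- With `2m + 1` odd multiplicities before `j`, the last of them opens a cut, and its partner
    -- cannot precede `j`.
    obtain ⟨i, hij, hi, hic⟩ := exists_odd_index (n := n) (k := j) (m := 2 * m) (by omega)
    have hic' : i ∈ cutStarts n := mem_cutStarts.2 ⟨hi, by rw [hic]; simp⟩
    refine ⟨i, Finset.mem_union_left _ hic', ?_⟩
    rw [singularPart_of_mem_cutStarts θ hic']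
    refine ⟨by simp, by simpa using (hθ hij).le, fun j' hj' => ?_⟩
    obtain ⟨-, h2, h3⟩ := isPartner_iff.1 hj'
    simp only [Complex.neg_re, Complex.ofReal_re, neg_le_neg_iff]
    refine hθ.monotone (not_lt.1 fun hlt => ?_)
    have := oddCount_mono n (show (j' : ℕ) + 1 ≤ j from hlt)
    rw [oddCount_succ_of_odd h2] at this
    omega

/-- The parts of the singular set are ordered from right to left. -/
theorem exists_left_end {θ : Fin p → ℝ} {n : Fin p → ℕ} {i i' : Fin p}
    (hi : i ∈ cutStarts n ∪ typeOne n) (hi' : i' ∈ cutStarts n ∪ typeOne n) (hlt : i < i') :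
    ∃ j, i ≤ j ∧ j < i' ∧ (i ∈ typeOne n ∧ i = j ∨ IsPartner n i j) ∧
      ∀ z ∈ singularPart θ n i, -θ j ≤ z.re := by
  have hie := mem_cutStarts_union_typeOne.1 hi
  have hie' := mem_cutStarts_union_typeOne.1 hi'
  rcases Finset.mem_union.1 hi with h | h
  · have hodd := (mem_cutStarts.1 h).1
    have h1 := oddCount_mono n (show (i : ℕ) + 1 ≤ i' from hlt)
    rw [oddCount_succ_of_odd hodd] at h1
    -- Both counts are even, so the count grows by at least two from `i` to `i'`: the partner of `i`
    -- comes before `i'`.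
    obtain ⟨j, hj1, hj2, hj3⟩ := exists_odd_index (n := n) (k := i') (m := oddCount n i + 1) (by
      rcases hie with ⟨a, ha⟩; rcases hie' with ⟨b, hb⟩; omega)
    have hij : i < j := by
      by_contra hle
      have := oddCount_mono n (show (j : ℕ) ≤ i from not_lt.1 hle)
      omega
    have hp : IsPartner n i j := isPartner_iff.2 ⟨hij, hj2, hj3⟩
    refine ⟨j, hij.le, hj1, Or.inr hp, fun z hz => ?_⟩
    rw [singularPart_of_mem_cutStarts θ h] at hz
    exact hz.2.2 j hp
  · refine ⟨i, le_rfl, hlt, Or.inl ⟨h, rfl⟩, fun z hz => ?_⟩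
    rw [singularPart_of_mem_typeOne θ h, mem_singleton_iff] at hz
    simp [hz]

/-- The left end of the earlier part lies strictly to the right of the later part. -/
theorem singularPart_inj {θ : Fin p → ℝ} (hθ : StrictMono θ) {n : Fin p → ℕ} {i i' : Fin p}
    (hi : i ∈ cutStarts n ∪ typeOne n) (hi' : i' ∈ cutStarts n ∪ typeOne n) {z : ℂ}
    (hz : z ∈ singularPart θ n i) (hz' : z ∈ singularPart θ n i') : i = i' := by
  wlog hlt : i < i' generalizing i i'
  · rcases (not_lt.1 hlt).eq_or_lt with h | h
    · exact h.symm
    · exact (this hi' hi hz' hz h).symm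
  · obtain ⟨j, -, hj, -, hle⟩ := exists_left_end hi hi' hlt
    have h1 := hle z hz
    have h2 := singularPart_re_le hz'
    have h3 := hθ hj
    linarith

/-- There is at most one unbounded cut. -/
theorem IsUnboundedCut.unique {n : Fin p → ℕ} {i i' : Fin p} (hi : IsUnboundedCut n i)
    (hi' : IsUnboundedCut n i') : i = i' := by
  wlog hlt : i < i' generalizing i i'
  · rcases (not_lt.1 hlt).eq_or_lt with h | h
    · exact h.symm
    · exact (this hi' hi h).symm
  · obtain ⟨j, -, -, hj, -⟩ := exists_left_end (θ := fun _ => 0)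
      (Finset.mem_union_left _ hi.1) (Finset.mem_union_left _ hi'.1) hlt
    rcases hj with ⟨h, -⟩ | h
    · exact absurd h (Finset.disjoint_left.1 (disjoint_cutStarts_typeOne n) hi.1)
    · exact absurd h (hi.2 j)

/-- If the total number is `2m + 1`, the last odd multiplicity starts a cut and has no partner. -/
theorem even_oddCount_of_no_unboundedCut {n : Fin p → ℕ} (h : ∀ i, ¬ IsUnboundedCut n i) :
    Even (oddCount n p) := by
  by_contra hodd
  obtain ⟨m, hm⟩ := Nat.not_even_iff_odd.1 hodd
  obtain ⟨i, -, hi, hic⟩ := exists_odd_index (n := n) (k := p) (m := 2 * m) (by omega)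
  refine h i ⟨mem_cutStarts.2 ⟨hi, by rw [hic]; simp⟩, fun j hj => ?_⟩
  obtain ⟨-, h2, h3⟩ := isPartner_iff.1 hj
  have := oddCount_mono n (show (j : ℕ) + 1 ≤ p from j.2)
  rw [oddCount_succ_of_odd h2] at this
  omega

/-- The `k`-th gap between the points `-θ i`, from right to left. -/
def gap (θ : Fin p → ℝ) (k : ℕ) : Set ℝ :=
  {x | ∀ j : Fin p, ((j : ℕ) < k → x < -θ j) ∧ (k ≤ (j : ℕ) → -θ j < x)}

theorem exists_mem_gap {θ : Fin p → ℝ} (hθ : StrictMono θ) {x : ℝ} (hx : ∀ j, x ≠ -θ j) :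
    ∃ k ≤ p, x ∈ gap θ k := by
  classical
  -- The gap is found as the least `k` such that all points with index at least `k` lie to the left
  -- of `x`.
  have hex : ∃ k : ℕ, ∀ j : Fin p, k ≤ (j : ℕ) → -θ j < x := ⟨p, fun j hj => by have := j.2; omega⟩
  refine ⟨Nat.find hex, Nat.find_min' hex fun j hj => by have := j.2; omega, fun j =>
    ⟨fun hj => ?_, Nat.find_spec hex j⟩⟩
  obtain ⟨k, hk⟩ : ∃ k, Nat.find hex = k + 1 := Nat.exists_eq_succ_of_ne_zero (by omega)
  have h1 := Nat.find_min hex (m := k) (by omega)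
  push Not at h1
  obtain ⟨i, hki, hi⟩ := h1
  have hik : (i : ℕ) = k := by
    by_contra hne
    exact absurd (Nat.find_spec hex i (by omega)) (not_lt.2 hi)
  have hji : j ≤ i := by rw [Fin.le_def]; omega
  exact (lt_of_le_of_ne hi (hx i)).trans_le (neg_le_neg (hθ.monotone hji))

theorem ordConnected_gap (θ : Fin p → ℝ) (k : ℕ) : OrdConnected (gap θ k) :=
  ⟨fun _ hx _ hy _ hz j => ⟨fun h => hz.2.trans_lt ((hy j).1 h), fun h => ((hx j).2 h).trans_le hz.1⟩⟩

theorem gap_nonempty {θ : Fin p → ℝ} (hθ : StrictMono θ) (k : ℕ) : (gap θ k).Nonempty := by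
  classical
  obtain ⟨x, h1, h2⟩ := Order.exists_between_finsets
    (lo := (Finset.univ.filter fun j : Fin p => k ≤ (j : ℕ)).image fun j => -θ j)
    (hi := (Finset.univ.filter fun j : Fin p => (j : ℕ) < k).image fun j => -θ j) (by
      simp only [Finset.mem_image, Finset.mem_filter, Finset.mem_univ, true_and]
      rintro _ ⟨i, hi, rfl⟩ _ ⟨j, hj, rfl⟩
      exact neg_lt_neg (hθ (show j < i from Fin.lt_def.2 (by omega))))
  refine ⟨x, fun j => ⟨fun hj => h2 _ ?_, fun hj => h1 _ ?_⟩⟩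
  · exact Finset.mem_image_of_mem _ (by simpa using hj)
  · exact Finset.mem_image_of_mem _ (by simpa using hj)

/-- When the number of odd multiplicities to the right of `x` is even, every cut opened there has
also been closed there. -/
theorem notMem_singularSet_of_even {θ : Fin p → ℝ} {n : Fin p → ℕ} {k : ℕ} {x : ℝ}
    (hx : x ∈ gap θ k) (hk : Even (oddCount n k)) : (x : ℂ) ∉ singularSet θ n := by
  rw [mem_singularSet]
  rintro ⟨i, hi, hxi⟩
  have hik : (i : ℕ) < k := by
    by_contra hle
    have h1 := (hx i).2 (not_lt.1 hle)
    have h2 := singularPart_re_le hxi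
    rw [Complex.ofReal_re] at h2
    linarith
  rcases Finset.mem_union.1 hi with h | h
  · rw [singularPart_of_mem_cutStarts θ h] at hxi
    obtain ⟨hodd, a, ha⟩ := mem_cutStarts.1 h
    have h1 := oddCount_mono n (show (i : ℕ) + 1 ≤ k from hik)
    rw [oddCount_succ_of_odd hodd] at h1
    obtain ⟨j, hj1, hj2, hj3⟩ := exists_odd_index (n := n) (k := k) (m := oddCount n i + 1) (by
      rcases hk with ⟨b, hb⟩; omega)
    have hij : i < j := by
      by_contra hle
      have := oddCount_mono n (show (j : ℕ) ≤ i from not_lt.1 hle)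
      omega
    have h2 := hxi.2.2 j (isPartner_iff.2 ⟨hij, hj2, hj3⟩)
    rw [Complex.ofReal_re] at h2
    have h3 := (hx j).1 hj1
    linarith
  · rw [singularPart_of_mem_typeOne θ h, mem_singleton_iff] at hxi
    have h1 : x = -θ i := by exact_mod_cast hxi
    have h2 := (hx i).1 hik
    linarith

/-- An odd count would leave a cut open at `x`. -/
theorem even_oddCount_of_gap {θ : Fin p → ℝ} {n : Fin p → ℕ} {k : ℕ} {x : ℝ} (hx : x ∈ gap θ k)
    (hxS : (x : ℂ) ∉ singularSet θ n) : Even (oddCount n k) := by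
  by_contra h
  obtain ⟨m, hm⟩ := Nat.not_even_iff_odd.1 h
  obtain ⟨i, hik, hi, hic⟩ := exists_odd_index (n := n) (k := k) (m := 2 * m) (by omega)
  have hic' : i ∈ cutStarts n := mem_cutStarts.2 ⟨hi, by rw [hic]; simp⟩
  refine hxS (mem_singularSet.2 ⟨i, Finset.mem_union_left _ hic', ?_⟩)
  rw [singularPart_of_mem_cutStarts θ hic']
  refine ⟨by simp, by simpa using ((hx i).1 hik).le, fun j hj => ?_⟩
  obtain ⟨-, h2, h3⟩ := isPartner_iff.1 hj
  refine ((hx j).2 (not_lt.1 fun hlt => ?_)).le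
  have := oddCount_mono n (show (j : ℕ) + 1 ≤ k from hlt)
  rw [oddCount_succ_of_odd h2] at this
  omega

/-- A gap that is not part of a cut avoids the singular set. -/
theorem notMem_singularSet_of_gap {θ : Fin p → ℝ} {n : Fin p → ℕ} {k : ℕ} {x y : ℝ}
    (hx : x ∈ gap θ k) (hy : y ∈ gap θ k) (hxS : (x : ℂ) ∉ singularSet θ n) :
    (y : ℂ) ∉ singularSet θ n := by
  rw [mem_singularSet] at hxS ⊢
  rintro ⟨i, hi, hyi⟩
  refine hxS ⟨i, hi, ?_⟩
  have hle : ∀ j, y ≤ -θ j → x ≤ -θ j := fun j hj =>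
    ((hx j).1 (not_le.1 fun h => absurd ((hy j).2 h) (not_lt.2 hj))).le
  have hge : ∀ j, -θ j ≤ y → -θ j ≤ x := fun j hj =>
    ((hx j).2 (not_lt.1 fun h => absurd ((hy j).1 h) (not_lt.2 hj))).le
  rcases Finset.mem_union.1 hi with h | h
  · rw [singularPart_of_mem_cutStarts θ h] at hyi ⊢
    exact ⟨by simp, by simpa using hle i (by simpa using hyi.2.1), fun j hj => by
      simpa using hge j (by simpa using hyi.2.2 j hj)⟩
  · rw [singularPart_of_mem_typeOne θ h, mem_singleton_iff] at hyi
    have : y = -θ i := by exact_mod_cast hyi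
    rcases lt_or_ge (i : ℕ) k with h' | h'
    · exact absurd ((hy i).1 h') (by rw [this]; exact lt_irrefl _)
    · exact absurd ((hy i).2 h') (by rw [this]; exact lt_irrefl _)

theorem ne_neg_of_notMem_singularSet {θ : Fin p → ℝ} (hθ : StrictMono θ) {n : Fin p → ℕ} {z : ℂ}
    (hz : z ∉ singularSet θ n) (j : Fin p) : z ≠ -(θ j : ℂ) := by
  rintro rfl
  exact hz (mem_singularSet.2 (exists_neg_mem_singularPart hθ n j))

end Cuts

/-! ### The logarithm on the two closed half-planes -/

theorem Complex.log_neg_of_upper {w : ℂ} (h : 0 < w.im ∨ w.im = 0 ∧ w.re < 0) :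
    Complex.log (-w) = Complex.log w - Real.pi * Complex.I := by
  rw [Complex.log, Complex.log, Complex.arg_neg_eq_arg_sub_pi_iff.2 h, norm_neg]
  push_cast; ring

theorem Complex.log_neg_of_lower {w : ℂ} (h : w.im < 0 ∨ w.im = 0 ∧ 0 < w.re) :
    Complex.log (-w) = Complex.log w + Real.pi * Complex.I := by
  rw [Complex.log, Complex.log, Complex.arg_neg_eq_arg_add_pi_iff.2 h, norm_neg]
  push_cast; ring

/-- The principal logarithm takes its values on the negative axis from above; near such a point it
is `log (-z) + πi` on the closed upper half-plane. -/
theorem Complex.hasDerivWithinAt_log_upper {w : ℂ} (hw : w ≠ 0) (him : 0 ≤ w.im) :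
    HasDerivWithinAt Complex.log w⁻¹ {z | 0 ≤ z.im} w := by
  by_cases hs : w ∈ Complex.slitPlane
  · exact (Complex.hasDerivAt_log hs).hasDerivWithinAt
  · have hre : w.re < 0 ∧ w.im = 0 := by
      rw [Complex.mem_slitPlane_iff, not_or, not_lt, not_not] at hs
      refine ⟨lt_of_le_of_ne hs.1 fun h => hw (Complex.ext h hs.2), hs.2⟩
    have h1 : HasDerivAt (fun z : ℂ => Complex.log (-z) + Real.pi * Complex.I) w⁻¹ w := by
      have h2 : -w ∈ Complex.slitPlane := by
        rw [Complex.mem_slitPlane_iff]; left; simpa using hre.1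
      have := ((Complex.hasDerivAt_log h2).comp w (hasDerivAt_neg w)).add_const
        (Real.pi * Complex.I : ℂ)
      refine this.congr_deriv ?_
      rw [inv_neg]; ring
    have heq : ∀ z : ℂ, 0 ≤ z.im → z.re < 0 →
        Complex.log z = Complex.log (-z) + Real.pi * Complex.I := by
      intro z hz hz'
      rw [Complex.log_neg_of_upper (hz.lt_or_eq.imp id fun h => ⟨h.symm, hz'⟩)]
      ring
    refine h1.hasDerivWithinAt.congr_of_eventuallyEq ?_ (heq w him hre.1)
    filter_upwards [self_mem_nhdsWithin, mem_nhdsWithin_of_mem_nhds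
      ((isOpen_lt Complex.continuous_re continuous_const).mem_nhds hre.1)] with z hz hz'
    exact heq z hz hz'

/-- The function `log (-z)` is a branch, up to a constant, that is regular on the closed lower
half-plane away from `0`. -/
theorem Complex.hasDerivWithinAt_log_neg_lower {w : ℂ} (hw : w ≠ 0) (him : w.im ≤ 0) :
    HasDerivWithinAt (fun z => Complex.log (-z)) w⁻¹ {z | z.im ≤ 0} w := by
  have h := Complex.hasDerivWithinAt_log_upper (neg_ne_zero.2 hw) (by simpa using him)
  have := h.comp w (hasDerivAt_neg w).hasDerivWithinAt (s := {z | z.im ≤ 0})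
    (fun z hz => by simpa using hz)
  refine this.congr_deriv ?_
  rw [inv_neg]; ring

/-! ### The function `g` and the integrand -/

section GFun

variable {m : ℕ}

/-- A bound for `g` at distance `δ` from the singularities. -/
noncomputable def gBound (g : Fin m → ℝ) (n : Fin m → ℕ) (δ : ℝ) : ℝ :=
  Real.exp (∑ i, |g i| / (4 * δ)) / ∏ i, δ ^ ((n i : ℝ) / 2)

theorem natCast_div_two (k : ℕ) : (k : ℂ) / 2 = (((k : ℝ) / 2 : ℝ) : ℂ) := by push_cast; rfl

theorem norm_gFun_le {θ g : Fin m → ℝ} {n : Fin m → ℕ} {δ : ℝ} (hδ : 0 < δ) {z : ℂ}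
    (hz : ∀ i, δ ≤ ‖(θ i : ℂ) + z‖) : ‖gFun θ g n z‖ ≤ gBound g n δ := by
  unfold gFun gBound
  rw [norm_div, norm_prod]
  refine div_le_div₀ (Real.exp_pos _).le ?_ (Finset.prod_pos fun i _ => by positivity) ?_
  · refine (Complex.norm_exp_le_exp_norm _).trans (Real.exp_le_exp.2 ?_)
    refine (norm_sum_le _ _).trans (Finset.sum_le_sum fun i _ => ?_)
    rw [norm_div, norm_mul, Complex.norm_real, Real.norm_eq_abs]
    have := hz i
    norm_num
    gcongr
  · refine Finset.prod_le_prod (fun i _ => by positivity) fun i _ => ?_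
    rw [natCast_div_two, Complex.norm_cpow_real]
    exact Real.rpow_le_rpow hδ.le (hz i) (by positivity)

theorem norm_integrand_le {θ g : Fin m → ℝ} {n : Fin m → ℕ} {s δ : ℝ} (hδ : 0 < δ) {z : ℂ}
    (hz : ∀ i, δ ≤ ‖(θ i : ℂ) + z‖) :
    ‖integrand θ g n s z‖ ≤ gBound g n δ * Real.exp (s * z.re) := by
  unfold integrand
  rw [norm_mul, Complex.norm_exp]
  simp only [Complex.mul_re, Complex.ofReal_re, Complex.ofReal_im, zero_mul, sub_zero]
  exact mul_le_mul_of_nonneg_right (norm_gFun_le hδ hz) (Real.exp_pos _).le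

/-- The total exponent `∑ n i / 2` is positive. This decay at large height takes the place of
absolute convergence. -/
theorem tendsto_gBound (g : Fin m → ℝ) {n : Fin m → ℕ} (hm : 0 < m) (hn : ∀ i, 1 ≤ n i) :
    Tendsto (gBound g n) atTop (𝓝 0) := by
  have h1 : Tendsto (fun δ : ℝ => Real.exp (∑ i, |g i| / (4 * δ))) atTop (𝓝 (Real.exp 0)) := by
    refine (Real.continuous_exp.tendsto 0).comp ?_
    have : Tendsto (fun δ : ℝ => ∑ i, |g i| / (4 * δ)) atTop (𝓝 (∑ _i : Fin m, 0)) :=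
      tendsto_finsetSum _ fun i _ =>
        tendsto_const_nhds.div_atTop (tendsto_id.const_mul_atTop (by norm_num))
    simpa using this
  have h2 : Tendsto (fun δ : ℝ => (∏ i, δ ^ ((n i : ℝ) / 2))⁻¹) atTop (𝓝 0) := by
    have hpos : 0 < ∑ i, (n i : ℝ) / 2 := by
      refine Finset.sum_pos (fun i _ => ?_) ⟨⟨0, hm⟩, Finset.mem_univ _⟩
      have : (1 : ℝ) ≤ n i := by exact_mod_cast hn i
      positivity
    refine ((tendsto_rpow_neg_atTop hpos)).congr' ?_
    filter_upwards [eventually_gt_atTop 0] with δ hδ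
    rw [Real.rpow_neg hδ.le, Real.rpow_sum_of_pos hδ]
  have := h1.mul h2
  rw [mul_zero] at this
  exact this.congr fun δ => (div_eq_mul_inv _ _).symm

theorem differentiableAt_gFun_of_mem_slitPlane {θ g : Fin m → ℝ} {n : Fin m → ℕ} {z : ℂ}
    (hz : ∀ i, (θ i : ℂ) + z ∈ Complex.slitPlane) : DifferentiableAt ℂ (gFun θ g n) z := by
  unfold gFun
  have hne : ∀ i, (θ i : ℂ) + z ≠ 0 := fun i => Complex.slitPlane_ne_zero (hz i)
  refine DifferentiableAt.div ?_ ?_ ?_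
  · refine DifferentiableAt.cexp (DifferentiableAt.fun_sum fun i _ => ?_)
    refine DifferentiableAt.div (by fun_prop) (by fun_prop) ?_
    exact mul_ne_zero (by norm_num) (hne i)
  · refine DifferentiableAt.fun_finsetProd fun i _ => ?_
    exact DifferentiableAt.cpow (by fun_prop) (by fun_prop) (hz i)
  · exact Finset.prod_ne_zero_iff.2 fun i _ => by simp [Complex.cpow_eq_zero_iff, hne i]

theorem mem_slitPlane_add {x : ℝ} {z : ℂ} (h : z.im ≠ 0 ∨ -x < z.re) :
    (x : ℂ) + z ∈ Complex.slitPlane := by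
  rw [Complex.mem_slitPlane_iff]
  rcases h with h | h
  · right; simpa using h
  · left; simp; linarith

/-- The base `-w` stays away from the branch cut, so the discontinuity of the power is confined to a
phase `e^{±πic}`; the real axis counts as the upper side. -/
theorem Complex.cpow_eq_neg_cpow_mul {w : ℂ} (hw : w.re < 0) (c : ℂ) :
    w ^ c = (-w) ^ c * Complex.exp ((if 0 ≤ w.im then 1 else -1) * (Real.pi * Complex.I * c)) := by
  have h0 : w ≠ 0 := fun h => by simp [h] at hw
  rw [Complex.cpow_def_of_ne_zero h0, Complex.cpow_def_of_ne_zero (neg_ne_zero.2 h0),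
    ← Complex.exp_add]
  congr 1
  split_ifs with h
  · rw [Complex.log_neg_of_upper (h.lt_or_eq.imp id fun h => ⟨h.symm, hw⟩)]; ring
  · rw [Complex.log_neg_of_lower (Or.inl (not_le.1 h))]; ring

/-- Flipping the sign of the bases with index below `k` costs the phase `e^{±πi ∑ n i / 2}`. An even
number of odd `n i` makes `∑ n i = 2M`, so the phase is `(-1)^M` on both sides of the axis, and near
`x` the function `g` coincides with a holomorphic one. -/
theorem differentiableAt_gFun_of_gap {θ g : Fin m → ℝ} {n : Fin m → ℕ} {k : ℕ} {x : ℝ}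
    (hx : x ∈ gap θ k) (hk : Even (oddCount n k)) : DifferentiableAt ℂ (gFun θ g n) x := by
  classical
  obtain ⟨M, hM⟩ : Even (∑ i ∈ Finset.univ.filter (fun i : Fin m => (i : ℕ) < k), n i) := by
    rw [Finset.even_sum_iff_even_card_odd]
    convert hk using 1
    unfold oddCount
    rw [Finset.filter_filter]
  set h : ℂ → ℂ := fun z => ∏ i : Fin m, (if (i : ℕ) < k then (-((θ i : ℂ) + z)) ^ ((n i : ℂ) / 2)
    else ((θ i : ℂ) + z) ^ ((n i : ℂ) / 2))
  have hslit : ∀ i : Fin m, (if (i : ℕ) < k then (-((θ i : ℂ) + x)) else ((θ i : ℂ) + x))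
      ∈ Complex.slitPlane := by
    intro i
    split_ifs with hi
    · have := (hx i).1 hi
      rw [Complex.mem_slitPlane_iff]; left; simp; linarith
    · have := (hx i).2 (not_lt.1 hi)
      rw [Complex.mem_slitPlane_iff]; left; simp; linarith
  have heq : gFun θ g n =ᶠ[𝓝 (x : ℂ)] fun z =>
      Complex.exp (∑ i, (g i : ℂ) / (4 * ((θ i : ℂ) + z))) / (h z * (-1) ^ M) := by
    have hnear : ∀ᶠ z : ℂ in 𝓝 (x : ℂ), ∀ i : Fin m, (i : ℕ) < k → z.re < -θ i := by
      rw [eventually_all]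
      intro i
      by_cases hi : (i : ℕ) < k
      · have : ∀ᶠ z : ℂ in 𝓝 (x : ℂ), z.re < -θ i :=
          (isOpen_lt Complex.continuous_re continuous_const).mem_nhds (by simpa using (hx i).1 hi)
        filter_upwards [this] with z hz _ using hz
      · exact Eventually.of_forall fun z h => absurd h hi
    filter_upwards [hnear] with z hz
    unfold gFun
    congr 1
    set ε : ℂ := if 0 ≤ z.im then 1 else -1
    have hterm : ∀ i : Fin m, ((θ i : ℂ) + z) ^ ((n i : ℂ) / 2) =
        (if (i : ℕ) < k then (-((θ i : ℂ) + z)) ^ ((n i : ℂ) / 2)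
          else ((θ i : ℂ) + z) ^ ((n i : ℂ) / 2)) *
        (if (i : ℕ) < k then Complex.exp (ε * (Real.pi * Complex.I * ((n i : ℂ) / 2))) else 1) := by
      intro i
      split_ifs with hi
      · rw [Complex.cpow_eq_neg_cpow_mul (by simpa using by linarith [hz i hi])]
        simp [ε]
      · rw [mul_one]
    rw [Finset.prod_congr rfl fun i _ => hterm i, Finset.prod_mul_distrib]
    congr 1
    rw [← Finset.prod_filter, ← Complex.exp_sum, ← Finset.mul_sum, ← Finset.mul_sum,
      ← Finset.sum_div, ← Nat.cast_sum, hM]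
    have hpi : Complex.exp (ε * (Real.pi * Complex.I)) = -1 := by
      simp only [ε]
      split_ifs
      · simp
      · rw [neg_one_mul, Complex.exp_neg, Complex.exp_pi_mul_I]; norm_num
    rw [← hpi, ← Complex.exp_nat_mul]
    congr 1
    push_cast; ring
  refine DifferentiableAt.congr_of_eventuallyEq ?_ heq
  have hne : ∀ i : Fin m, (θ i : ℂ) + x ≠ 0 := by
    intro i h0
    have := Complex.slitPlane_ne_zero (hslit i)
    rw [h0] at this
    simp at this
  refine DifferentiableAt.div ?_ (DifferentiableAt.mul_const ?_ _) ?_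
  · refine DifferentiableAt.cexp (DifferentiableAt.fun_sum fun i _ => ?_)
    refine DifferentiableAt.div (by fun_prop) (by fun_prop) ?_
    exact mul_ne_zero (by norm_num) (hne i)
  · refine DifferentiableAt.fun_finsetProd fun i _ => ?_
    have := hslit i
    split_ifs at this ⊢ with hi
    · exact DifferentiableAt.cpow (by fun_prop) (by fun_prop) this
    · exact DifferentiableAt.cpow (by fun_prop) (by fun_prop) this
  · refine mul_ne_zero (Finset.prod_ne_zero_iff.2 fun i _ => ?_) (by simp)
    have := Complex.slitPlane_ne_zero (hslit i)
    split_ifs at this ⊢ with hi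
    · simp only [ne_eq, Complex.cpow_eq_zero_iff, this, false_and, not_false_iff]
    · simp only [ne_eq, Complex.cpow_eq_zero_iff, this, false_and, not_false_iff]

theorem differentiableAt_integrand {θ g : Fin m → ℝ} {n : Fin m → ℕ} {s : ℝ} {z : ℂ}
    (h : DifferentiableAt ℂ (gFun θ g n) z) : DifferentiableAt ℂ (integrand θ g n s) z :=
  h.mul (by fun_prop)

theorem differentiableAt_integrand_of_notMem {θ g : Fin m → ℝ} (hθ : StrictMono θ)
    {n : Fin m → ℕ} {s : ℝ} {z : ℂ} (hz : z ∉ singularSet θ n) :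
    DifferentiableAt ℂ (integrand θ g n s) z := by
  refine differentiableAt_integrand ?_
  by_cases him : z.im = 0
  · obtain ⟨x, rfl⟩ : ∃ x : ℝ, z = x := ⟨z.re, Complex.ext rfl (by simpa using him)⟩
    obtain ⟨k, -, hk⟩ := exists_mem_gap hθ (x := x) fun j h =>
      ne_neg_of_notMem_singularSet hθ hz j (by rw [h]; push_cast; rfl)
    exact differentiableAt_gFun_of_gap hk (even_oddCount_of_gap hk hz)
  · exact differentiableAt_gFun_of_mem_slitPlane fun i => mem_slitPlane_add (Or.inl him)

end GFun

/-! ### Primitives of the integrand on the two half-planes -/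

section Inversion

variable {m : ℕ}

/-- `Φ` and `Ψ` are the primitives of the integrand on the upper and the lower half-plane that
vanish at infinity, extended to the real points off the singular set. -/
structure IsPrimitivePair (θ g : Fin m → ℝ) (n : Fin m → ℕ) (s : ℝ) (Φ Ψ : ℂ → ℂ) : Prop where
  upper : ∀ z ∉ singularSet θ n, 0 ≤ z.im →
    HasDerivWithinAt Φ (integrand θ g n s z) {z | 0 ≤ z.im} z
  lower : ∀ z ∉ singularSet θ n, z.im ≤ 0 →
    HasDerivWithinAt Ψ (integrand θ g n s z) {z | z.im ≤ 0} z
  upper_bound : ∀ z : ℂ, 0 < z.im → ∀ δ : ℝ, 0 < δ →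
    (∀ i, ∀ x : ℝ, x ≤ 0 → δ ≤ ‖(θ i : ℂ) + (z + x)‖) →
    ‖Φ z‖ ≤ gBound g n δ * Real.exp (s * z.re) / s
  lower_bound : ∀ z : ℂ, z.im < 0 → ∀ δ : ℝ, 0 < δ →
    (∀ i, ∀ x : ℝ, x ≤ 0 → δ ≤ ‖(θ i : ℂ) + (z + x)‖) →
    ‖Ψ z‖ ≤ gBound g n δ * Real.exp (s * z.re) / s

theorem abs_im_le_norm_add (x : ℝ) (z : ℂ) : |z.im| ≤ ‖(x : ℂ) + z‖ := by
  simpa using Complex.abs_im_le_norm ((x : ℂ) + z)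

/-- At height at least `η` every `θ i + z` has modulus at least `η`, which gives the exponential
bound needed for the normalised primitive. The sign `σ` treats both half-planes at once. -/
theorem exists_halfPlane_primitive_integrand {θ : Fin m → ℝ} (hθ : StrictMono θ) (g : Fin m → ℝ)
    (n : Fin m → ℕ) {s σ : ℝ} (hs : 0 < s) (hσ : |σ| = 1) :
    ∃ Φ : ℂ → ℂ, (∀ z ∉ singularSet θ n, 0 ≤ σ * z.im →
        HasDerivWithinAt Φ (integrand θ g n s z) {z | 0 ≤ σ * z.im} z) ∧
      ∀ z : ℂ, 0 < σ * z.im → ∀ δ : ℝ, 0 < δ →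
        (∀ i, ∀ x : ℝ, x ≤ 0 → δ ≤ ‖(θ i : ℂ) + (z + x)‖) →
        ‖Φ z‖ ≤ gBound g n δ * Real.exp (s * z.re) / s := by
  have hσ0 : σ ≠ 0 := fun h => by simp [h] at hσ
  have him : ∀ {z : ℂ}, 0 < σ * z.im → z.im ≠ 0 := fun hz h => by simp [h] at hz
  obtain ⟨Φ, h1, h2⟩ := exists_halfPlane_primitive (F := integrand θ g n s) hs hσ0
    (fun z hz => (differentiableAt_integrand (differentiableAt_gFun_of_mem_slitPlane
      fun i => mem_slitPlane_add (Or.inl (him hz)))).differentiableWithinAt)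
    (fun η hη => ⟨gBound g n η, fun w hw => norm_integrand_le hη fun i =>
      (hw.trans (le_abs_self _)).trans (by
        rw [abs_mul, hσ, one_mul]; exact abs_im_le_norm_add _ _)⟩)
  obtain ⟨Ψ, h3, h4⟩ := exists_primitive_extension hσ0 h1
  refine ⟨Ψ, fun z hz hz' => h4 z hz' ?_, fun z hz δ hδ hb => ?_⟩
  · obtain ⟨r, hr, hr'⟩ := Metric.isOpen_iff.1 (isClosed_singularSet θ n).isOpen_compl z hz
    exact ⟨r, hr, fun w hw =>
      (differentiableAt_integrand_of_notMem hθ (hr' hw)).differentiableWithinAt⟩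
  · rw [h3 z hz]
    refine h2 z hz _ fun x hx => ?_
    have := norm_integrand_le (g := g) (n := n) (s := s) hδ fun i => hb i x hx
    simpa using this

theorem exists_isPrimitivePair {θ : Fin m → ℝ} (hθ : StrictMono θ) (g : Fin m → ℝ)
    (n : Fin m → ℕ) {s : ℝ} (hs : 0 < s) : ∃ Φ Ψ : ℂ → ℂ, IsPrimitivePair θ g n s Φ Ψ := by
  obtain ⟨Φ, h1, h2⟩ := exists_halfPlane_primitive_integrand hθ g n hs (σ := 1) (by simp)
  obtain ⟨Ψ, h3, h4⟩ := exists_halfPlane_primitive_integrand hθ g n hs (σ := -1) (by simp)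
  simp only [one_mul, neg_mul, Left.nonneg_neg_iff, Left.neg_pos_iff] at h1 h2 h3 h4
  exact ⟨Φ, Ψ, h1, h3, h2, h4⟩

variable {θ g : Fin m → ℝ} {n : Fin m → ℕ} {s : ℝ} {Φ Ψ : ℂ → ℂ}

/-- The jump between the two primitives is constant on every gap between the cuts. -/
theorem IsPrimitivePair.jump_eq (h : IsPrimitivePair θ g n s Φ Ψ) {k : ℕ} {x y : ℝ}
    (hx : x ∈ gap θ k) (hy : y ∈ gap θ k) (hxS : (x : ℂ) ∉ singularSet θ n) :
    Φ x - Ψ x = Φ y - Ψ y := by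
  -- Both primitives have the integrand as derivative along the real axis.
  have hd : ∀ u ∈ gap θ k, HasDerivAt (fun u : ℝ => Φ u - Ψ u) 0 u := by
    intro u hu
    have huS := notMem_singularSet_of_gap hx hu hxS
    have h1 := HasDerivWithinAt.scomp (t' := {z : ℂ | 0 ≤ z.im}) (s := univ) u
      (h.upper u huS (by simp)) (Complex.ofRealCLM.hasDerivAt (x := u)).hasDerivWithinAt
      (fun v _ => by simp)
    have h2 := HasDerivWithinAt.scomp (t' := {z : ℂ | z.im ≤ 0}) (s := univ) u
      (h.lower u huS (by simp)) (Complex.ofRealCLM.hasDerivAt (x := u)).hasDerivWithinAt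
      (fun v _ => by simp)
    have := (h1.sub h2).hasDerivAt univ_mem
    rw [sub_self] at this
    exact this
  have hconv : Convex ℝ (gap θ k) := (ordConnected_gap θ k).convex
  have := hconv.norm_image_sub_le_of_norm_hasDerivWithin_le (C := 0)
    (fun u hu => (hd u hu).hasDerivWithinAt) (fun u _ => by simp) hy hx
  rw [zero_mul, norm_le_zero_iff, sub_eq_zero] at this
  exact this

/-! ### The inversion integral along vertical lines. -/

theorem mem_gap_zero {x : ℝ} : x ∈ gap θ 0 ↔ ∀ i, -θ i < x := by
  simp [gap]

theorem notMem_singularSet_of_lt {z : ℂ} (hz : ∀ i, -θ i < z.re) : z ∉ singularSet θ n := by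
  rw [mem_singularSet]
  rintro ⟨i, -, hi⟩
  exact absurd (singularPart_re_le hi) (not_le.2 (hz i))

theorem hasDerivAt_verticalLine (t₀ y : ℝ) : HasDerivAt (verticalLine t₀) Complex.I y := by
  have := ((Complex.ofRealCLM.hasDerivAt (x := y)).mul_const Complex.I).const_add (t₀ : ℂ)
  exact this.congr_deriv (by simp)

theorem contDiff_verticalLine (t₀ : ℝ) : ContDiff ℝ 1 (verticalLine t₀) :=
  contDiff_const.add (Complex.ofRealCLM.contDiff.mul contDiff_const)

/-- To the right of all singularities the jump is a single constant, so `Φ` and `Ψ` plus this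
constant glue to one primitive. -/
theorem IsPrimitivePair.contourIntegral_verticalLine (hθ : StrictMono θ)
    (h : IsPrimitivePair θ g n s Φ Ψ) {t₀ x₀ : ℝ} (ht : ∀ i, -θ i < t₀) (hx₀ : ∀ i, -θ i < x₀)
    {R : ℝ} (hR : 0 < R) :
    contourIntegral (integrand θ g n s) (verticalLine t₀) (-R) R =
      Φ (verticalLine t₀ R) - Ψ (verticalLine t₀ (-R)) - (Φ x₀ - Ψ x₀) := by
  set U : Set ℂ := {z | ∀ i, -θ i < z.re}
  have hU : IsOpen U := by
    have : U = ⋂ i, {z : ℂ | -θ i < z.re} := by ext; simp [U]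
    rw [this]
    exact isOpen_iInter_of_finite fun i => isOpen_lt continuous_const Complex.continuous_re
  obtain ⟨G, hG, hup, hlo⟩ := exists_primitive_of_halfPlanes hU (Φ x₀ - Ψ x₀)
    (fun z hz => h.upper z (notMem_singularSet_of_lt hz))
    (fun z hz => h.lower z (notMem_singularSet_of_lt hz)) (fun z hz him => by
      obtain ⟨x, rfl⟩ : ∃ x : ℝ, z = x := ⟨z.re, Complex.ext rfl (by simpa using him)⟩
      rw [h.jump_eq (x := x₀) (y := x) (mem_gap_zero.2 hx₀) (mem_gap_zero.2 fun i => by simpa using hz i)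
        (notMem_singularSet_of_lt (by simpa using hx₀))]
      ring)
  rw [((contDiff_verticalLine t₀).piecewiseC1 (-R) R).contourIntegral_eq_sub (by linarith)
    (U := U) (fun z hz => (differentiableAt_integrand_of_notMem hθ
      (notMem_singularSet_of_lt hz)).continuousAt.continuousWithinAt) hG
    (fun u _ i => by simpa [verticalLine] using ht i),
    hup _ (by simp [verticalLine, hR.le]), hlo _ (by simp [verticalLine, hR])]
  ring

/-- The leftward rays from the two ends of the line stay at height `R` in absolute value, hence at
distance at least `R` from the singularities. The explicit dependence on `s` serves later for
locally uniform convergence. -/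
theorem IsPrimitivePair.norm_truncatedInversion_sub_le (hθ : StrictMono θ)
    (h : IsPrimitivePair θ g n s Φ Ψ) {t₀ x₀ : ℝ} (ht : ∀ i, -θ i < t₀) (hx₀ : ∀ i, -θ i < x₀)
    {R : ℝ} (hR : 0 < R) :
    ‖truncatedInversion θ g n t₀ s R -
        kappa θ g n * (1 / (2 * (Real.pi : ℂ) * Complex.I) * -(Φ x₀ - Ψ x₀))‖ ≤
      |kappa θ g n| / Real.pi * (gBound g n R * Real.exp (s * t₀) / s) := by
  have h1 : ‖Φ (verticalLine t₀ R)‖ ≤ gBound g n R * Real.exp (s * t₀) / s := by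
    have := h.upper_bound (verticalLine t₀ R) (by simp [verticalLine, hR]) R hR fun i x hx => by
      have := abs_im_le_norm_add (θ i) (verticalLine t₀ R + x)
      rwa [show (verticalLine t₀ R + x).im = R by simp [verticalLine], abs_of_pos hR] at this
    simpa [verticalLine] using this
  have h2 : ‖Ψ (verticalLine t₀ (-R))‖ ≤ gBound g n R * Real.exp (s * t₀) / s := by
    have := h.lower_bound (verticalLine t₀ (-R)) (by simp [verticalLine, hR]) R hR fun i x hx => by
      have := abs_im_le_norm_add (θ i) (verticalLine t₀ (-R) + x)
      rwa [show (verticalLine t₀ (-R) + x).im = -R by simp [verticalLine], abs_neg,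
        abs_of_pos hR] at this
    simpa [verticalLine] using this
  rw [truncatedInversion, h.contourIntegral_verticalLine hθ ht hx₀ hR, ← mul_sub, ← mul_sub]
  rw [show Φ (verticalLine t₀ R) - Ψ (verticalLine t₀ (-R)) - (Φ x₀ - Ψ x₀) - -(Φ x₀ - Ψ x₀) =
    Φ (verticalLine t₀ R) - Ψ (verticalLine t₀ (-R)) by ring, norm_mul, norm_mul, norm_div,
    norm_mul, norm_mul, Complex.norm_I, Complex.norm_real, Complex.norm_real, Real.norm_eq_abs,
    Real.norm_eq_abs, abs_of_pos Real.pi_pos]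
  simp only [norm_one, Complex.norm_ofNat, mul_one]
  have hpi := Real.pi_pos
  calc |kappa θ g n| * (1 / (2 * Real.pi) * ‖Φ (verticalLine t₀ R) - Ψ (verticalLine t₀ (-R))‖)
      ≤ |kappa θ g n| * (1 / (2 * Real.pi) * (2 * (gBound g n R * Real.exp (s * t₀) / s))) := by
        gcongr
        refine (norm_sub_le _ _).trans (by linarith)
    _ = _ := by field_simp

theorem conj_gFun {z : ℂ} (hz : ∀ i, -θ i < z.re) :
    (starRingEnd ℂ) (gFun θ g n z) = gFun θ g n ((starRingEnd ℂ) z) := by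
  unfold gFun
  rw [map_div₀, ← Complex.exp_conj, map_sum, map_prod]
  congr 1
  · congr 1
    refine Finset.sum_congr rfl fun i _ => ?_
    rw [map_div₀, map_mul, map_add, Complex.conj_ofReal, Complex.conj_ofReal, Complex.conj_ofNat]
  · refine Finset.prod_congr rfl fun i _ => ?_
    have h := Complex.conj_cpow ((θ i : ℂ) + z) (((n i : ℝ) / 2 : ℝ) : ℂ)
      (Complex.slitPlane_arg_ne_pi (mem_slitPlane_add (Or.inr (hz i))))
    rw [Complex.conj_ofReal, map_add, Complex.conj_ofReal] at h
    rw [natCast_div_two, ← h]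

theorem conj_integrand {z : ℂ} (hz : ∀ i, -θ i < z.re) :
    (starRingEnd ℂ) (integrand θ g n s z) = integrand θ g n s ((starRingEnd ℂ) z) := by
  unfold integrand
  rw [map_mul, conj_gFun hz, ← Complex.exp_conj]
  simp

theorem truncatedInversion_eq (t₀ R : ℝ) : truncatedInversion θ g n t₀ s R =
    kappa θ g n * (1 / (2 * (Real.pi : ℂ)) *
      ∫ y in (-R)..R, integrand θ g n s (verticalLine t₀ y)) := by
  unfold truncatedInversion contourIntegral
  simp only [(hasDerivAt_verticalLine t₀ _).deriv]
  rw [intervalIntegral.integral_mul_const]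
  have := Complex.I_ne_zero
  have := Real.pi_ne_zero
  field_simp

/-- Conjugation reflects the line, `y ↦ -y`. Hence the inversion integral is real, and taking the
real part in `chiSqDensity` loses nothing. -/
theorem conj_truncatedInversion {t₀ : ℝ} (ht : ∀ i, -θ i < t₀) (R : ℝ) :
    (starRingEnd ℂ) (truncatedInversion θ g n t₀ s R) = truncatedInversion θ g n t₀ s R := by
  rw [truncatedInversion_eq]
  simp only [map_mul, map_div₀, map_one, Complex.conj_ofReal, Complex.conj_ofNat]
  congr 2
  rw [← intervalIntegral.intervalIntegral_conj]
  have hneg := intervalIntegral.integral_comp_neg (a := -R) (b := R)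
    (fun y => integrand θ g n s (verticalLine t₀ y))
  rw [neg_neg] at hneg
  rw [← hneg]
  refine intervalIntegral.integral_congr fun y _ => ?_
  rw [conj_integrand (by simpa [verticalLine] using ht)]
  simp [verticalLine]

theorem IsPrimitivePair.tendsto_truncatedInversion (hm : 0 < m) (hn : ∀ i, 1 ≤ n i)
    (hθ : StrictMono θ) (h : IsPrimitivePair θ g n s Φ Ψ) {t₀ x₀ : ℝ} (ht : ∀ i, -θ i < t₀)
    (hx₀ : ∀ i, -θ i < x₀) :
    Tendsto (truncatedInversion θ g n t₀ s) atTop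
      (𝓝 (kappa θ g n * (1 / (2 * (Real.pi : ℂ) * Complex.I) * -(Φ x₀ - Ψ x₀)))) := by
  rw [tendsto_iff_norm_sub_tendsto_zero]
  refine squeeze_zero' (g := fun R => |kappa θ g n| / Real.pi *
    (gBound g n R * Real.exp (s * t₀) / s)) (Eventually.of_forall fun R => norm_nonneg _) ?_ ?_
  · filter_upwards [eventually_gt_atTop 0] with R hR
    exact h.norm_truncatedInversion_sub_le hθ ht hx₀ hR
  · have := (((tendsto_gBound g hm hn).mul_const (Real.exp (s * t₀))).div_const s).const_mul
      (|kappa θ g n| / Real.pi)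
    simpa using this

theorem IsPrimitivePair.chiSqDensity_eq (hm : 0 < m) (hn : ∀ i, 1 ≤ n i) (hpos : ∀ i, 0 < θ i)
    (hθ : StrictMono θ) (hs : 0 < s) (h : IsPrimitivePair θ g n s Φ Ψ) {x₀ : ℝ}
    (hx₀ : ∀ i, -θ i < x₀) :
    (chiSqDensity θ g n s : ℂ) =
      kappa θ g n * (1 / (2 * (Real.pi : ℂ) * Complex.I) * -(Φ x₀ - Ψ x₀)) := by
  set L := (kappa θ g n : ℂ) * (1 / (2 * (Real.pi : ℂ) * Complex.I) * -(Φ x₀ - Ψ x₀))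
  have h0 : ∀ i, -θ i < 0 := fun i => by simpa using hpos i
  have ht : Tendsto (truncatedInversion θ g n 0 s) atTop (𝓝 L) :=
    h.tendsto_truncatedInversion hm hn hθ h0 hx₀
  have hre : Tendsto (fun R => (truncatedInversion θ g n 0 s R).re) atTop (𝓝 L.re) :=
    (Complex.continuous_re.tendsto _).comp ht
  have him : Tendsto (fun R => (truncatedInversion θ g n 0 s R).im) atTop (𝓝 L.im) :=
    (Complex.continuous_im.tendsto _).comp ht
  have hz : ∀ R, (truncatedInversion θ g n 0 s R).im = 0 := fun R =>
    Complex.conj_eq_iff_im.1 (conj_truncatedInversion h0 R)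
  simp only [hz] at him
  rw [chiSqDensity, if_pos hs, hre.limUnder_eq]
  exact Complex.ext (by simp) (by simpa using tendsto_nhds_unique tendsto_const_nhds him)

/-- The inversion integral converges to the density, with an explicit rate. -/
theorem norm_truncatedInversion_sub_chiSqDensity_le (hm : 0 < m) (hn : ∀ i, 1 ≤ n i)
    (hpos : ∀ i, 0 < θ i) (hθ : StrictMono θ) (hs : 0 < s) {t₀ : ℝ} (ht : ∀ i, -θ i < t₀) {R : ℝ}
    (hR : 0 < R) :
    ‖truncatedInversion θ g n t₀ s R - chiSqDensity θ g n s‖ ≤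
      |kappa θ g n| / Real.pi * (gBound g n R * Real.exp (s * t₀) / s) := by
  obtain ⟨Φ, Ψ, h⟩ := exists_isPrimitivePair hθ g n hs
  rw [h.chiSqDensity_eq hm hn hpos hθ hs ht]
  exact h.norm_truncatedInversion_sub_le hθ ht ht hR

theorem tendsto_truncatedInversion (hm : 0 < m) (hn : ∀ i, 1 ≤ n i)
    (hpos : ∀ i, 0 < θ i) (hθ : StrictMono θ) (hs : 0 < s) {t₀ : ℝ} (ht : ∀ i, -θ i < t₀) :
    Tendsto (truncatedInversion θ g n t₀ s) atTop (𝓝 (chiSqDensity θ g n s : ℂ)) := by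
  obtain ⟨Φ, Ψ, h⟩ := exists_isPrimitivePair hθ g n hs
  rw [h.chiSqDensity_eq hm hn hpos hθ hs ht]
  exact h.tendsto_truncatedInversion hm hn hθ ht ht

/-! ### Scaling -/

theorem Complex.ofReal_mul_cpow {c : ℝ} (hc : 0 < c) (w a : ℂ) :
    ((c : ℂ) * w) ^ a = (c : ℂ) ^ a * w ^ a := by
  have hc' : (c : ℂ) ≠ 0 := by exact_mod_cast hc.ne'
  rcases eq_or_ne w 0 with rfl | hw
  · rcases eq_or_ne a 0 with rfl | ha
    · simp
    · simp [ha]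
  · rw [Complex.cpow_def_of_ne_zero (mul_ne_zero hc' hw), Complex.cpow_def_of_ne_zero hc',
      Complex.cpow_def_of_ne_zero hw, Complex.log_ofReal_mul hc hw, ← Complex.exp_add,
      Complex.ofReal_log hc.le, add_mul]

theorem gFun_scale {c : ℝ} (hc : 0 < c) (z : ℂ) :
    gFun (fun i => c * θ i) (fun i => c * g i) n (c * z) =
      gFun θ g n z / ∏ i, ((c ^ ((n i : ℝ) / 2) : ℝ) : ℂ) := by
  have hc' : (c : ℂ) ≠ 0 := by exact_mod_cast hc.ne'
  unfold gFun
  rw [div_div, ← Finset.prod_mul_distrib]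
  congr 1
  · congr 1
    refine Finset.sum_congr rfl fun i _ => ?_
    push_cast
    rw [← mul_add, mul_left_comm, mul_div_mul_left _ _ hc']
  · refine Finset.prod_congr rfl fun i _ => ?_
    rw [Complex.ofReal_mul, ← mul_add, Complex.ofReal_mul_cpow hc, Complex.ofReal_cpow hc.le,
      ← natCast_div_two, mul_comm]

theorem kappa_scale {c : ℝ} (hc : 0 < c) (hpos : ∀ i, 0 < θ i) :
    kappa (fun i => c * θ i) (fun i => c * g i) n =
      (∏ i, c ^ ((n i : ℝ) / 2)) * kappa θ g n := by
  unfold kappa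
  rw [← mul_assoc, ← Finset.prod_mul_distrib]
  congr 1
  · exact Finset.prod_congr rfl fun i _ => Real.mul_rpow hc.le (hpos i).le
  · congr 2
    refine Finset.sum_congr rfl fun i _ => ?_
    rw [mul_left_comm, mul_div_mul_left _ _ hc.ne']

/-- After the substitution `t ↦ s t` the powers of `s` coming from `g` and from `κ` cancel; the
Jacobian `s` remains. -/
theorem truncatedInversion_scale (hpos : ∀ i, 0 < θ i) (hs : 0 < s) (R : ℝ) :
    truncatedInversion (fun i => s * θ i) (fun i => s * g i) n 0 1 (s * R) =
      s * truncatedInversion θ g n 0 s R := by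
  have hprod : (∏ i, ((s ^ ((n i : ℝ) / 2) : ℝ) : ℂ)) ≠ 0 :=
    Finset.prod_ne_zero_iff.2 fun i _ => by exact_mod_cast (Real.rpow_pos_of_pos hs _).ne'
  have hint : (s : ℂ) * ∫ y in (-R)..R,
      integrand (fun i => s * θ i) (fun i => s * g i) n 1 (verticalLine 0 (s * y)) =
      ∫ y in (-(s * R))..(s * R),
        integrand (fun i => s * θ i) (fun i => s * g i) n 1 (verticalLine 0 y) := by
    have := intervalIntegral.smul_integral_comp_mul_left (a := -R) (b := R)
      (fun y => integrand (fun i => s * θ i) (fun i => s * g i) n 1 (verticalLine 0 y)) s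
    rw [mul_neg] at this
    rw [← this, Complex.real_smul]
  have hF : ∀ y : ℝ, integrand (fun i => s * θ i) (fun i => s * g i) n 1 (verticalLine 0 (s * y)) =
      integrand θ g n s (verticalLine 0 y) / ∏ i, ((s ^ ((n i : ℝ) / 2) : ℝ) : ℂ) := by
    intro y
    have hv : verticalLine 0 (s * y) = s * verticalLine 0 y := by
      simp [verticalLine]; ring
    unfold integrand
    rw [hv, gFun_scale hs, div_mul_eq_mul_div]
    simp
  rw [truncatedInversion_eq, truncatedInversion_eq, ← hint]
  simp only [hF]
  rw [intervalIntegral.integral_div, kappa_scale hs hpos]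
  push_cast at hprod ⊢
  field_simp

theorem chiSqDensity_scale (hm : 0 < m) (hn : ∀ i, 1 ≤ n i) (hpos : ∀ i, 0 < θ i)
    (hθ : StrictMono θ) (hs : 0 < s) :
    chiSqDensity θ g n s = chiSqDensity (fun i => s * θ i) (fun i => s * g i) n 1 / s := by
  have h1 := (tendsto_truncatedInversion (g := g) hm hn hpos hθ hs (t₀ := 0)
    (by simpa using hpos)).const_mul (s : ℂ)
  have h2 := (tendsto_truncatedInversion (θ := fun i => s * θ i) (g := fun i => s * g i) hm hn
    (fun i => mul_pos hs (hpos i)) (fun i j hij => mul_lt_mul_of_pos_left (hθ hij) hs) one_pos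
    (t₀ := 0) (fun i => by simpa using mul_pos hs (hpos i))).comp (tendsto_id.const_mul_atTop hs)
  have h3 := tendsto_nhds_unique (h2.congr fun R => truncatedInversion_scale hpos hs R) h1
  rw [eq_div_iff hs.ne']
  have h4 : chiSqDensity (fun i => s * θ i) (fun i => s * g i) n 1 = s * chiSqDensity θ g n s := by
    exact_mod_cast h3
  rw [h4, mul_comm]

end Inversion

/-! ### Contour integrals around the cuts and poles -/

section Contours

variable {p : ℕ} {θ g : Fin p → ℝ} {n : Fin p → ℕ} {s : ℝ} {Φ Ψ : ℂ → ℂ}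

/-- After subtracting simple poles that account for the jumps, the integrand has a primitive
off the singular set. -/
theorem IsPrimitivePair.exists_global_primitive (hθ : StrictMono θ)
    (h : IsPrimitivePair θ g n s Φ Ψ) {y : ℕ → ℝ} (hy : ∀ k, y k ∈ gap θ k) :
    ∃ a : Fin p → ℂ, ∃ G : ℂ → ℂ,
      (∀ z ∉ singularSet θ n,
        HasDerivAt G (integrand θ g n s z - ∑ j, a j * (z + θ j)⁻¹) z) ∧
      (∀ z, 0 ≤ z.im → G z = Φ z - ∑ j, a j * Complex.log (z + θ j)) ∧
      (∀ z, z.im < 0 → G z = Ψ z - ∑ j, a j * (Complex.log (-(z + θ j)) - Real.pi * Complex.I) +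
        (Φ (y 0) - Ψ (y 0))) ∧
      2 * Real.pi * Complex.I * ∑ j, a j = (Φ (y p) - Ψ (y p)) - (Φ (y 0) - Ψ (y 0)) := by
  have hpi : (2 * Real.pi * Complex.I : ℂ) ≠ 0 := Complex.two_pi_I_ne_zero
  -- If the gap lies inside a cut, nothing is known about `Φ` and `Ψ` at `y k`, and `d k` is
  -- arbitrary. This does no harm, since the gluing takes place only on gaps off the cuts.
  set d : ℕ → ℂ := fun k => Φ (y k) - Ψ (y k) with hd
  -- The two branches of `log (z + θ j)` used above and below differ by `2πi` to the left of `-θ j`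
  -- and agree to its right. With these coefficients the logarithms absorb `d k - d 0` on the `k`-th
  -- gap, leaving the constant `d 0`.
  set a : Fin p → ℂ := fun j => (d (j + 1) - d j) / (2 * Real.pi * Complex.I) with ha
  have hsum : ∀ k ≤ p, 2 * Real.pi * Complex.I * ∑ j : Fin p, (if (j : ℕ) < k then a j else 0) =
      d k - d 0 := by
    intro k hk
    rw [Finset.mul_sum, ← Finset.sum_range_sub d k]
    have hterm : ∀ j : Fin p, 2 * Real.pi * Complex.I * (if (j : ℕ) < k then a j else 0) =
        (fun i : ℕ => if i < k then d (i + 1) - d i else 0) j := by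
      intro j
      by_cases hj : (j : ℕ) < k
      · simp only [hj, if_true, ha]
        field_simp
      · simp [hj]
    rw [Finset.sum_congr rfl fun j _ => hterm j, Fin.sum_univ_eq_sum_range
      (fun i : ℕ => if i < k then d (i + 1) - d i else 0), ← Finset.sum_filter]
    refine Finset.sum_congr ?_ fun _ _ => rfl
    ext i
    simp only [Finset.mem_filter, Finset.mem_range]
    omega
  have hne : ∀ z ∉ singularSet θ n, ∀ j, z + (θ j : ℂ) ≠ 0 := fun z hz j h0 =>
    ne_neg_of_notMem_singularSet hθ hz j (eq_neg_of_add_eq_zero_left h0)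
  suffices H : ∃ G : ℂ → ℂ, (∀ z ∈ (singularSet θ n)ᶜ,
        HasDerivAt G (integrand θ g n s z - ∑ j, a j * (z + θ j)⁻¹) z) ∧
      (∀ z, 0 ≤ z.im → G z = Φ z - ∑ j, a j * Complex.log (z + θ j)) ∧
      (∀ z, z.im < 0 → G z = Ψ z - ∑ j, a j * (Complex.log (-(z + θ j)) - Real.pi * Complex.I) +
        d 0) by
    obtain ⟨G, h1, h2, h3⟩ := H
    exact ⟨a, G, fun z hz => h1 z hz, h2, h3, by simpa using hsum p le_rfl⟩
  refine exists_primitive_of_halfPlanes (isClosed_singularSet θ n).isOpen_compl (d 0) ?_ ?_ ?_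
  · intro z hz him
    refine (h.upper z hz him).sub (HasDerivWithinAt.fun_sum fun j _ =>
      HasDerivWithinAt.const_mul (a j) ?_)
    have := (Complex.hasDerivWithinAt_log_upper (hne z hz j) (by simpa using him)).comp z
      ((hasDerivAt_id z).add_const (θ j : ℂ)).hasDerivWithinAt (s := {z | 0 ≤ z.im})
      (fun w hw => by simpa using hw)
    rw [mul_one] at this
    exact this
  · intro z hz him
    refine (h.lower z hz him).sub (HasDerivWithinAt.fun_sum fun j _ =>
      HasDerivWithinAt.const_mul (a j) (HasDerivWithinAt.sub_const _ ?_))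
    have := (Complex.hasDerivWithinAt_log_neg_lower (hne z hz j) (by simpa using him)).comp z
      ((hasDerivAt_id z).add_const (θ j : ℂ)).hasDerivWithinAt (s := {z | z.im ≤ 0})
      (fun w hw => by simpa using hw)
    rw [mul_one] at this
    exact this
  · intro z hz him
    obtain ⟨x, rfl⟩ : ∃ x : ℝ, z = x := ⟨z.re, Complex.ext rfl (by simpa using him)⟩
    obtain ⟨k, hkp, hk⟩ := exists_mem_gap hθ (x := x) fun j h' =>
      ne_neg_of_notMem_singularSet hθ hz j (by rw [h']; push_cast; rfl)
    have hj := h.jump_eq hk (hy k) hz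
    have hlog : ∀ j : Fin p, a j * Complex.log (x + θ j) =
        a j * (Complex.log (-(x + θ j)) - Real.pi * Complex.I) +
          2 * Real.pi * Complex.I * (if (j : ℕ) < k then a j else 0) := by
      intro j
      split_ifs with hjk
      · have := (hk j).1 hjk
        rw [Complex.log_neg_of_upper (Or.inr ⟨by simp, by simp; linarith⟩)]
        ring
      · have := (hk j).2 (not_lt.1 hjk)
        rw [Complex.log_neg_of_lower (Or.inr ⟨by simp, by simp; linarith⟩)]
        ring
    rw [Finset.sum_congr rfl fun j _ => hlog j, Finset.sum_add_distrib, ← Finset.mul_sum,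
      hsum k hkp]
    have : Φ x = Ψ x + d k := by rw [hd]; simp only; rw [← hj]; ring
    rw [this]; ring

theorem integral_deriv_div_eq (c : ℝ → ℂ) (a b : ℝ) (w : ℂ) :
    ∫ u in a..b, deriv c u / (c u - w) = 2 * Real.pi * Complex.I * windingNumber c a b w -
      ∫ v in (0 : ℝ)..1, (c a - c b) / (c b + (v : ℂ) * (c a - c b) - w) := by
  have hpi : (2 * Real.pi * Complex.I : ℂ) ≠ 0 := Complex.two_pi_I_ne_zero
  unfold windingNumber
  rw [← mul_assoc, mul_one_div_cancel hpi]
  ring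

/-- Integration of the integrand along a curve that avoids the singular set. -/
theorem contourIntegral_integrand_eq (hθ : StrictMono θ) {a : Fin p → ℂ} {G : ℂ → ℂ}
    (hG : ∀ z ∉ singularSet θ n,
      HasDerivAt G (integrand θ g n s z - ∑ j, a j * (z + θ j)⁻¹) z)
    {c : ℝ → ℂ} {u v : ℝ} (huv : u ≤ v) (hc : PiecewiseC1 c u v)
    (hav : ∀ x ∈ Icc u v, c x ∉ singularSet θ n) :
    contourIntegral (integrand θ g n s) c u v = G (c v) - G (c u) +
      ∑ j, a j * ∫ x in u..v, deriv c x / (c x - (-(θ j : ℂ))) := by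
  have hne : ∀ z ∉ singularSet θ n, ∀ j, z + (θ j : ℂ) ≠ 0 := fun z hz j h0 =>
    ne_neg_of_notMem_singularSet hθ hz j (eq_neg_of_add_eq_zero_left h0)
  have cF : ContinuousOn (integrand θ g n s) (singularSet θ n)ᶜ := fun z hz =>
    (differentiableAt_integrand_of_notMem hθ hz).continuousAt.continuousWithinAt
  have cj : ∀ j, ContinuousOn (fun z : ℂ => (z + θ j)⁻¹) (singularSet θ n)ᶜ := fun j =>
    (continuousOn_id.add continuousOn_const).inv₀ fun z hz => hne z hz j
  have cS : ContinuousOn (fun z : ℂ => ∑ j, a j * (z + θ j)⁻¹) (singularSet θ n)ᶜ :=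
    continuousOn_finsetSum _ fun j _ => continuousOn_const.mul (cj j)
  have hE := hc.contourIntegral_eq_sub huv (cF.sub cS) hG hav
  have iE := hc.intervalIntegrable huv (cF.sub cS) hav
  have ij := fun j => hc.intervalIntegrable huv (cj j) hav
  have iS : IntervalIntegrable (fun x => ∑ j, a j * ((c x + θ j)⁻¹ * deriv c x)) volume u v := by
    have := IntervalIntegrable.sum Finset.univ (f := fun j x => a j * ((c x + θ j)⁻¹ * deriv c x))
      fun j _ => (ij j).const_mul (a j)
    have e : (∑ j, fun x => a j * ((c x + θ j)⁻¹ * deriv c x)) =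
        fun x => ∑ j, a j * ((c x + θ j)⁻¹ * deriv c x) := by
      funext x; simp
    rwa [e] at this
  rw [← hE]
  unfold contourIntegral
  have h1 : ∀ j, a j * ∫ x in u..v, deriv c x / (c x - (-(θ j : ℂ))) =
      ∫ x in u..v, a j * ((c x + θ j)⁻¹ * deriv c x) := by
    intro j
    rw [intervalIntegral.integral_const_mul]
    congr 1
    refine intervalIntegral.integral_congr fun x _ => ?_
    simp only [sub_neg_eq_add]
    rw [div_eq_mul_inv, mul_comm]
  rw [Finset.sum_congr rfl fun j _ => h1 j, ← intervalIntegral.integral_finsetSum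
    fun j _ => (ij j).const_mul (a j), ← intervalIntegral.integral_add iE iS]
  refine intervalIntegral.integral_congr fun x _ => ?_
  simp only [Pi.sub_apply]
  rw [sub_mul, Finset.sum_mul]
  simp only [mul_assoc]
  ring

open scoped Classical in
-- The part with a primitive contributes nothing, and each `-θ j` lies in some part of the singular
-- set, so its winding number is prescribed as `1` or `0`.
theorem contourIntegral_closed_eq (hθ : StrictMono θ) {a : Fin p → ℂ} {G : ℂ → ℂ}
    (hG : ∀ z ∉ singularSet θ n,
      HasDerivAt G (integrand θ g n s z - ∑ j, a j * (z + θ j)⁻¹) z)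
    {i : Fin p} {c : ℝ → ℂ} (hc : IsClosedContour θ n i c) :
    contourIntegral (integrand θ g n s) c 0 1 =
      2 * Real.pi * Complex.I *
        ∑ j, if -(θ j : ℂ) ∈ singularPart θ n i then a j else 0 := by
  rw [contourIntegral_integrand_eq hθ hG zero_le_one hc.piecewise fun x hx hxS => by
    obtain ⟨j, hj, hj'⟩ := mem_singularSet.1 hxS
    exact hc.avoids x hx j hj hj', hc.closed, sub_self, zero_add, Finset.mul_sum]
  refine Finset.sum_congr rfl fun j _ => ?_
  rw [integral_deriv_div_eq, hc.closed]
  split_ifs with h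
  · rw [hc.encloses _ h]; simp [mul_comm]
  · obtain ⟨i', hi', hj⟩ := exists_neg_mem_singularPart hθ n j
    rw [hc.excludes i' hi' (fun h' => h (h' ▸ hj)) _ hj]; simp

/-- To the left of `w` the difference `w - z` has positive real part, so `log (w - z)` is a
primitive of `1 / (z - w)`. -/
theorem integral_segment_left (w : ℂ) {a b : ℂ} (ha : a.re < w.re) (hb : b.re < w.re) :
    ∫ v in (0 : ℝ)..1, (b - a) / (a + (v : ℂ) * (b - a) - w) =
      Complex.log (w - b) - Complex.log (w - a) := by
  have hsl : ∀ z : ℂ, z.re < w.re → w - z ∈ Complex.slitPlane := fun z hz => by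
    rw [Complex.mem_slitPlane_iff]; left; simpa using hz
  have hD : ∀ z ∈ {z : ℂ | z.re < w.re}, HasDerivAt (fun z => Complex.log (w - z)) (z - w)⁻¹ z := by
    intro z hz
    have := ((Complex.hasDerivAt_log (hsl z hz)).comp z ((hasDerivAt_id z).const_sub w))
    refine this.congr_deriv ?_
    rw [mul_neg_one, ← inv_neg, neg_sub]
  have := integral_segment_eq_sub (f := fun z => (z - w)⁻¹) (U := {z : ℂ | z.re < w.re})
    (a := a) (b := b) (fun z hz => ?_) hD (fun v hv => ?_)
  · rw [← this]
    refine intervalIntegral.integral_congr fun v _ => ?_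
    rw [div_eq_mul_inv, mul_comm]
  · refine ContinuousAt.continuousWithinAt (ContinuousAt.inv₀ (by fun_prop) ?_)
    rw [← neg_ne_zero, neg_sub]
    exact Complex.slitPlane_ne_zero (hsl z hz)
  · have : (a + (v : ℂ) * (b - a)).re = (1 - v) * a.re + v * b.re := by simp; ring
    simp only [mem_ofPred_eq, this]
    rcases hv.1.eq_or_lt with rfl | h0
    · simpa using ha
    · nlinarith [hv.2, mul_lt_mul_of_pos_left hb h0,
        mul_le_mul_of_nonneg_left ha.le (sub_nonneg.2 hv.2)]

theorem one_le_norm_add_of_left {z : ℂ} {x : ℝ} (hx : x ≤ 0) {t : ℝ} (hz : z.re ≤ -t - 1) :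
    1 ≤ ‖(t : ℂ) + (z + x)‖ := by
  refine le_trans ?_ (Complex.abs_re_le_norm _)
  rw [le_abs]; right
  simp; linarith

/-- Far to the left the bound holds with `δ = 1` whatever the height, so a keyhole may come
arbitrarily close to the cut. -/
theorem IsPrimitivePair.tendsto_upper (h : IsPrimitivePair θ g n s Φ Ψ) (hs : 0 < s)
    {ι : Type*} {l : Filter ι} {c : ι → ℂ} (hre : Tendsto (fun u => (c u).re) l atBot)
    (him : ∀ᶠ u in l, 0 < (c u).im) : Tendsto (fun u => Φ (c u)) l (𝓝 0) := by
  have hexp : Tendsto (fun u => gBound g n 1 * Real.exp (s * (c u).re) / s) l (𝓝 0) := by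
    have := ((Real.tendsto_exp_atBot.comp (hre.const_mul_atBot hs)).const_mul
      (gBound g n 1)).div_const s
    simpa using this
  refine squeeze_zero_norm' ?_ hexp
  have hre' : ∀ᶠ u in l, ∀ i, (c u).re ≤ -θ i - 1 :=
    eventually_all.2 fun i => hre.eventually (eventually_le_atBot _)
  filter_upwards [him, hre'] with u h1 h2
  exact h.upper_bound _ h1 1 one_pos fun i x hx => one_le_norm_add_of_left hx (h2 i)

theorem IsPrimitivePair.tendsto_lower (h : IsPrimitivePair θ g n s Φ Ψ) (hs : 0 < s)
    {ι : Type*} {l : Filter ι} {c : ι → ℂ} (hre : Tendsto (fun u => (c u).re) l atBot)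
    (him : ∀ᶠ u in l, (c u).im < 0) : Tendsto (fun u => Ψ (c u)) l (𝓝 0) := by
  have hexp : Tendsto (fun u => gBound g n 1 * Real.exp (s * (c u).re) / s) l (𝓝 0) := by
    have := ((Real.tendsto_exp_atBot.comp (hre.const_mul_atBot hs)).const_mul
      (gBound g n 1)).div_const s
    simpa using this
  refine squeeze_zero_norm' ?_ hexp
  have hre' : ∀ᶠ u in l, ∀ i, (c u).re ≤ -θ i - 1 :=
    eventually_all.2 fun i => hre.eventually (eventually_le_atBot _)
  filter_upwards [him, hre'] with u h1 h2
  exact h.lower_bound _ h1 1 one_pos fun i x hx => one_le_norm_add_of_left hx (h2 i)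

open scoped Classical in
-- At the ends `Φ` and `Ψ` tend to `0`. The logarithms in the end values of `G` cancel those from
-- the segment that closes the curve, except for a half turn `-πi` at each end; these account for
-- `-2πi ∑ a j`, and the gluing constant for `-D`.
theorem tendsto_contourIntegral_keyhole (hθ : StrictMono θ) (hs : 0 < s)
    (h : IsPrimitivePair θ g n s Φ Ψ) {a : Fin p → ℂ} {G : ℂ → ℂ} {D : ℂ}
    (hG : ∀ z ∉ singularSet θ n,
      HasDerivAt G (integrand θ g n s z - ∑ j, a j * (z + θ j)⁻¹) z)
    (hup : ∀ z, 0 ≤ z.im → G z = Φ z - ∑ j, a j * Complex.log (z + θ j))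
    (hlo : ∀ z, z.im < 0 →
      G z = Ψ z - ∑ j, a j * (Complex.log (-(z + θ j)) - Real.pi * Complex.I) + D)
    {i : Fin p} {c : ℝ → ℂ} (hc : IsKeyholeContour θ n i c) :
    Tendsto (fun R : ℝ => contourIntegral (integrand θ g n s) c (-R) R) atTop
      (𝓝 (2 * Real.pi * Complex.I *
        (∑ j, if -(θ j : ℂ) ∈ singularPart θ n i then a j else 0) -
        2 * Real.pi * Complex.I * ∑ j, a j - D)) := by
  set N : Fin p → ℂ := fun j => if -(θ j : ℂ) ∈ singularPart θ n i then 1 else 0 with hN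
  have hwind : ∀ᶠ R : ℝ in atTop, ∀ j, windingNumber c (-R) R (-(θ j : ℂ)) = N j := by
    refine eventually_all.2 fun j => ?_
    simp only [hN]
    split_ifs with hj
    · exact hc.encloses _ hj
    · obtain ⟨i', hi', hj'⟩ := exists_neg_mem_singularPart hθ n j
      exact hc.excludes i' hi' (fun h' => hj (h' ▸ hj')) _ hj'
  have hneg : Tendsto (fun R : ℝ => -R) atTop atBot := tendsto_neg_atTop_atBot
  have hre1 : ∀ᶠ R : ℝ in atTop, ∀ j, (c R).re < -θ j :=
    eventually_all.2 fun j => hc.re_end.eventually (eventually_lt_atBot _)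
  have hre2 : ∀ᶠ R : ℝ in atTop, ∀ j, (c (-R)).re < -θ j :=
    eventually_all.2 fun j => (hc.re_start.comp hneg).eventually (eventually_lt_atBot _)
  have hlim : Tendsto (fun R : ℝ => Φ (c R) - Ψ (c (-R)) +
      (2 * Real.pi * Complex.I *
        (∑ j, if -(θ j : ℂ) ∈ singularPart θ n i then a j else 0) -
        2 * Real.pi * Complex.I * ∑ j, a j - D)) atTop
      (𝓝 (0 - 0 + (2 * Real.pi * Complex.I *
        (∑ j, if -(θ j : ℂ) ∈ singularPart θ n i then a j else 0) -
        2 * Real.pi * Complex.I * ∑ j, a j - D))) :=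
    ((h.tendsto_upper hs hc.re_end hc.im_end).sub
      (h.tendsto_lower hs (hc.re_start.comp hneg) (hneg.eventually hc.im_start))).add_const _
  rw [sub_zero, zero_add] at hlim
  refine hlim.congr' ?_
  filter_upwards [hwind, hre1, hre2, hc.im_end, hneg.eventually hc.im_start,
    eventually_ge_atTop 0] with R h1 h2 h3 h4 h5 h6
  rw [contourIntegral_integrand_eq hθ hG (by linarith) (hc.piecewise R) fun x _ hxS => by
    obtain ⟨j, hj, hj'⟩ := mem_singularSet.1 hxS
    exact hc.avoids x j hj hj']
  have hint : ∀ j, a j * ∫ x in (-R)..R, deriv c x / (c x - (-(θ j : ℂ))) =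
      2 * Real.pi * Complex.I * (if -(θ j : ℂ) ∈ singularPart θ n i then a j else 0) +
      a j * Complex.log (-(c R + θ j)) - a j * Complex.log (-(c (-R) + θ j)) := by
    intro j
    rw [integral_deriv_div_eq, h1 j, integral_segment_left _ (by simpa using h2 j)
      (by simpa using h3 j)]
    rw [show -(θ j : ℂ) - c (-R) = -(c (-R) + θ j) by ring,
      show -(θ j : ℂ) - c R = -(c R + θ j) by ring]
    simp only [hN]
    split_ifs <;> ring
  have hlog : ∀ j, a j * Complex.log (-(c R + θ j)) =
      a j * Complex.log (c R + θ j) - a j * (Real.pi * Complex.I) := by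
    intro j
    rw [Complex.log_neg_of_upper (Or.inl (by simpa using h4))]; ring
  rw [Finset.sum_congr rfl fun j _ => hint j, Finset.sum_sub_distrib, Finset.sum_add_distrib,
    Finset.sum_congr rfl fun j _ => hlog j, Finset.sum_sub_distrib, hup _ h4.le, hlo _ h5,
    ← Finset.mul_sum, ← Finset.sum_mul]
  simp only [mul_sub, Finset.sum_sub_distrib, ← Finset.sum_mul]
  ring

/-- Here the real axis far to the left is off the singular set, so the bounds on `Φ` and `Ψ` pass to
it by continuity. The jump is constant on this gap and `O(e^{sx})` as `x → -∞`. -/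
theorem IsPrimitivePair.jump_eq_zero (h : IsPrimitivePair θ g n s Φ Ψ) (hs : 0 < s)
    (hp : Even (oddCount n p)) {y : ℝ} (hy : y ∈ gap θ p) : Φ y - Ψ y = 0 := by
  have hS : ∀ x ∈ gap θ p, (x : ℂ) ∉ singularSet θ n := fun x hx => notMem_singularSet_of_even hx hp
  have hvert : ∀ x : ℝ, Tendsto (fun ε : ℝ => (x : ℂ) + ε * Complex.I) (𝓝 0) (𝓝 (x : ℂ)) := by
    intro x
    have : Continuous fun ε : ℝ => (x : ℂ) + ε * Complex.I := by fun_prop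
    simpa using this.tendsto 0
  have key : ∀ x : ℝ, (∀ i, x ≤ -θ i - 1) →
      ‖Φ x - Ψ x‖ ≤ 2 * (gBound g n 1 * Real.exp (s * x) / s) := by
    intro x hx
    have hgap : x ∈ gap θ p := fun j => ⟨fun _ => by linarith [hx j], fun hj => by
      have := j.2; omega⟩
    have h1 : ‖Φ x‖ ≤ gBound g n 1 * Real.exp (s * x) / s := by
      have ht : Tendsto (fun ε : ℝ => Φ ((x : ℂ) + ε * Complex.I)) (𝓝[>] 0) (𝓝 (Φ x)) := by
        refine (h.upper x (hS x hgap) (by simp)).continuousWithinAt.tendsto.comp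
          (tendsto_nhdsWithin_iff.2 ⟨(hvert x).mono_left nhdsWithin_le_nhds, ?_⟩)
        filter_upwards [self_mem_nhdsWithin] with ε hε
        simpa using le_of_lt hε
      refine le_of_tendsto ht.norm ?_
      filter_upwards [self_mem_nhdsWithin] with ε hε
      have := h.upper_bound ((x : ℂ) + ε * Complex.I) (by simpa using hε) 1 one_pos
        fun i u hu => one_le_norm_add_of_left hu (by simpa using hx i)
      simpa using this
    have h2 : ‖Ψ x‖ ≤ gBound g n 1 * Real.exp (s * x) / s := by
      have ht : Tendsto (fun ε : ℝ => Ψ ((x : ℂ) + ε * Complex.I)) (𝓝[<] 0) (𝓝 (Ψ x)) := by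
        refine (h.lower x (hS x hgap) (by simp)).continuousWithinAt.tendsto.comp
          (tendsto_nhdsWithin_iff.2 ⟨(hvert x).mono_left nhdsWithin_le_nhds, ?_⟩)
        filter_upwards [self_mem_nhdsWithin] with ε hε
        simpa using le_of_lt hε
      refine le_of_tendsto ht.norm ?_
      filter_upwards [self_mem_nhdsWithin] with ε hε
      have := h.lower_bound ((x : ℂ) + ε * Complex.I) (by simpa using hε) 1 one_pos
        fun i u hu => one_le_norm_add_of_left hu (by simpa using hx i)
      simpa using this
    exact (norm_sub_le _ _).trans (by linarith)
  have hlim : Tendsto (fun x : ℝ => 2 * (gBound g n 1 * Real.exp (s * x) / s)) atBot (𝓝 0) := by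
    have := (((Real.tendsto_exp_atBot.comp (tendsto_id.const_mul_atBot hs)).const_mul
      (gBound g n 1)).div_const s).const_mul 2
    simpa using this
  rw [← norm_le_zero_iff]
  refine ge_of_tendsto hlim ?_
  have hx : ∀ᶠ x : ℝ in atBot, ∀ i, x ≤ -θ i - 1 :=
    eventually_all.2 fun i => eventually_le_atBot _
  filter_upwards [hx] with x hx
  have hgap : x ∈ gap θ p := fun j => ⟨fun _ => by linarith [hx j], fun hj => by
    have := j.2; omega⟩
  rw [h.jump_eq hy hgap (hS y hy)]
  exact key x hx

/-- The contour integrals add up to the jump of the primitives to the right of all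
singularities. -/
theorem IsPrimitivePair.exists_sum_contourIntegral (hθ : StrictMono θ) (hs : 0 < s)
    (h : IsPrimitivePair θ g n s Φ Ψ) {Γ : Fin p → ℝ → ℂ} (hΓ : IsContourSystem θ n Γ)
    {x₀ : ℝ} (hx₀ : ∀ i, -θ i < x₀) :
    ∃ J : Fin p → ℂ, (∀ i ∈ cutStarts n ∪ typeOne n,
        HasIntegralAlong n i (integrand θ g n s) (Γ i) (J i)) ∧
      ∑ i ∈ cutStarts n ∪ typeOne n, J i = -(Φ x₀ - Ψ x₀) := by
  classical
  choose y hy using gap_nonempty hθ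
  obtain ⟨a, G, hG, hup, hlo, hsum⟩ := h.exists_global_primitive hθ hy
  have hd0 : Φ (y 0) - Ψ (y 0) = Φ x₀ - Ψ x₀ :=
    h.jump_eq (hy 0) (mem_gap_zero.2 hx₀)
      (notMem_singularSet_of_lt (by simpa using mem_gap_zero.1 (hy 0)))
  rw [hd0] at hsum hlo
  set A := cutStarts n ∪ typeOne n
  set B : ℂ := 2 * Real.pi * Complex.I * ∑ j, a j with hB
  set K : Fin p → ℂ := fun i => 2 * Real.pi * Complex.I *
    ∑ j, if -(θ j : ℂ) ∈ singularPart θ n i then a j else 0 with hK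
  -- Each `-θ j` lies in exactly one part, so each `a j` is counted once.
  have hKsum : ∑ i ∈ A, K i = B := by
    simp only [hK, hB]
    rw [← Finset.mul_sum, Finset.sum_comm]
    congr 1
    refine Finset.sum_congr rfl fun j _ => ?_
    obtain ⟨i, hi, hij⟩ := exists_neg_mem_singularPart hθ n j
    rw [Finset.sum_eq_single_of_mem i hi fun i' hi' hne => if_neg fun h' =>
      hne (singularPart_inj hθ hi' hi h' hij), if_pos hij]
  refine ⟨fun i => K i + if IsUnboundedCut n i then -B - (Φ x₀ - Ψ x₀) else 0,
    fun i hi => ⟨fun hu => ?_, fun hu => ?_⟩, ?_⟩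
  · have := tendsto_contourIntegral_keyhole hθ hs h hG hup hlo ((hΓ i hi).1 hu)
    simp only [hu, if_true]
    convert this using 2
    ring
  · simp only [hu, if_false, add_zero]
    exact contourIntegral_closed_eq hθ hG ((hΓ i hi).2 hu)
  · rw [Finset.sum_add_distrib, hKsum]
    -- With an unbounded cut its extra term cancels `B`, so the arbitrary value `d p` drops out.
    -- Otherwise `B` is the leftmost jump, which is zero, minus the rightmost one.
    by_cases hex : ∃ u, IsUnboundedCut n u
    · obtain ⟨u, hu⟩ := hex
      rw [Finset.sum_eq_single_of_mem u (Finset.mem_union_left _ hu.1) fun i _ hne =>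
        if_neg fun h' => hne (h'.unique hu), if_pos hu]
      ring
    · push Not at hex
      rw [Finset.sum_eq_zero fun i _ => if_neg (hex i), hsum,
        h.jump_eq_zero hs (even_oddCount_of_no_unboundedCut hex) (hy p)]
      ring

/-- The density as a sum of contour integrals. -/
theorem exists_chiSqDensity_eq_sum_contourIntegral (hp : 0 < p) (hn : ∀ i, 1 ≤ n i)
    (hpos : ∀ i, 0 < θ i) (hθ : StrictMono θ) (hs : 0 < s) {Γ : Fin p → ℝ → ℂ}
    (hΓ : IsContourSystem θ n Γ) :
    ∃ J : Fin p → ℂ, (∀ i ∈ cutStarts n ∪ typeOne n,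
        HasIntegralAlong n i (integrand θ g n s) (Γ i) (J i)) ∧
      (chiSqDensity θ g n s : ℂ) = (kappa θ g n : ℂ) *
        (1 / (2 * (Real.pi : ℂ) * Complex.I) * ∑ i ∈ cutStarts n, J i +
          1 / (2 * (Real.pi : ℂ) * Complex.I) * ∑ i ∈ typeOne n, J i) := by
  obtain ⟨Φ, Ψ, h⟩ := exists_isPrimitivePair hθ g n hs
  have h0 : ∀ i, -θ i < 0 := fun i => by simpa using hpos i
  obtain ⟨J, hJ, hsum⟩ := h.exists_sum_contourIntegral hθ hs hΓ h0
  refine ⟨J, hJ, ?_⟩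
  rw [h.chiSqDensity_eq hp hn hpos hθ hs h0, ← mul_add,
    ← Finset.sum_union (disjoint_cutStarts_typeOne n), hsum]

end Contours

/-! ### Existence of the contours -/

section Existence

variable {p : ℕ} {θ : Fin p → ℝ} {n : Fin p → ℕ}

theorem contDiff_circleMap_comp (c : ℂ) (r : ℝ) :
    ContDiff ℝ 1 (fun u : ℝ => circleMap c r (2 * Real.pi * u)) :=
  (contDiff_circleMap c r).comp (contDiff_const.mul contDiff_id)

theorem windingNumber_circleMap (c : ℂ) (r : ℝ) (w : ℂ) :
    windingNumber (fun u : ℝ => circleMap c r (2 * Real.pi * u)) 0 1 w =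
      1 / (2 * (Real.pi : ℂ) * Complex.I) * ∮ z in C(c, r), (z - w)⁻¹ := by
  unfold windingNumber circleIntegral
  have hclosed : circleMap c r (2 * Real.pi * 0) = circleMap c r (2 * Real.pi * 1) := by
    have := periodic_circleMap c r 0
    simpa using this.symm
  have hd : ∀ u : ℝ, deriv (fun u : ℝ => circleMap c r (2 * Real.pi * u)) u =
      (2 * Real.pi : ℝ) * deriv (circleMap c r) (2 * Real.pi * u) := by
    intro u
    have h := (hasDerivAt_circleMap c r (2 * Real.pi * u)).scomp u
      ((hasDerivAt_id u).const_mul (2 * Real.pi))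
    rw [deriv_circleMap]
    refine h.deriv.trans ?_
    simp
  have hint := intervalIntegral.smul_integral_comp_mul_left (a := 0) (b := 1)
    (fun t => deriv (circleMap c r) t • (circleMap c r t - w)⁻¹) (2 * Real.pi)
  rw [mul_zero, mul_one] at hint
  simp only
  rw [hclosed, ← hint, ← intervalIntegral.integral_smul]
  simp only [hd, sub_self, zero_div, intervalIntegral.integral_zero, add_zero]
  congr 1
  refine intervalIntegral.integral_congr fun u _ => ?_
  simp only [smul_eq_mul, Complex.real_smul]
  rw [div_eq_mul_inv, mul_assoc]

theorem windingNumber_circleMap_of_mem {c w : ℂ} {r : ℝ} (hw : w ∈ Metric.ball c r) :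
    windingNumber (fun u : ℝ => circleMap c r (2 * Real.pi * u)) 0 1 w = 1 := by
  rw [windingNumber_circleMap, circleIntegral.integral_sub_inv_of_mem_ball hw]
  exact one_div_mul_cancel Complex.two_pi_I_ne_zero

theorem windingNumber_circleMap_of_notMem {c w : ℂ} {r : ℝ} (hr : 0 ≤ r)
    (hw : w ∉ Metric.closedBall c r) :
    windingNumber (fun u : ℝ => circleMap c r (2 * Real.pi * u)) 0 1 w = 0 := by
  have hne : ∀ z ∈ Metric.closedBall c r, z - w ≠ 0 := fun z hz h =>
    hw (sub_eq_zero.1 h ▸ hz)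
  rw [windingNumber_circleMap, Complex.circleIntegral_eq_zero_of_differentiable_on_off_countable hr
    countable_empty (fun z hz => ?_) (fun z hz => ?_), mul_zero]
  · exact ContinuousAt.continuousWithinAt (ContinuousAt.inv₀ (by fun_prop) (hne z hz))
  · exact DifferentiableAt.inv (by fun_prop) (hne z (Metric.ball_subset_closedBall hz.1))

/-- A bounded cut or a type 1 pole is separated from the other parts of the singular set. -/
theorem exists_separation {i : Fin p} (hi : i ∈ cutStarts n ∪ typeOne n)
    (hu : ¬ IsUnboundedCut n i) :
    ∃ e : Fin p, i ≤ e ∧ Even (oddCount n (e + 1)) ∧ (∀ w ∈ singularPart θ n i, -θ e ≤ w.re) ∧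
      ∀ j ∈ cutStarts n ∪ typeOne n, i < j → e < j := by
  have hie := mem_cutStarts_union_typeOne.1 hi
  rcases Finset.mem_union.1 hi with h | h
  · obtain ⟨e, he⟩ : ∃ e, IsPartner n i e := by
      by_contra hne
      push Not at hne
      exact hu ⟨h, hne⟩
    obtain ⟨he1, he2, he3⟩ := isPartner_iff.1 he
    refine ⟨e, he1.le, ?_, fun w hw => ?_, fun j hj hij => ?_⟩
    · rw [oddCount_succ_of_odd he2, he3]
      exact hie.add (by decide : Even 2)
    · rw [singularPart_of_mem_cutStarts θ h] at hw
      exact hw.2.2 e he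
    · obtain ⟨j', -, hj', hp, -⟩ := exists_left_end (θ := θ) hi hj hij
      rcases hp with ⟨ht, -⟩ | hp
      · exact absurd ht (Finset.disjoint_left.1 (disjoint_cutStarts_typeOne n) h)
      · obtain ⟨-, h2, h3⟩ := isPartner_iff.1 hp
        have : e ≤ j' := by
          by_contra hlt
          have := oddCount_mono n (show (j' : ℕ) + 1 ≤ e from not_le.1 hlt)
          rw [oddCount_succ_of_odd h2] at this
          omega
        exact this.trans_lt hj'
  · refine ⟨i, le_rfl, ?_, fun w hw => ?_, fun j _ hij => hij⟩
    · have : oddCount n (i + 1) = oddCount n i := by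
        unfold oddCount
        congr 1
        ext j
        simp only [Finset.mem_filter, Finset.mem_univ, true_and, and_congr_left_iff]
        intro hj
        have : (j : ℕ) ≠ i := fun h' =>
          Nat.not_even_iff_odd.2 hj (Fin.ext h' ▸ (mem_typeOne.1 h).1)
        omega
      rwa [this]
    · rw [singularPart_of_mem_typeOne θ h, mem_singleton_iff] at hw
      simp [hw]

theorem singularPart_eq_ofReal {i : Fin p} {w : ℂ} (hw : w ∈ singularPart θ n i) :
    w = (w.re : ℂ) := Complex.ext rfl (by simpa using singularPart_im hw)

/-- The circle has as diameter the segment between a point in the gap just right of `-θ i` and one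
in the gap just left of the left end `-θ e`. The singular set is real, so comparing real parts is
enough. -/
theorem exists_isClosedContour (hθ : StrictMono θ) {i : Fin p}
    (hi : i ∈ cutStarts n ∪ typeOne n) (hu : ¬ IsUnboundedCut n i) :
    ∃ c, IsClosedContour θ n i c := by
  obtain ⟨e, hie, he, hleft, hsep⟩ := exists_separation hi hu
  obtain ⟨x₀, hx₀⟩ := gap_nonempty hθ i
  obtain ⟨x₁, hx₁⟩ := gap_nonempty hθ (e + 1)
  have hx : x₁ < x₀ := by
    have h1 := (hx₁ e).1 (Nat.lt_succ_self _)
    have h2 := (hx₀ e).2 hie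
    linarith
  set c : ℂ := (((x₀ + x₁) / 2 : ℝ) : ℂ) with hc
  set r : ℝ := (x₀ - x₁) / 2 with hr
  have hr0 : 0 < r := by rw [hr]; linarith
  have hdist : ∀ x : ℝ, dist (x : ℂ) c = |x - (x₀ + x₁) / 2| := fun x => by
    rw [hc, dist_eq_norm, ← Complex.ofReal_sub, Complex.norm_real, Real.norm_eq_abs]
  have hin : ∀ w ∈ singularPart θ n i, w ∈ Metric.ball c r := by
    intro w hw
    rw [singularPart_eq_ofReal hw, Metric.mem_ball, hdist, abs_lt]
    have h1 := hleft w hw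
    have h2 := singularPart_re_le hw
    have h3 := (hx₁ e).1 (Nat.lt_succ_self _)
    have h4 := (hx₀ i).2 le_rfl
    constructor <;> linarith
  have hout : ∀ j ∈ cutStarts n ∪ typeOne n, j ≠ i → ∀ w ∈ singularPart θ n j,
      w ∉ Metric.closedBall c r := by
    intro j hj hne w hw hwb
    rw [singularPart_eq_ofReal hw, Metric.mem_closedBall, hdist, abs_le] at hwb
    rcases lt_or_gt_of_ne hne with hlt | hlt
    · obtain ⟨j', -, hj', -, hle⟩ := exists_left_end hj hi hlt
      have h1 := hle w hw
      have h2 := (hx₀ j').1 hj'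
      linarith [hwb.2]
    · have h1 := singularPart_re_le hw
      have h2 := (hx₁ j).2 (hsep j hj hlt)
      linarith [hwb.1]
  refine ⟨fun u : ℝ => circleMap c r (2 * Real.pi * u), ?_, ?_, ?_, ?_, ?_⟩
  · exact (contDiff_circleMap_comp c r).piecewiseC1 0 1
  · have := periodic_circleMap c r 0
    simpa using this.symm
  · intro u _ j hj hmem
    have hs : circleMap c r (2 * Real.pi * u) ∈ Metric.sphere c r :=
      circleMap_mem_sphere c hr0.le _
    by_cases hji : j = i
    · subst hji
      have := hin _ hmem
      rw [Metric.mem_ball, Metric.mem_sphere.1 hs] at this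
      exact lt_irrefl _ this
    · exact hout j hj hji _ hmem (Metric.sphere_subset_closedBall hs)
  · exact fun w hw => windingNumber_circleMap_of_mem (hin w hw)
  · exact fun j hj hji w hw => windingNumber_circleMap_of_notMem hr0.le (hout j hj hji w hw)

/-- A parabola around a half-line. -/
noncomputable def parabola (x₀ : ℝ) (u : ℝ) : ℂ := ((x₀ - u ^ 2 : ℝ) : ℂ) + u * Complex.I

@[simp] theorem parabola_re (x₀ u : ℝ) : (parabola x₀ u).re = x₀ - u ^ 2 := by
  rw [parabola, Complex.add_re, Complex.ofReal_re]; simp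

@[simp] theorem parabola_im (x₀ u : ℝ) : (parabola x₀ u).im = u := by
  rw [parabola, Complex.add_im, Complex.ofReal_im]; simp

theorem contDiff_parabola (x₀ : ℝ) : ContDiff ℝ 1 (parabola x₀) :=
  (Complex.ofRealCLM.contDiff.comp (contDiff_const.sub (contDiff_id.pow 2))).add
    (Complex.ofRealCLM.contDiff.mul contDiff_const)

theorem tendsto_parabola_re_atTop (x₀ : ℝ) :
    Tendsto (fun u => (parabola x₀ u).re) atTop atBot := by
  simp only [parabola_re]
  exact tendsto_atBot_add_const_left _ x₀ (tendsto_neg_atTop_atBot.comp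
    (tendsto_pow_atTop two_ne_zero))

theorem tendsto_parabola_re_atBot (x₀ : ℝ) :
    Tendsto (fun u => (parabola x₀ u).re) atBot atBot := by
  have := (tendsto_parabola_re_atTop x₀).comp tendsto_neg_atBot_atTop
  refine this.congr fun u => by simp

theorem windingNumber_parabola_of_gt {x₀ R : ℝ} {w : ℂ} (hR : 0 ≤ R) (hw : x₀ < w.re) :
    windingNumber (parabola x₀) (-R) R w = 0 := by
  have hsl : ∀ z : ℂ, z.re < w.re → w - z ∈ Complex.slitPlane := fun z hz => by
    rw [Complex.mem_slitPlane_iff]; left; simpa using hz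
  have hre : ∀ u, (parabola x₀ u).re < w.re := fun u => by
    rw [parabola_re]; nlinarith [sq_nonneg u]
  have hD : ∀ z ∈ {z : ℂ | z.re < w.re}, HasDerivAt (fun z => Complex.log (w - z)) (z - w)⁻¹ z := by
    intro z hz
    have := ((Complex.hasDerivAt_log (hsl z hz)).comp z ((hasDerivAt_id z).const_sub w))
    refine this.congr_deriv ?_
    rw [mul_neg_one, ← inv_neg, neg_sub]
  have h1 := ((contDiff_parabola x₀).piecewiseC1 (-R) R).contourIntegral_eq_sub (by linarith)
    (f := fun z => (z - w)⁻¹) (U := {z : ℂ | z.re < w.re}) (fun z hz => by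
      refine ContinuousAt.continuousWithinAt (ContinuousAt.inv₀ (by fun_prop) ?_)
      rw [← neg_ne_zero, neg_sub]
      exact Complex.slitPlane_ne_zero (hsl z hz)) hD (fun u _ => hre u)
  unfold windingNumber
  rw [integral_segment_left w (hre _) (hre _)]
  have h2 : ∫ u in (-R)..R, deriv (parabola x₀) u / (parabola x₀ u - w) =
      contourIntegral (fun z => (z - w)⁻¹) (parabola x₀) (-R) R := by
    unfold contourIntegral
    refine intervalIntegral.integral_congr fun u _ => ?_
    simp only
    rw [div_eq_mul_inv, mul_comm]
  rw [h2, h1]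
  ring

/-- The parabola crosses the real axis only to the right of `w`, where `log (z - w)` is a primitive;
the closing chord crosses to its left, where `log (w - z)` is. The branches differ by `πi` at each
end, in total `2πi`. -/
theorem windingNumber_parabola_of_lt {x₀ R : ℝ} {w : ℂ} (hR : 0 < R) (him : w.im = 0)
    (hw : w.re < x₀) (hRw : x₀ - R ^ 2 < w.re) :
    windingNumber (parabola x₀) (-R) R w = 1 := by
  have hD : ∀ z ∈ {z : ℂ | z - w ∈ Complex.slitPlane},
      HasDerivAt (fun z => Complex.log (z - w)) (z - w)⁻¹ z := by
    intro z hz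
    have := ((Complex.hasDerivAt_log hz).comp z ((hasDerivAt_id z).sub_const w))
    rw [mul_one] at this
    exact this
  have hmem : ∀ u, parabola x₀ u - w ∈ Complex.slitPlane := by
    intro u
    rw [Complex.mem_slitPlane_iff]
    by_cases h : u = 0
    · left; subst h; simpa using hw
    · right; simpa [him] using h
  have h1 := ((contDiff_parabola x₀).piecewiseC1 (-R) R).contourIntegral_eq_sub (by linarith)
    (f := fun z => (z - w)⁻¹) (U := {z : ℂ | z - w ∈ Complex.slitPlane})
    (fun z hz => ContinuousAt.continuousWithinAt (ContinuousAt.inv₀ (by fun_prop)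
      (Complex.slitPlane_ne_zero hz))) hD (fun u _ => hmem u)
  have h2 : ∫ u in (-R)..R, deriv (parabola x₀) u / (parabola x₀ u - w) =
      contourIntegral (fun z => (z - w)⁻¹) (parabola x₀) (-R) R := by
    unfold contourIntegral
    refine intervalIntegral.integral_congr fun u _ => ?_
    simp only
    rw [div_eq_mul_inv, mul_comm]
  unfold windingNumber
  rw [integral_segment_left w (by simpa using hRw) (by simpa using hRw), h2, h1,
    ← neg_sub (parabola x₀ R) w, ← neg_sub (parabola x₀ (-R)) w,
    Complex.log_neg_of_upper (w := parabola x₀ R - w) (Or.inl (by simpa [him] using hR)),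
    Complex.log_neg_of_lower (w := parabola x₀ (-R) - w) (Or.inl (by simpa [him] using hR))]
  have := Complex.two_pi_I_ne_zero
  rw [show ∀ a b : ℂ, a - b + (b + Real.pi * Complex.I - (a - Real.pi * Complex.I)) =
    2 * Real.pi * Complex.I by intro a b; ring]
  exact one_div_mul_cancel this

/-- The vertex lies in the gap just right of `-θ i` and is the only real point of the parabola. No
other part of the singular set lies to the left of an unbounded cut. -/
theorem exists_isKeyholeContour (hθ : StrictMono θ) {i : Fin p} (hu : IsUnboundedCut n i) :
    ∃ c, IsKeyholeContour θ n i c := by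
  have hi : i ∈ cutStarts n ∪ typeOne n := Finset.mem_union_left _ hu.1
  obtain ⟨x₀, hx₀⟩ := gap_nonempty hθ i
  have hx₀S := notMem_singularSet_of_even hx₀ (mem_cutStarts_union_typeOne.1 hi)
  refine ⟨parabola x₀, fun R => (contDiff_parabola x₀).piecewiseC1 _ _,
    tendsto_parabola_re_atBot x₀, tendsto_parabola_re_atTop x₀, ?_, ?_, ?_, ?_, ?_⟩
  · filter_upwards [eventually_lt_atBot 0] with u hu using by simpa using hu
  · filter_upwards [eventually_gt_atTop 0] with u hu using by simpa using hu
  · intro u j hj hmem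
    have h0 : u = 0 := by simpa using singularPart_im hmem
    subst h0
    refine hx₀S (mem_singularSet.2 ⟨j, hj, ?_⟩)
    rw [singularPart_eq_ofReal hmem] at hmem
    simpa using hmem
  · intro w hw
    have h1 : w.re < x₀ := (singularPart_re_le hw).trans_lt ((hx₀ i).2 le_rfl)
    have h2 := (tendsto_parabola_re_atTop x₀).eventually (eventually_lt_atBot w.re)
    filter_upwards [eventually_gt_atTop 0, h2] with R hR hR'
    exact windingNumber_parabola_of_lt hR (singularPart_im hw) h1 (by simpa using hR')
  · intro j hj hne w hw
    have hlt : j < i := by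
      by_contra hle
      obtain ⟨j', -, -, hp, -⟩ := exists_left_end (θ := θ) hi hj
        (lt_of_le_of_ne (not_lt.1 hle) hne.symm)
      rcases hp with ⟨ht, -⟩ | hp
      · exact absurd ht (Finset.disjoint_left.1 (disjoint_cutStarts_typeOne n) hu.1)
      · exact hu.2 j' hp
    obtain ⟨j', -, hj', -, hle⟩ := exists_left_end hj hi hlt
    have h1 : x₀ < w.re := ((hx₀ j').1 hj').trans_le (hle w hw)
    filter_upwards [eventually_ge_atTop 0] with R hR
    exact windingNumber_parabola_of_gt hR h1

theorem exists_isContourSystem (hθ : StrictMono θ) (n : Fin p → ℕ) :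
    ∃ Γ : Fin p → ℝ → ℂ, IsContourSystem θ n Γ := by
  classical
  have : ∀ i : Fin p, ∃ c : ℝ → ℂ, i ∈ cutStarts n ∪ typeOne n →
      (IsUnboundedCut n i → IsKeyholeContour θ n i c) ∧
      (¬ IsUnboundedCut n i → IsClosedContour θ n i c) := by
    intro i
    by_cases hi : i ∈ cutStarts n ∪ typeOne n
    · by_cases hu : IsUnboundedCut n i
      · obtain ⟨c, hc⟩ := exists_isKeyholeContour hθ hu
        exact ⟨c, fun _ => ⟨fun _ => hc, fun h => absurd hu h⟩⟩
      · obtain ⟨c, hc⟩ := exists_isClosedContour hθ hi hu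
        exact ⟨c, fun _ => ⟨fun h => absurd h hu, fun _ => hc⟩⟩
    · exact ⟨fun _ => 0, fun h => absurd h hi⟩
  choose Γ hΓ using this
  exact ⟨Γ, hΓ⟩

end Existence

/-! ### The Laplace transform of noncentral chi-square laws -/

theorem one_add_two_mul_mem_slitPlane {z : ℂ} (hz : 0 ≤ z.re) : 1 + 2 * z ∈ Complex.slitPlane := by
  rw [Complex.mem_slitPlane_iff]; left; simp; linarith

/-- This is the complex Gaussian integral; the positive factor `2π` splits off from the principal
square root and cancels the normalisation. -/
theorem integral_exp_neg_sq_gaussianReal (a : ℝ) {z : ℂ} (hz : 0 ≤ z.re) :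
    ∫ y, Complex.exp (-z * (y : ℂ) ^ 2) ∂(gaussianReal a 1) =
      ((1 + 2 * z)⁻¹) ^ (1 / 2 : ℂ) * Complex.exp (-(z * a ^ 2) / (1 + 2 * z)) := by
  have hsl := one_add_two_mul_mem_slitPlane hz
  have hne := Complex.slitPlane_ne_zero hsl
  rw [integral_gaussianReal_eq_integral_smul one_ne_zero]
  have hterm : ∀ y : ℝ, gaussianPDFReal a 1 y • Complex.exp (-z * (y : ℂ) ^ 2) =
      ((Real.sqrt (2 * Real.pi))⁻¹ : ℝ) *
        Complex.exp (-(1 / 2 + z) * (y : ℂ) ^ 2 + a * y + (-(a ^ 2 / 2 : ℝ) : ℂ)) := by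
    intro y
    rw [gaussianPDFReal, Complex.real_smul, Complex.ofReal_mul, Complex.ofReal_exp, mul_assoc,
      ← Complex.exp_add]
    simp only [NNReal.coe_one, mul_one]
    congr 2
    push_cast; ring
  simp only [hterm]
  rw [integral_const_mul, integral_cexp_quadratic (by simp; linarith), ← mul_assoc]
  have h12 : (1 / 2 + z : ℂ) ≠ 0 := by
    intro h; apply hne; linear_combination 2 * h
  congr 1
  · rw [neg_neg, show (Real.pi : ℂ) / (1 / 2 + z) = ((2 * Real.pi : ℝ) : ℂ) * (1 + 2 * z)⁻¹ by
      push_cast; field_simp, Complex.ofReal_mul_cpow (by positivity), ← mul_assoc]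
    have : (((2 * Real.pi : ℝ) : ℂ)) ^ (1 / 2 : ℂ) = (Real.sqrt (2 * Real.pi) : ℂ) := by
      rw [Real.sqrt_eq_rpow, Complex.ofReal_cpow (by positivity)]
      push_cast; rfl
    rw [this, ← Complex.ofReal_mul, inv_mul_cancel₀ (by positivity)]
    simp
  · congr 1
    push_cast
    have h3 : (-(1 / 2 + z) : ℂ) ≠ 0 := neg_ne_zero.2 h12
    field_simp
    ring

theorem measurable_sum_sq (k : ℕ) : Measurable (fun y : Fin k → ℝ => ∑ j, y j ^ 2) := by
  fun_prop

theorem integral_exp_neg_noncentralChiSq {k : ℕ} (hk : 1 ≤ k) {δ : ℝ} (hδ : 0 ≤ δ) {z : ℂ}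
    (hz : 0 ≤ z.re) :
    ∫ x, Complex.exp (-z * (x : ℂ)) ∂(noncentralChiSq k δ) =
      (((1 + 2 * z)⁻¹) ^ (1 / 2 : ℂ)) ^ k * Complex.exp (-(z * δ) / (1 + 2 * z)) := by
  have hne := Complex.slitPlane_ne_zero (one_add_two_mul_mem_slitPlane hz)
  have hk0 : (k : ℂ) ≠ 0 := by exact_mod_cast (by omega : k ≠ 0)
  unfold noncentralChiSq
  rw [integral_map (measurable_sum_sq k).aemeasurable (by fun_prop)]
  have hterm : ∀ y : Fin k → ℝ, Complex.exp (-z * ((∑ j, y j ^ 2 : ℝ) : ℂ)) =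
      ∏ j, Complex.exp (-z * (y j : ℂ) ^ 2) := by
    intro y
    rw [← Complex.exp_sum, ← Finset.mul_sum]
    push_cast; rfl
  simp only [hterm]
  rw [integral_fintype_prod_eq_prod (f := fun _ (x : ℝ) => Complex.exp (-z * (x : ℂ) ^ 2))]
  simp only [integral_exp_neg_sq_gaussianReal _ hz]
  rw [Finset.prod_const, Finset.card_univ, Fintype.card_fin, mul_pow, ← Complex.exp_nat_mul,
    ← Complex.ofReal_pow, Real.sq_sqrt (by positivity)]
  congr 2
  push_cast
  field_simp

theorem noncentralChiSq_Iio (k : ℕ) (δ : ℝ) : noncentralChiSq k δ (Iio 0) = 0 := by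
  unfold noncentralChiSq
  rw [Measure.map_apply (measurable_sum_sq k) measurableSet_Iio]
  convert measure_empty (μ := Measure.pi fun _ : Fin k => gaussianReal (Real.sqrt (δ / k)) 1)
  ext y
  simp only [mem_preimage, mem_Iio, mem_empty_iff_false, iff_false, not_lt]
  positivity

section Laplace

variable {m : ℕ} {θ g : Fin m → ℝ} {n : Fin m → ℕ}

theorem cpow_natCast_div_two (w : ℂ) (k : ℕ) : w ^ ((k : ℂ) / 2) = (w ^ (1 / 2 : ℂ)) ^ k := by
  rw [← Complex.cpow_nat_mul, mul_one_div]

/-- With `z = t / (2θ)` one has `1 + 2z = (θ + t) / θ`, and the exponent becomes `g / (4(θ + t)) - g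
/ (4θ)`. -/
theorem kappa_mul_gFun (hpos : ∀ i, 0 < θ i) {t : ℂ} (ht : 0 ≤ t.re) :
    kappa θ g n * gFun θ g n t = ∏ i, ((((1 + 2 * (t / (2 * θ i)))⁻¹) ^ (1 / 2 : ℂ)) ^ n i *
      Complex.exp (-(t / (2 * θ i) * (g i / (2 * θ i) : ℝ)) / (1 + 2 * (t / (2 * θ i))))) := by
  have hne : ∀ i, (θ i : ℂ) + t ≠ 0 := fun i => Complex.slitPlane_ne_zero
    (mem_slitPlane_add (Or.inr (by linarith [hpos i])))
  have hθ : ∀ i, (θ i : ℂ) ≠ 0 := fun i => by exact_mod_cast (hpos i).ne'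
  unfold kappa gFun
  push_cast
  rw [Finset.prod_mul_distrib, ← Complex.exp_sum, mul_div_assoc', mul_assoc, ← Complex.exp_add,
    mul_div_right_comm, ← Finset.prod_div_distrib]
  congr 1
  · refine Finset.prod_congr rfl fun i _ => ?_
    have h1 : (1 + 2 * (t / (2 * θ i)))⁻¹ = (θ i : ℂ) * ((θ i : ℂ) + t)⁻¹ := by
      have := hθ i
      have := hne i
      have h3 : (1 + 2 * (t / (2 * θ i)) : ℂ) = ((θ i : ℂ) + t) / θ i := by field_simp
      rw [h3, inv_div, div_eq_mul_inv]
    rw [h1, Complex.ofReal_mul_cpow (hpos i), Complex.inv_cpow _ _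
      (Complex.slitPlane_arg_ne_pi (mem_slitPlane_add (Or.inr (by linarith [hpos i])))),
      mul_pow, inv_pow, ← cpow_natCast_div_two, ← cpow_natCast_div_two, div_eq_mul_inv]
    congr 1
    rw [Complex.ofReal_cpow (hpos i).le]
    push_cast; rfl
  · congr 1
    rw [← Finset.sum_neg_distrib, ← Finset.sum_add_distrib]
    refine Finset.sum_congr rfl fun i _ => ?_
    have := hθ i
    have := hne i
    have h3 : (1 + 2 * (t / (2 * θ i)) : ℂ) = ((θ i : ℂ) + t) / θ i := by field_simp
    rw [h3]
    field_simp
    ring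

variable {Ω : Type*} [MeasurableSpace Ω] {P : Measure Ω} {X : Ω → ℝ}

theorem IsChiSqCombination.aemeasurable (hX : IsChiSqCombination P θ g n X) :
    AEMeasurable X P := by
  obtain ⟨Z, hZ, -, hXZ⟩ := hX
  rw [funext hXZ]
  exact Finset.aemeasurable_fun_sum _ fun i _ => (hZ i).aemeasurable.const_mul _

theorem IsChiSqCombination.ae_nonneg (hpos : ∀ i, 0 < θ i) (hX : IsChiSqCombination P θ g n X) :
    ∀ᵐ ω ∂P, 0 ≤ X ω := by
  obtain ⟨Z, hZ, -, hXZ⟩ := hX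
  have h : ∀ᵐ ω ∂P, ∀ i, 0 ≤ Z i ω := by
    rw [ae_all_iff]
    intro i
    have h1 : ∀ᵐ x ∂(P.map (Z i)), 0 ≤ x := by
      rw [(hZ i).map_eq, ae_iff]
      simp only [not_le]
      exact noncentralChiSq_Iio (n i) (g i / (2 * θ i))
    exact ae_of_ae_map (hZ i).aemeasurable h1
  filter_upwards [h] with ω hω
  rw [hXZ]
  exact Finset.sum_nonneg fun i _ => mul_nonneg (by have := hpos i; positivity) (hω i)

/-- The Laplace transform of a linear combination of chi-square variables. -/
theorem IsChiSqCombination.integral_exp_neg (hn : ∀ i, 1 ≤ n i) (hpos : ∀ i, 0 < θ i)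
    (hg : ∀ i, 0 ≤ g i) (hX : IsChiSqCombination P θ g n X) {t : ℂ} (ht : 0 ≤ t.re) :
    ∫ x, Complex.exp (-t * (x : ℂ)) ∂(P.map X) = kappa θ g n * gFun θ g n t := by
  rw [integral_map hX.aemeasurable (by fun_prop)]
  obtain ⟨Z, hZ, hind, hXZ⟩ := hX
  have hterm : ∀ ω, Complex.exp (-t * (X ω : ℂ)) =
      ∏ i, Complex.exp (-(t / (2 * θ i)) * (Z i ω : ℂ)) := by
    intro ω
    rw [← Complex.exp_sum, hXZ]
    push_cast
    rw [Finset.mul_sum]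
    congr 1
    refine Finset.sum_congr rfl fun i _ => ?_
    rw [one_div, div_eq_mul_inv]; ring
  simp only [hterm]
  rw [hind.integral_fun_prod_comp (f := fun i (x : ℝ) => Complex.exp (-(t / (2 * θ i)) * (x : ℂ)))
    (fun i => (hZ i).aemeasurable) (fun i => by fun_prop), kappa_mul_gFun hpos ht]
  refine Finset.prod_congr rfl fun i _ => ?_
  have hre : 0 ≤ (t / (2 * θ i)).re := by
    rw [show (2 * (θ i : ℂ)) = ((2 * θ i : ℝ) : ℂ) by push_cast; rfl, Complex.div_ofReal_re]
    have := hpos i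
    positivity
  rw [← integral_exp_neg_noncentralChiSq (hn i) (div_nonneg (hg i) (by have := hpos i; positivity)) hre,
    ← (hZ i).map_eq, integral_map (hZ i).aemeasurable (by fun_prop)]

end Laplace

/-! ### Fourier inversion for the distribution function -/

section CDF

variable {μ : Measure ℝ} [IsProbabilityMeasure μ]

theorem integral_indicator_exp (z : ℂ) (s : ℝ) :
    ∫ x, (if x ≤ s then Complex.exp (-z * s) else 0) ∂μ = Complex.exp (-z * s) * cdf μ s := by
  have : (fun x : ℝ => if x ≤ s then Complex.exp (-z * s) else 0) =
      (Iic s).indicator fun _ => Complex.exp (-z * s) := by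
    funext x
    simp [indicator]
  rw [this, integral_indicator measurableSet_Iic, setIntegral_const, cdf_eq_real,
    Complex.real_smul, mul_comm]

/-- Integrating the modulus over `s ≥ x` gives `e^{-x Re z} / Re z`, which is bounded because `x ≥
0` almost surely. This justifies Fubini. -/
theorem integrable_indicator_exp (hμ : ∀ᵐ x ∂μ, 0 ≤ x) {z : ℂ} (hz : 0 < z.re) :
    Integrable (fun q : ℝ × ℝ => if q.2 ≤ q.1 then Complex.exp (-z * q.1) else 0)
      (volume.prod μ) := by
  have hmeas : Measurable (fun q : ℝ × ℝ => if q.2 ≤ q.1 then Complex.exp (-z * q.1) else 0) :=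
    Measurable.ite (measurableSet_le measurable_snd measurable_fst) (by fun_prop) measurable_const
  rw [integrable_prod_iff' hmeas.aestronglyMeasurable]
  have hind : ∀ x : ℝ, (fun s : ℝ => if x ≤ s then Complex.exp (-z * s) else 0) =
      (Ici x).indicator fun s : ℝ => Complex.exp (-z * s) := fun x => by
    funext s; simp [indicator]
  have hnorm : ∀ x : ℝ, ∫ s : ℝ, ‖(if x ≤ s then Complex.exp (-z * s) else 0)‖ =
      Real.exp (-z.re * x) / z.re := by
    intro x
    have h1 : (fun s : ℝ => ‖(if x ≤ s then Complex.exp (-z * s) else 0)‖) =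
        (Ici x).indicator fun s : ℝ => Real.exp (-z.re * s) := by
      funext s
      by_cases h : x ≤ s
      · simp [indicator, h, Complex.norm_exp]
      · simp [indicator, h]
    rw [h1, integral_indicator measurableSet_Ici, integral_Ici_eq_integral_Ioi,
      integral_exp_mul_Ioi (by linarith), neg_div_neg_eq]
  refine ⟨Eventually.of_forall fun x => ?_, ?_⟩
  · simp only
    rw [hind x, integrable_indicator_iff measurableSet_Ici, integrableOn_Ici_iff_integrableOn_Ioi]
    exact integrableOn_exp_mul_complex_Ioi (by simpa using hz) x
  · simp only [hnorm]
    refine Integrable.mono' (integrable_const (1 / z.re)) (by fun_prop) ?_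
    filter_upwards [hμ] with x hx
    rw [Real.norm_of_nonneg (by positivity)]
    gcongr
    rw [Real.exp_le_one_iff]
    nlinarith

theorem integrable_exp_mul_cdf (hμ : ∀ᵐ x ∂μ, 0 ≤ x) {z : ℂ} (hz : 0 < z.re) :
    Integrable (fun s : ℝ => Complex.exp (-z * s) * cdf μ s) := by
  refine (integrable_indicator_exp hμ hz).integral_prod_left.congr
    (Eventually.of_forall fun s => ?_)
  exact integral_indicator_exp z s

/-- The Laplace transform of a distribution function. -/
theorem integral_exp_mul_cdf (hμ : ∀ᵐ x ∂μ, 0 ≤ x) {z : ℂ} (hz : 0 < z.re) :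
    ∫ s : ℝ, Complex.exp (-z * s) * cdf μ s = (∫ x : ℝ, Complex.exp (-z * (x : ℂ)) ∂μ) / z := by
  have hz0 : z ≠ 0 := fun h => by simp [h] at hz
  have h := integral_integral_swap (μ := volume) (ν := μ)
    (f := fun s x : ℝ => if x ≤ s then Complex.exp (-z * s) else 0) (integrable_indicator_exp hμ hz)
  simp only [integral_indicator_exp] at h
  rw [h, ← integral_div]
  congr 1
  funext x
  have hind : (fun s : ℝ => if x ≤ s then Complex.exp (-z * s) else 0) =
      (Ici x).indicator fun s : ℝ => Complex.exp (-z * s) := by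
    funext s; simp [indicator]
  rw [hind, integral_indicator measurableSet_Ici, integral_Ici_eq_integral_Ioi,
    integral_exp_mul_complex_Ioi (by simpa using hz), neg_div_neg_eq]

theorem continuous_fourierInv {W : ℝ → ℂ} (hW : Integrable W) :
    Continuous (FourierTransformInv.fourierInv W : ℝ → ℂ) := by
  have h : Continuous (VectorFourier.fourierIntegral Real.fourierChar volume (-innerₗ ℝ) W) :=
    VectorFourier.fourierIntegral_continuous Real.continuous_fourierChar
      (continuous_inner (𝕜 := ℝ) (E := ℝ)).neg hW
  exact h

/-- The distribution function of a law on `[0, ∞)` as an inversion integral. -/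
theorem cdf_eq_exp_mul_integral (hμ : ∀ᵐ x ∂μ, 0 ≤ x) {c : ℝ} (hc : 0 < c) {W : ℝ → ℂ}
    (hW : ∀ v : ℝ, W v = (∫ x : ℝ, Complex.exp (-(c + (2 * Real.pi * v : ℝ) * Complex.I) *
      (x : ℂ)) ∂μ) / (c + (2 * Real.pi * v : ℝ) * Complex.I)) (hWi : Integrable W) :
    Continuous (cdf μ) ∧ ∀ s : ℝ, (cdf μ s : ℂ) = Complex.exp (c * s) *
      ∫ v : ℝ, Complex.exp ((2 * Real.pi * v * s : ℝ) * Complex.I) * W v := by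
  set k : ℝ → ℂ := fun s => Complex.exp (-(c : ℂ) * s) * cdf μ s with hk
  have hki : Integrable k := integrable_exp_mul_cdf hμ (by simpa using hc)
  have hF : (FourierTransform.fourier k : ℝ → ℂ) = W := by
    funext v
    rw [Real.fourier_real_eq_integral_exp_smul, hW v, ← integral_exp_mul_cdf hμ (by simpa using hc)]
    congr 1
    funext s
    simp only [hk, smul_eq_mul]
    rw [← mul_assoc, ← Complex.exp_add]
    congr 2
    push_cast; ring
  set q : ℝ → ℂ := FourierTransformInv.fourierInv W with hq
  have hqc : Continuous q := continuous_fourierInv hWi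
  -- Fourier inversion applies at continuity points. A monotone function has only countably many
  -- others, and these are reached from the right, using right continuity of the distribution
  -- function.
  set D : Set ℝ := {x | ¬ ContinuousAt (cdf μ) x}
  have hD : D.Countable := (monotone_cdf μ).countable_not_continuousAt
  have hexp : Continuous fun s : ℝ => Complex.exp (-(c : ℂ) * s) := by fun_prop
  have heq : ∀ x ∉ D, k x = q x := by
    intro x hx
    have hcx : ContinuousAt k x := hexp.continuousAt.mul
      (Complex.continuous_ofReal.continuousAt.comp (not_not.1 hx))
    rw [hq, ← hF]
    exact (hki.fourierInv_fourier_eq (by rw [hF]; exact hWi) hcx).symm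
  have hall : ∀ s, k s = q s := by
    intro s
    have hne : (𝓝[Ioi s ∩ Dᶜ] s).NeBot := by
      rw [← mem_closure_iff_nhdsWithin_neBot]
      have h1 := (hD.dense_compl ℝ).open_subset_closure_inter (isOpen_Ioi (a := s))
      have h2 := closure_minimal h1 isClosed_closure
      rw [closure_Ioi] at h2
      exact h2 self_mem_Ici
    have hcdf : Tendsto (cdf μ) (𝓝[Ioi s ∩ Dᶜ] s) (𝓝 (cdf μ s)) :=
      ((cdf μ).right_continuous s).tendsto.mono_left
        (nhdsWithin_mono _ (inter_subset_left.trans Ioi_subset_Ici_self))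
    have h1 : Tendsto k (𝓝[Ioi s ∩ Dᶜ] s) (𝓝 (k s)) :=
      ((hexp.tendsto s).mono_left nhdsWithin_le_nhds).mul
        ((Complex.continuous_ofReal.tendsto _).comp hcdf)
    have h2 : Tendsto q (𝓝[Ioi s ∩ Dᶜ] s) (𝓝 (q s)) :=
      (hqc.tendsto s).mono_left nhdsWithin_le_nhds
    refine tendsto_nhds_unique (h1.congr' ?_) h2
    filter_upwards [self_mem_nhdsWithin] with x hx using heq x hx.2
  have hcdf : ∀ s, (cdf μ s : ℂ) = Complex.exp (c * s) * q s := by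
    intro s
    rw [← hall s, hk]
    simp only
    rw [← mul_assoc, ← Complex.exp_add]
    simp
  refine ⟨?_, fun s => ?_⟩
  · have h1 : Continuous fun s : ℝ => (cdf μ s : ℂ) := by
      rw [funext hcdf]
      exact (by fun_prop : Continuous fun s : ℝ => Complex.exp (c * s)).mul hqc
    have h2 := Complex.continuous_re.comp h1
    simpa [Function.comp_def] using h2
  · rw [hcdf s, hq, Real.fourierInv_eq']
    congr 1
    refine integral_congr_ae (Eventually.of_forall fun v => ?_)
    simp only [smul_eq_mul]
    congr 3
    simp only [RCLike.inner_apply, conj_trivial]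
    push_cast; ring

end CDF

/-! ### Integrability of `g(t) / t` on vertical lines. -/

section Decay

variable {m : ℕ} {θ g : Fin m → ℝ} {n : Fin m → ℕ}

theorem mul_sqrt_le_norm_add {c t y : ℝ} (hc : 0 < c) (hc1 : c ≤ 1) (ht : c ≤ t) :
    c * Real.sqrt (1 + y ^ 2) ≤ ‖(t : ℂ) + y * Complex.I‖ := by
  rw [Complex.norm_add_mul_I]
  refine Real.le_sqrt_of_sq_le ?_
  rw [mul_pow, Real.sq_sqrt (by positivity)]
  nlinarith [mul_le_mul_of_nonneg_right (pow_le_one₀ hc.le hc1 : c ^ 2 ≤ 1) (sq_nonneg y),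
    pow_le_pow_left₀ hc.le ht 2]

/-- One factor with `n i ≥ 1` gives decay of order `1/2`, and the division by `t` adds order `1`;
the total `3/2` exceeds `1`. -/
theorem exists_gBound_mul_sqrt_le (hm : 0 < m) (g : Fin m → ℝ) (hn : ∀ i, 1 ≤ n i) {c : ℝ}
    (hc : 0 < c) : ∃ C : ℝ, 0 ≤ C ∧ ∀ y : ℝ,
      gBound g n (c * Real.sqrt (1 + y ^ 2)) / (c * Real.sqrt (1 + y ^ 2)) ≤
        C * (1 + ‖y‖ ^ 2) ^ (-(3 / 2 : ℝ) / 2) := by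
  refine ⟨Real.exp (∑ i, |g i| / (4 * c)) / ((∏ i, c ^ ((n i : ℝ) / 2)) * c), by positivity,
    fun y => ?_⟩
  set r := Real.sqrt (1 + y ^ 2) with hr
  have hr1 : 1 ≤ r := by
    rw [hr, Real.one_le_sqrt]; nlinarith [sq_nonneg y]
  have hr0 : 0 < r := by linarith
  have hrpow : (1 + ‖y‖ ^ 2) ^ (-(3 / 2 : ℝ) / 2) = (r ^ (1 / 2 : ℝ) * r)⁻¹ := by
    have h1 : 1 + ‖y‖ ^ 2 = r ^ (2 : ℝ) := by
      rw [Real.norm_eq_abs, sq_abs, Real.rpow_two, hr, Real.sq_sqrt (by positivity)]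
    rw [h1, ← Real.rpow_mul hr0.le, ← Real.rpow_add_one hr0.ne', ← Real.rpow_neg hr0.le]
    norm_num
  have hexp : Real.exp (∑ i, |g i| / (4 * (c * r))) ≤ Real.exp (∑ i, |g i| / (4 * c)) := by
    refine Real.exp_le_exp.2 (Finset.sum_le_sum fun i _ => ?_)
    gcongr
    nlinarith
  have hprod : (∏ i, c ^ ((n i : ℝ) / 2)) * r ^ (1 / 2 : ℝ) ≤ ∏ i, (c * r) ^ ((n i : ℝ) / 2) := by
    rw [Finset.prod_congr rfl fun i _ => Real.mul_rpow hc.le hr0.le, Finset.prod_mul_distrib,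
      ← Real.rpow_sum_of_pos hr0]
    refine mul_le_mul_of_nonneg_left (Real.rpow_le_rpow_of_exponent_le hr1 ?_) (by positivity)
    have h1 : ((n ⟨0, hm⟩ : ℕ) : ℝ) / 2 ≤ ∑ i, (n i : ℝ) / 2 :=
      Finset.single_le_sum (f := fun i => (n i : ℝ) / 2) (fun i _ => by positivity)
        (Finset.mem_univ _)
    have h2 : (1 : ℝ) ≤ n ⟨0, hm⟩ := by exact_mod_cast hn _
    linarith
  rw [hrpow, gBound, div_div]
  have hP : 0 < ∏ i, c ^ ((n i : ℝ) / 2) := by positivity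
  have hR : 0 < r ^ (1 / 2 : ℝ) := by positivity
  calc Real.exp (∑ i, |g i| / (4 * (c * r))) / ((∏ i, (c * r) ^ ((n i : ℝ) / 2)) * (c * r))
      ≤ Real.exp (∑ i, |g i| / (4 * c)) /
          (((∏ i, c ^ ((n i : ℝ) / 2)) * r ^ (1 / 2 : ℝ)) * (c * r)) := by
        gcongr
    _ = _ := by field_simp

theorem continuous_gFun_line (hpos : ∀ i, 0 < θ i) {t₀ : ℝ} (ht : 0 ≤ t₀) :
    Continuous fun y : ℝ => gFun θ g n (t₀ + y * Complex.I) := by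
  rw [continuous_iff_continuousAt]
  intro y
  have h1 : ContinuousAt (gFun θ g n) (t₀ + y * Complex.I) :=
    (differentiableAt_gFun_of_mem_slitPlane fun i => mem_slitPlane_add (Or.inr (by
      have := hpos i; simp; linarith))).continuousAt
  exact ContinuousAt.comp (f := fun y : ℝ => (t₀ : ℂ) + y * Complex.I) h1 (by fun_prop)

/-- After division by `t`, the function `g` is integrable on vertical lines. -/
theorem integrable_gFun_div (hm : 0 < m) (hn : ∀ i, 1 ≤ n i) (hpos : ∀ i, 0 < θ i) {t₀ : ℝ}
    (ht : 0 < t₀) :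
    Integrable fun y : ℝ => gFun θ g n (t₀ + y * Complex.I) / (t₀ + y * Complex.I) := by
  -- This `c` gives a common lower bound `c √(1 + y²)` for the moduli of `t` and of all `θ i + t`.
  set c := min t₀ 1
  have hc : 0 < c := lt_min ht one_pos
  obtain ⟨C, hC, hb⟩ := exists_gBound_mul_sqrt_le hm g hn hc
  have hne : ∀ y : ℝ, (t₀ + y * Complex.I : ℂ) ≠ 0 := fun y h => by
    have := congrArg Complex.re h
    simp at this
    linarith
  have hdec : Integrable (fun y : ℝ => C * (1 + ‖y‖ ^ 2) ^ (-(3 / 2 : ℝ) / 2)) :=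
    (integrable_rpow_neg_one_add_norm_sq (by norm_num)).const_mul C
  refine hdec.mono' (((continuous_gFun_line hpos ht.le).div (by fun_prop) hne).aestronglyMeasurable)
    (Eventually.of_forall fun y => ?_)
  refine le_trans ?_ (hb y)
  rw [norm_div]
  have hpos' : 0 < c * Real.sqrt (1 + y ^ 2) := by positivity
  have hgF : ‖gFun θ g n (t₀ + y * Complex.I)‖ ≤ gBound g n (c * Real.sqrt (1 + y ^ 2)) := by
    refine norm_gFun_le hpos' fun i => ?_
    rw [← add_assoc, ← Complex.ofReal_add]
    exact mul_sqrt_le_norm_add hc (min_le_right _ _)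
      ((min_le_left _ _).trans (by linarith [hpos i]))
  exact div_le_div₀ ((norm_nonneg _).trans hgF) hgF hpos'
    (mul_sqrt_le_norm_add hc (min_le_right _ _) (min_le_left _ _))

end Decay

/-! ### The distribution function and the density -/

section Density

variable {m : ℕ} {θ g : Fin m → ℝ} {n : Fin m → ℕ}

theorem verticalLine_ne_zero {c : ℝ} (hc : 0 < c) (y : ℝ) : verticalLine c y ≠ 0 := fun h => by
  have := congrArg Complex.re h
  simp [verticalLine] at this
  linarith

theorem norm_exp_mul_verticalLine (s c y : ℝ) :
    ‖Complex.exp (s * verticalLine c y)‖ = Real.exp (s * c) := by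
  rw [Complex.norm_exp]
  simp [verticalLine]

theorem integrable_gFun_div_mul_exp (hm : 0 < m) (hn : ∀ i, 1 ≤ n i) (hpos : ∀ i, 0 < θ i) {c : ℝ}
    (hc : 0 < c) (s : ℝ) :
    Integrable fun y : ℝ => gFun θ g n (verticalLine c y) / verticalLine c y *
      Complex.exp (s * verticalLine c y) := by
  refine (integrable_gFun_div hm hn hpos hc).mul_bdd (c := Real.exp (s * c))
    (Continuous.aestronglyMeasurable ?_)
    (Eventually.of_forall fun y => (norm_exp_mul_verticalLine s c y).le)
  have := (contDiff_verticalLine c).continuous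
  fun_prop

/-- The truncated inversion integral of the distribution function. -/
noncomputable def cdfInversion (θ g : Fin m → ℝ) (n : Fin m → ℕ) (c s R : ℝ) : ℂ :=
  kappa θ g n * (1 / (2 * (Real.pi : ℂ)) * ∫ y in (-R)..R,
    gFun θ g n (verticalLine c y) / verticalLine c y * Complex.exp (s * verticalLine c y))

theorem tendsto_cdfInversion (hm : 0 < m) (hn : ∀ i, 1 ≤ n i) (hpos : ∀ i, 0 < θ i) {c : ℝ}
    (hc : 0 < c) (s : ℝ) :
    Tendsto (cdfInversion θ g n c s) atTop (𝓝 (kappa θ g n * (1 / (2 * (Real.pi : ℂ)) *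
      ∫ y : ℝ, gFun θ g n (verticalLine c y) / verticalLine c y *
        Complex.exp (s * verticalLine c y)))) :=
  ((intervalIntegral_tendsto_integral (integrable_gFun_div_mul_exp hm hn hpos hc s)
    tendsto_neg_atTop_atBot tendsto_id).const_mul _).const_mul _

variable {Ω : Type*} [MeasurableSpace Ω] {P : Measure Ω} [IsProbabilityMeasure P] {X : Ω → ℝ}

theorem IsChiSqCombination.cdf_eq (hm : 0 < m) (hn : ∀ i, 1 ≤ n i) (hpos : ∀ i, 0 < θ i)
    (hg : ∀ i, 0 ≤ g i) (hX : IsChiSqCombination P θ g n X) {c : ℝ} (hc : 0 < c) :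
    Continuous (cdf (P.map X)) ∧ ∀ s : ℝ, (cdf (P.map X) s : ℂ) =
      kappa θ g n * (1 / (2 * (Real.pi : ℂ)) * ∫ y : ℝ,
        gFun θ g n (verticalLine c y) / verticalLine c y * Complex.exp (s * verticalLine c y)) := by
  have : IsProbabilityMeasure (P.map X) := Measure.isProbabilityMeasure_map hX.aemeasurable
  have hμ : ∀ᵐ x ∂(P.map X), 0 ≤ x :=
    (ae_map_iff hX.aemeasurable measurableSet_Ici).2 (hX.ae_nonneg hpos)
  have hpi : (0 : ℝ) < 2 * Real.pi := by positivity
  obtain ⟨h1, h2⟩ := cdf_eq_exp_mul_integral hμ hc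
    (W := fun v : ℝ => (kappa θ g n : ℂ) * (gFun θ g n (c + (2 * Real.pi * v : ℝ) * Complex.I) /
      (c + (2 * Real.pi * v : ℝ) * Complex.I))) (fun v => by
        rw [hX.integral_exp_neg hn hpos hg (by simp; exact hc.le), mul_div_assoc])
    (((integrable_gFun_div hm hn hpos hc).comp_mul_left' hpi.ne').const_mul _)
  refine ⟨h1, fun s => ?_⟩
  have h3 := Measure.integral_comp_mul_left (fun y : ℝ => (kappa θ g n : ℂ) *
    (gFun θ g n (verticalLine c y) / verticalLine c y * Complex.exp (s * verticalLine c y)))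
    (2 * Real.pi)
  rw [abs_of_pos (inv_pos.2 hpi), Complex.real_smul] at h3
  rw [h2 s, ← integral_const_mul]
  refine Eq.trans (integral_congr_ae (Eventually.of_forall fun v => ?_)) (h3.trans ?_)
  · simp only [verticalLine]
    rw [show (s : ℂ) * (c + (2 * Real.pi * v : ℝ) * Complex.I) =
      c * s + (2 * Real.pi * v * s : ℝ) * Complex.I by push_cast; ring, Complex.exp_add]
    ring
  · rw [integral_const_mul]
    push_cast
    ring

/-- Differentiating `e^{st}` produces a factor `t`, which cancels the division by `t`. -/
theorem hasDerivAt_cdfInversion (hpos : ∀ i, 0 < θ i) {c : ℝ} (hc : 0 < c) (s R : ℝ) :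
    HasDerivAt (fun s => cdfInversion θ g n c s R) (truncatedInversion θ g n c s R) s := by
  rw [truncatedInversion_eq]
  refine HasDerivAt.const_mul _ (HasDerivAt.const_mul _ ?_)
  have hvl : Continuous (verticalLine c) := (contDiff_verticalLine c).continuous
  have hgc : Continuous fun y : ℝ => gFun θ g n (verticalLine c y) :=
    continuous_gFun_line hpos hc.le
  have hF : ∀ x : ℝ, Continuous fun y : ℝ => gFun θ g n (verticalLine c y) / verticalLine c y *
      Complex.exp (x * verticalLine c y) := fun x =>
    (hgc.div hvl (verticalLine_ne_zero hc)).mul (by fun_prop)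
  refine (intervalIntegral.hasDerivAt_integral_of_dominated_loc_of_deriv_le
    (F' := fun x y => integrand θ g n x (verticalLine c y))
    (bound := fun _ => gBound g n c * Real.exp ((s + 1) * c)) (Iio_mem_nhds (lt_add_one s))
    (Eventually.of_forall fun x => (hF x).aestronglyMeasurable) ((hF s).intervalIntegrable _ _)
    ?_ ?_ intervalIntegrable_const ?_).2
  · exact (hgc.mul (by fun_prop)).aestronglyMeasurable
  · refine Eventually.of_forall fun y _ x hx => ?_
    refine (norm_integrand_le (s := x) hc fun i => ?_).trans ?_
    · refine le_trans ?_ ((le_abs_self _).trans (Complex.abs_re_le_norm _))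
      simp [verticalLine, (hpos i).le]
    · have hB : 0 ≤ gBound g n c := by unfold gBound; positivity
      have hre : (verticalLine c y).re = c := by simp [verticalLine]
      rw [hre]
      have := le_of_lt (mem_Iio.1 hx)
      gcongr
  · refine Eventually.of_forall fun y _ x _ => ?_
    have h1 : HasDerivAt (fun x : ℝ => (x : ℂ) * verticalLine c y) (1 * verticalLine c y) x :=
      (Complex.ofRealCLM.hasDerivAt (x := x)).mul_const (verticalLine c y)
    have := (h1.cexp).const_mul (gFun θ g n (verticalLine c y) / verticalLine c y)
    refine this.congr_deriv ?_
    unfold integrand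
    have := verticalLine_ne_zero hc y
    field_simp

/-- The error bound depends on `s` only through `e^{sc} / s`, which is locally bounded on `(0, ∞)`.
-/
theorem tendstoLocallyUniformlyOn_truncatedInversion (hm : 0 < m) (hn : ∀ i, 1 ≤ n i)
    (hpos : ∀ i, 0 < θ i) (hθ : StrictMono θ) {c : ℝ} (hc : 0 < c) :
    TendstoLocallyUniformlyOn (fun R s => truncatedInversion θ g n c s R)
      (fun s => (chiSqDensity θ g n s : ℂ)) atTop (Ioi 0) := by
  rw [Metric.tendstoLocallyUniformlyOn_iff]
  intro ε hε x hx
  set φ : ℝ → ℝ := fun s => Real.exp (s * c) / s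
  have hφ : ContinuousAt φ x := ContinuousAt.div (by fun_prop) continuousAt_id (ne_of_gt hx)
  have hlim : Tendsto (fun R => |kappa θ g n| / Real.pi * (gBound g n R * (φ x + 1))) atTop
      (𝓝 0) := by
    have := ((tendsto_gBound g hm hn).mul_const (φ x + 1)).const_mul (|kappa θ g n| / Real.pi)
    simpa using this
  refine ⟨{s | φ s < φ x + 1} ∩ Ioi 0, inter_mem (mem_nhdsWithin_of_mem_nhds
    (hφ.eventually_lt continuousAt_const (by simp))) self_mem_nhdsWithin, ?_⟩
  filter_upwards [hlim.eventually_lt_const hε, eventually_gt_atTop 0] with R hR hR0 s hs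
  have hs0 : 0 < s := hs.2
  have hsφ : φ s < φ x + 1 := hs.1
  rw [dist_comm, dist_eq_norm]
  refine (norm_truncatedInversion_sub_chiSqDensity_le hm hn hpos hθ hs0
    (fun i => by linarith [hpos i]) hR0).trans_lt (lt_of_le_of_lt ?_ hR)
  rw [mul_div_assoc]
  have hB : 0 ≤ gBound g n R := by unfold gBound; positivity
  have := Real.pi_pos
  change |kappa θ g n| / Real.pi * (gBound g n R * φ s) ≤ _
  gcongr

/-- The function `f_{θ, γ², n}` is the derivative of the distribution function. -/
theorem IsChiSqCombination.hasDerivAt_cdf (hm : 0 < m) (hn : ∀ i, 1 ≤ n i) (hpos : ∀ i, 0 < θ i)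
    (hθ : StrictMono θ) (hg : ∀ i, 0 ≤ g i) (hX : IsChiSqCombination P θ g n X) {s : ℝ}
    (hs : 0 < s) : HasDerivAt (cdf (P.map X)) (chiSqDensity θ g n s) s := by
  obtain ⟨-, h2⟩ := hX.cdf_eq hm hn hpos hg one_pos
  -- The truncated integrals converge pointwise to the distribution function and their derivatives
  -- locally uniformly. The line through `1` is an arbitrary choice.
  have h := hasDerivAt_of_tendstoLocallyUniformlyOn (𝕜 := ℝ) (g := fun s : ℝ => (cdf (P.map X) s : ℂ))
    (f := fun R s => cdfInversion θ g n 1 s R) isOpen_Ioi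
    (tendstoLocallyUniformlyOn_truncatedInversion hm hn hpos hθ one_pos)
    (Eventually.of_forall fun R x _ => hasDerivAt_cdfInversion hpos one_pos x R)
    (fun x _ => by rw [h2 x]; exact tendsto_cdfInversion hm hn hpos one_pos x) hs
  have := Complex.reCLM.hasFDerivAt.comp_hasDerivAt s h
  simpa [Function.comp_def] using this

/-- The function `f_{θ, γ², n}` is a density. -/
theorem IsChiSqCombination.isDensityOf (hm : 0 < m) (hn : ∀ i, 1 ≤ n i) (hpos : ∀ i, 0 < θ i)
    (hθ : StrictMono θ) (hg : ∀ i, 0 ≤ g i) (hX : IsChiSqCombination P θ g n X) :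
    IsDensityOf P X (chiSqDensity θ g n) := by
  have : IsProbabilityMeasure (P.map X) := Measure.isProbabilityMeasure_map hX.aemeasurable
  set F := cdf (P.map X) with hF
  obtain ⟨hcont, -⟩ := hX.cdf_eq hm hn hpos hg one_pos
  have hder : ∀ s, 0 < s → HasDerivAt F (chiSqDensity θ g n s) s := fun s hs =>
    hX.hasDerivAt_cdf hm hn hpos hθ hg hs
  have hzero : ∀ s, s ≤ 0 → chiSqDensity θ g n s = 0 := fun s hs => if_neg (not_lt.2 hs)
  have hnn : ∀ s, 0 ≤ chiSqDensity θ g n s := by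
    intro s
    rcases le_or_gt s 0 with h | h
    · exact (hzero s h).ge
    · rw [← (hder s h).deriv]
      exact (monotone_cdf _).deriv_nonneg
  have hmeas : Measurable (chiSqDensity θ g n) := by
    have : chiSqDensity θ g n = (Ioi 0).indicator (deriv F) := by
      funext s
      by_cases h : 0 < s
      · rw [indicator_of_mem (mem_Ioi.2 h), (hder s h).deriv]
      · rw [indicator_of_notMem (by simpa using h), hzero s (not_lt.1 h)]
    rw [this]
    exact (measurable_deriv _).indicator measurableSet_Ioi
  have hneg : ∀ s, s < 0 → F s = 0 := by
    intro s hs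
    rw [hF, cdf_eq_real, measureReal_def, Measure.map_apply_of_aemeasurable hX.aemeasurable
      measurableSet_Iic]
    have : P (X ⁻¹' Iic s) = 0 := by
      refine measure_mono_null (fun ω hω => ?_) (ae_iff.1 (hX.ae_nonneg hpos))
      exact not_le.2 ((mem_Iic.1 hω).trans_lt hs)
    rw [this]; rfl
  -- Continuity excludes an atom at `0`.
  have hF0 : ∀ s, s ≤ 0 → F s = 0 := by
    have hcl : IsClosed {s | F s = 0} := isClosed_eq hcont continuous_const
    have h1 : closure (Iio (0 : ℝ)) ⊆ {s | F s = 0} := closure_minimal hneg hcl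
    rw [closure_Iio] at h1
    exact h1
  refine ⟨hmeas, hnn, Measure.ext_of_Iic _ _ fun a => ?_⟩
  rw [← ofReal_cdf, withDensity_apply _ measurableSet_Iic]
  have hIic : ∫⁻ s in Iic 0, ENNReal.ofReal (chiSqDensity θ g n s) = 0 := by
    rw [setLIntegral_congr_fun measurableSet_Iic (g := fun _ => 0) fun s hs => by
      simp only; rw [hzero s hs, ENNReal.ofReal_zero]]
    simp
  rcases le_or_gt a 0 with ha | ha
  · rw [← hF, hF0 a ha, ENNReal.ofReal_zero]
    exact (le_antisymm ((lintegral_mono_set (Iic_subset_Iic.2 ha)).trans hIic.le) zero_le).symm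
  -- The density may be unbounded near `0`; integrability follows from its being a nonnegative
  -- derivative of a function continuous up to `0`.
  · have hint : IntegrableOn (chiSqDensity θ g n) (Ioc 0 a) :=
      intervalIntegral.integrableOn_deriv_of_nonneg hcont.continuousOn
        (fun x hx => hder x hx.1) fun x _ => hnn x
    have hftc : ∫ y in (0 : ℝ)..a, chiSqDensity θ g n y = F a - F 0 :=
      intervalIntegral.integral_eq_sub_of_hasDerivAt_of_le ha.le hcont.continuousOn
        (fun x hx => hder x hx.1) ((intervalIntegrable_iff_integrableOn_Ioc_of_le ha.le).2 hint)
    rw [← Iic_union_Ioc_eq_Iic ha.le, lintegral_union measurableSet_Ioc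
      (Iic_disjoint_Ioc le_rfl), hIic, zero_add,
      ← ofReal_integral_eq_lintegral_ofReal hint (Eventually.of_forall hnn),
      ← intervalIntegral.integral_of_le ha.le, hftc, hF0 0 le_rfl, sub_zero]

end Density

/-! ### The auxiliary exponential summand -/

section Tilde

variable {p : ℕ} {θ g : Fin p → ℝ} {n : Fin p → ℕ} {θ₀ : ℝ}

theorem tildeTheta_pos (h₀ : 0 < θ₀) (hpos : ∀ i, 0 < θ i) (i : Fin (p + 1)) :
    0 < tildeTheta θ₀ θ i := by
  refine Fin.cases ?_ (fun j => ?_) i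
  · exact h₀
  · exact add_pos (hpos j) h₀

theorem strictMono_tildeTheta (hpos : ∀ i, 0 < θ i) (hθ : StrictMono θ) :
    StrictMono (tildeTheta θ₀ θ) := by
  intro i j
  refine Fin.cases ?_ (fun j => ?_) j
  · intro h; exact absurd h (Fin.not_lt_zero _)
  · refine Fin.cases ?_ (fun i => ?_) i
    · intro _
      simp only [tildeTheta, Fin.cons_zero, Fin.cons_succ]
      linarith [hpos j]
    · intro h
      simp only [tildeTheta, Fin.cons_succ]
      have := hθ (Fin.succ_lt_succ_iff.1 h)
      linarith

theorem one_le_tildeN (hn : ∀ i, 1 ≤ n i) (i : Fin (p + 1)) : 1 ≤ tildeN n i := by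
  refine Fin.cases ?_ (fun j => ?_) i
  · simp [tildeN]
  · simpa [tildeN] using hn j

theorem tildeG_nonneg (hg : ∀ i, 0 ≤ g i) (i : Fin (p + 1)) : 0 ≤ tildeG g i := by
  refine Fin.cases ?_ (fun j => ?_) i
  · simp [tildeG]
  · simpa [tildeG] using hg j

/-- The summand with two degrees of freedom and no noncentrality contributes exactly `1 / (θ₀ + t)`.
-/
theorem gFun_tilde (t : ℂ) : gFun (tildeTheta θ₀ θ) (tildeG g) (tildeN n) t =
    gFun θ g n (θ₀ + t) / (θ₀ + t) := by
  unfold gFun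
  rw [Fin.sum_univ_succ, Fin.prod_univ_succ]
  simp only [tildeTheta, tildeG, tildeN, Fin.cons_zero, Fin.cons_succ, Complex.ofReal_zero,
    zero_div, zero_add, Nat.cast_ofNat, Complex.ofReal_add]
  rw [div_self two_ne_zero, Complex.cpow_one, div_div, mul_comm]
  simp only [add_assoc]

theorem kappa_tilde (h₀ : 0 < θ₀) (hpos : ∀ i, 0 < θ i) :
    kappa θ g n = kappa (tildeTheta θ₀ θ) (tildeG g) (tildeN n) / θ₀ *
      (∏ i, (θ i / (θ i + θ₀)) ^ ((n i : ℝ) / 2)) *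
      Real.exp (-∑ i, g i * θ₀ / (4 * θ i * (θ i + θ₀))) := by
  unfold kappa
  rw [Fin.sum_univ_succ, Fin.prod_univ_succ]
  simp only [tildeTheta, tildeG, tildeN, Fin.cons_zero, Fin.cons_succ, zero_div, zero_add,
    Nat.cast_ofNat]
  rw [div_self two_ne_zero, Real.rpow_one]
  have h1 : ∏ i, (θ i / (θ i + θ₀)) ^ ((n i : ℝ) / 2) =
      (∏ i, θ i ^ ((n i : ℝ) / 2)) / ∏ i, (θ i + θ₀) ^ ((n i : ℝ) / 2) := by
    rw [← Finset.prod_div_distrib]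
    exact Finset.prod_congr rfl fun i _ =>
      Real.div_rpow (hpos i).le (add_pos (hpos i) h₀).le _
  have h2 : Real.exp (-∑ i, g i / (4 * θ i)) = Real.exp (-∑ i, g i / (4 * (θ i + θ₀))) *
      Real.exp (-∑ i, g i * θ₀ / (4 * θ i * (θ i + θ₀))) := by
    rw [← Real.exp_add]
    congr 1
    rw [← neg_add, ← Finset.sum_add_distrib]
    congr 1
    refine Finset.sum_congr rfl fun i _ => ?_
    have := (hpos i).ne'
    have := (add_pos (hpos i) h₀).ne'
    field_simp
  have h3 : (∏ i, (θ i + θ₀) ^ ((n i : ℝ) / 2)) ≠ 0 :=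
    Finset.prod_ne_zero_iff.2 fun i _ => (Real.rpow_pos_of_pos (add_pos (hpos i) h₀) _).ne'
  rw [h1, h2]
  field_simp

/-- Moving the variable from the line through `0` to the line through `θ₀` extracts `e^{sθ₀}`;
cross-multiplying by the two constants `κ` avoids division. -/
theorem truncatedInversion_tilde (s R : ℝ) :
    kappa θ g n * (Complex.exp (s * θ₀) *
      truncatedInversion (tildeTheta θ₀ θ) (tildeG g) (tildeN n) 0 s R) =
    kappa (tildeTheta θ₀ θ) (tildeG g) (tildeN n) * cdfInversion θ g n θ₀ s R := by
  rw [truncatedInversion_eq, cdfInversion]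
  have : ∀ y : ℝ, gFun θ g n (verticalLine θ₀ y) / verticalLine θ₀ y *
      Complex.exp (s * verticalLine θ₀ y) = Complex.exp (s * θ₀) *
        integrand (tildeTheta θ₀ θ) (tildeG g) (tildeN n) s (verticalLine 0 y) := by
    intro y
    have h : (θ₀ : ℂ) + verticalLine 0 y = verticalLine θ₀ y := by simp [verticalLine]
    unfold integrand
    rw [gFun_tilde, h, ← h, mul_add, Complex.exp_add, h]
    ring
  simp only [this]
  rw [intervalIntegral.integral_const_mul]
  ring

variable {Ω : Type*} [MeasurableSpace Ω] {P : Measure Ω} [IsProbabilityMeasure P] {X : Ω → ℝ}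

/-- The distribution function in terms of the density of the enlarged combination. -/
theorem IsChiSqCombination.measureReal_le_eq (hp : 0 < p) (hn : ∀ i, 1 ≤ n i)
    (hpos : ∀ i, 0 < θ i) (hθ : StrictMono θ) (hg : ∀ i, 0 ≤ g i)
    (hX : IsChiSqCombination P θ g n X) (h₀ : 0 < θ₀) {x : ℝ} (hx : 0 < x) :
    P.real {ω | X ω ≤ x} = Real.exp (x * θ₀) / θ₀ *
      chiSqDensity (tildeTheta θ₀ θ) (tildeG g) (tildeN n) x *
      (∏ i, (θ i / (θ i + θ₀)) ^ ((n i : ℝ) / 2)) *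
      Real.exp (-∑ i, g i * θ₀ / (4 * θ i * (θ i + θ₀))) := by
  have : IsProbabilityMeasure (P.map X) := Measure.isProbabilityMeasure_map hX.aemeasurable
  set κ' := kappa (tildeTheta θ₀ θ) (tildeG g) (tildeN n) with hκ'
  have hκ0 : κ' ≠ 0 := mul_ne_zero (Finset.prod_ne_zero_iff.2 fun i _ =>
    (Real.rpow_pos_of_pos (tildeTheta_pos h₀ hpos i) _).ne') (Real.exp_pos _).ne'
  have hcdf : P.real {ω | X ω ≤ x} = cdf (P.map X) x := by
    rw [cdf_eq_real, measureReal_def, measureReal_def,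
      Measure.map_apply_of_aemeasurable hX.aemeasurable measurableSet_Iic]
    rfl
  have ht1 := (tendsto_cdfInversion (g := g) hp hn hpos h₀ x).const_mul (κ' : ℂ)
  rw [← (hX.cdf_eq hp hn hpos hg h₀).2 x] at ht1
  have ht2 := ((tendsto_truncatedInversion (g := tildeG g) (Nat.succ_pos p) (one_le_tildeN hn)
    (tildeTheta_pos h₀ hpos) (strictMono_tildeTheta (θ₀ := θ₀) hpos hθ) hx (t₀ := 0)
    (fun i => by simpa using tildeTheta_pos h₀ hpos i)).const_mul
      (Complex.exp (x * θ₀))).const_mul (kappa θ g n : ℂ)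
  have h3 := tendsto_nhds_unique (ht2.congr fun R => truncatedInversion_tilde x R) ht1
  have h4 : kappa θ g n * (Real.exp (x * θ₀) *
      chiSqDensity (tildeTheta θ₀ θ) (tildeG g) (tildeN n) x) = κ' * cdf (P.map X) x := by
    exact_mod_cast h3
  rw [kappa_tilde h₀ hpos, ← hκ'] at h4
  rw [hcdf]
  refine mul_left_cancel₀ hκ0 (h4.symm.trans ?_)
  ring

end Tilde

theorem theorem1 {p : ℕ} (hp : 0 < p) (θ γ : Fin p → ℝ) (n : Fin p → ℕ)
    (hθ : ∀ i, 0 < θ i) (hmono : StrictMono θ) (hn : ∀ i, 1 ≤ n i)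
    {Ω : Type*} [MeasurableSpace Ω] (P : Measure Ω) [IsProbabilityMeasure P] (X : Ω → ℝ)
    (hX : IsChiSqCombination P θ (fun i => γ i ^ 2) n X) :
    -- the inversion integral converges, does not depend on the line, and is the density of `X`
    (∀ s : ℝ, 0 < s → ∀ t₀ : ℝ, (∀ i, -θ i < t₀) →
      Tendsto (truncatedInversion θ (fun i => γ i ^ 2) n t₀ s) atTop
        (𝓝 (chiSqDensity θ (fun i => γ i ^ 2) n s : ℂ))) ∧
    IsDensityOf P X (chiSqDensity θ (fun i => γ i ^ 2) n) ∧
    (∀ s : ℝ, 0 < s → chiSqDensity θ (fun i => γ i ^ 2) n s =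
      chiSqDensity (fun i => s * θ i) (fun i => s * γ i ^ 2) n 1 / s) ∧
    -- the density as a finite sum of contour integrals
    (∃ Γ : Fin p → ℝ → ℂ, IsContourSystem θ n Γ) ∧
    (∀ Γ : Fin p → ℝ → ℂ, IsContourSystem θ n Γ → ∀ s : ℝ, 0 < s →
      ∃ J : Fin p → ℂ,
        (∀ i ∈ cutStarts n ∪ typeOne n,
          HasIntegralAlong n i (integrand θ (fun i => γ i ^ 2) n s) (Γ i) (J i)) ∧
        (chiSqDensity θ (fun i => γ i ^ 2) n s : ℂ) =
          (kappa θ (fun i => γ i ^ 2) n : ℂ) *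
            (1 / (2 * (Real.pi : ℂ) * Complex.I) * ∑ i ∈ cutStarts n, J i +
              1 / (2 * (Real.pi : ℂ) * Complex.I) * ∑ i ∈ typeOne n, J i)) ∧
    -- the distribution function
    (∀ θ₀ : ℝ, 0 < θ₀ →
      (∀ {Ω' : Type*} [MeasurableSpace Ω'] (P' : Measure Ω') [IsProbabilityMeasure P']
        (X' : Ω' → ℝ),
        IsChiSqCombination P' (tildeTheta θ₀ θ) (tildeG (fun i => γ i ^ 2)) (tildeN n) X' →
          IsDensityOf P' X'
            (chiSqDensity (tildeTheta θ₀ θ) (tildeG (fun i => γ i ^ 2)) (tildeN n))) ∧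
      ∀ x : ℝ, 0 < x →
        P.real {ω | X ω ≤ x} =
          Real.exp (x * θ₀) / θ₀ *
            chiSqDensity (tildeTheta θ₀ θ) (tildeG (fun i => γ i ^ 2)) (tildeN n) x *
            (∏ i, (θ i / (θ i + θ₀)) ^ ((n i : ℝ) / 2)) *
            Real.exp (-∑ i, γ i ^ 2 * θ₀ / (4 * θ i * (θ i + θ₀))) ∧
        P.real {ω | X ω ≤ x} =
          Real.exp (x * θ₀) / (x * θ₀) *
            chiSqDensity (fun i => x * tildeTheta θ₀ θ i)
              (fun i => x * tildeG (fun i => γ i ^ 2) i) (tildeN n) 1 *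
            (∏ i, (θ i / (θ i + θ₀)) ^ ((n i : ℝ) / 2)) *
            Real.exp (-∑ i, γ i ^ 2 * θ₀ / (4 * θ i * (θ i + θ₀)))) := by
  have hg : ∀ i, 0 ≤ γ i ^ 2 := fun i => sq_nonneg _
  refine ⟨fun s hs t₀ ht => tendsto_truncatedInversion hp hn hθ hmono hs ht,
    hX.isDensityOf hp hn hθ hmono hg, fun s hs => chiSqDensity_scale hp hn hθ hmono hs,
    exists_isContourSystem hmono n,
    fun Γ hΓ s hs => exists_chiSqDensity_eq_sum_contourIntegral hp hn hθ hmono hs hΓ,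
    fun θ₀ h₀ => ⟨fun P' _ X' hX' => hX'.isDensityOf (Nat.succ_pos p) (one_le_tildeN hn)
      (tildeTheta_pos h₀ hθ) (strictMono_tildeTheta hθ hmono) (tildeG_nonneg hg),
      fun x hx => ⟨hX.measureReal_le_eq hp hn hθ hmono hg h₀ hx, ?_⟩⟩⟩
  rw [hX.measureReal_le_eq hp hn hθ hmono hg h₀ hx, chiSqDensity_scale (Nat.succ_pos p)
    (one_le_tildeN hn) (tildeTheta_pos h₀ hθ) (strictMono_tildeTheta hθ hmono) hx]
  field_simp
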